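/- **Setting.** Let $\mathcal T_0$ be a tensor-product mesh of a closed rectangle $\Omega\subset\mathbb R^2$. A hierarchical T-mesh $\mathcal T_h$ over $\mathcal T_0$ is obtained from $\mathcal T_0$ by finitely many refinement stages, in each of which selected (closed) elements are subdivided into four congruent subelements. Diameters are taken in the maximum norm, and $h$ is the largest diameter of an element of $\mathcal T_h$. A *basis vertex* is an element corner that lies on $\partial\Omega$ or is a crossing vertex (a corner of every element containing it, i.e. not a T-junction); $\mathcal N_h$ is the set of basis vertices. Let $V_h$ be the space of $C^1$ functions on $\Omega$ that are bicubic on every element, and put $\mathcal Gf=(f,f_x,f_y,f_{xy})$. A function $s\in V_h$ is determined by the values $\mathcal Gs(z)$, $z\in\mathcal N_h$, which can be prescribed arbitrarily; $I_hf\in V_h$ is the spline with $\mathcal G(I_hf)(z)=\mathcal Gf(z)$ for all $z\in\mathcal N_h$. **Recovery operator.** Assume that $\mathcal N_h$ determines quartic polynomials (a polynomial of total degree $\le 4$ vanishing on $\mathcal N_h$ is zero). For $z\in\mathcal N_h$ put $\mathcal L(z,0)=\{z\}$, and let $\mathcal L(z,n)$ be the union of all elements that meet $\mathcal L(z,n-1)$.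 Let $n_z$ be the smallest $n$ such that $B_z^n:=\mathcal N_h\cap\mathcal L(z,n)$ determines quartic polynomials, and put $B_z=B_z^{n_z}$, $\Omega_z=\mathcal L(z,n_z)$. For $w\in V_h$ let $p_z$ be the polynomial of degree $\le 4$ minimizing $\sum_{b\in B_z}|p(b)-w(b)|^2$. The recovered gradient $G_hw\in V_h\times V_h$ is the pair of splines $(g^x,g^y)$ with $\mathcal Gg^x(z)=\mathcal G(\partial_xp_z)(z)$ and $\mathcal Gg^y(z)=\mathcal G(\partial_yp_z)(z)$ for all $z\in\mathcal N_h$. For an element $K$, call $z\in\mathcal N_h$ *active on $K$* if some $s\in V_h$ with $\mathcal Gs(z')=0$ for all $z'\in\mathcal N_h\setminus\{z\}$ does not vanish identically on $K$ (that is, a basis function belonging to $z$ does not vanish on $K$), and let $\Omega_K$ be the union of $\Omega_z$ over all $z$ active on $K$. (If the four corners of $K$ are basis vertices, these are exactly the basis vertices active on $K$.) **Theorem.** For every $\mathcal T_0$ and every $M$ there is a constant $C$, depending only on $\mathcal T_0$ and $M$, such that the following holds for every hierarchical T-mesh $\mathcal T_h$ over $\mathcal T_0$ whose basis vertices determine quartic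 polynomials and for every element $K\in\mathcal T_h$ with $$\operatorname{diam}\Omega_K\le M\operatorname{diam}K'\qquad\text{for all }K'\in\mathcal T_h,\ K'\subset\Omega_K .$$ If $u\in H^5(\operatorname{int}\Omega_K)$ is continuous on $\Omega_K$ (i.e. $u$ is the continuous representative; its values outside $\Omega_K$ are irrelevant for $G_h(I_hu)|_K$), then $$\|\nabla u-G_h(I_hu)\|_{L^2(K)}\le C\,h^4\,\|u\|_{H^5(\operatorname{int}\Omega_K)} .$$ -/

import Mathlib

open MeasureTheory Set
open scoped ENNReal ContDiff

noncomputable section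

namespace PHT

/-! ### Rectangles and hierarchical T-meshes -/

/-- The data of an axis-parallel rectangle `[x₀, x₁] × [y₀, y₁]`. -/
@[ext] structure Rect where
  x₀ : ℝ
  x₁ : ℝ
  y₀ : ℝ
  y₁ : ℝ

/-- The closed rectangle as a subset of the plane. -/
def Rect.carrier (K : Rect) : Set (ℝ × ℝ) := Icc K.x₀ K.x₁ ×ˢ Icc K.y₀ K.y₁

open scoped Classical in
/-- The four corners of a rectangle. -/
def Rect.corners (K : Rect) : Finset (ℝ × ℝ) :=
  {(K.x₀, K.y₀), (K.x₁, K.y₀), (K.x₀, K.y₁), (K.x₁, K.y₁)}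

open scoped Classical in
/-- The four congruent subrectangles of a rectangle. -/
def Rect.children (K : Rect) : Finset Rect :=
  {⟨K.x₀, (K.x₀ + K.x₁) / 2, K.y₀, (K.y₀ + K.y₁) / 2⟩,
   ⟨(K.x₀ + K.x₁) / 2, K.x₁, K.y₀, (K.y₀ + K.y₁) / 2⟩,
   ⟨K.x₀, (K.x₀ + K.x₁) / 2, (K.y₀ + K.y₁) / 2, K.y₁⟩,
   ⟨(K.x₀ + K.x₁) / 2, K.x₁, (K.y₀ + K.y₁) / 2, K.y₁⟩}

/-- A tensor-product mesh, given by its mesh lines `x 0 < ⋯ < x m` and `y 0 < ⋯ < y n`. -/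
structure TensorMesh where
  m : ℕ
  n : ℕ
  m_pos : 0 < m
  n_pos : 0 < n
  x : Fin (m + 1) → ℝ
  y : Fin (n + 1) → ℝ
  x_strictMono : StrictMono x
  y_strictMono : StrictMono y

/-- The rectangular domain `Ω` that is covered by a tensor-product mesh. -/
def TensorMesh.domain (T₀ : TensorMesh) : Rect :=
  ⟨T₀.x 0, T₀.x (Fin.last T₀.m), T₀.y 0, T₀.y (Fin.last T₀.n)⟩

open scoped Classical in
/-- The elements of a tensor-product mesh. -/
def TensorMesh.elements (T₀ : TensorMesh) : Finset Rect :=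
  (Finset.univ : Finset (Fin T₀.m × Fin T₀.n)).image fun i =>
    ⟨T₀.x i.1.castSucc, T₀.x i.1.succ, T₀.y i.2.castSucc, T₀.y i.2.succ⟩

open scoped Classical in
/-- Hierarchical T-meshes over `T₀`: in each refinement stage, selected elements are subdivided
into four congruent subelements. -/
inductive IsHierarchical (T₀ : TensorMesh) : Finset Rect → Prop
  | init : IsHierarchical T₀ T₀.elements
  | refine (T S : Finset Rect) : IsHierarchical T₀ T → S ⊆ T →
      IsHierarchical T₀ ((T \ S) ∪ S.biUnion Rect.children)

/-- The mesh size `h`: the largest diameter of an element. (The plane `ℝ × ℝ` carries the maximum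
norm, so this is the longest edge of the mesh elements.) -/
def meshSize (T : Finset Rect) : ℝ :=
  sSup ((fun K : Rect => Metric.diam K.carrier) '' (T : Set Rect))

open scoped Classical in
/-- The vertices of a mesh: the corners of its elements. -/
def vertices (T : Finset Rect) : Finset (ℝ × ℝ) := T.biUnion Rect.corners

open scoped Classical in
/-- The basis vertices: the boundary vertices and the crossing vertices, that is, the vertices
that do not lie in the relative interior of an edge of an element (no T-junctions). -/
def basisVertices (Ω : Rect) (T : Finset Rect) : Finset (ℝ × ℝ) :=
  (vertices T).filter fun z =>
    z ∈ frontier Ω.carrier ∨ ∀ K ∈ T, z ∈ K.carrier → z ∈ K.corners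

/-! ### The spline space and interpolation of geometric information -/

/-- The partial derivative in `x` on the closed rectangle `Ω` (one-sided on the boundary). -/
def dx (Ω : Rect) (f : ℝ × ℝ → ℝ) (v : ℝ × ℝ) : ℝ :=
  derivWithin (fun t => f (t, v.2)) (Icc Ω.x₀ Ω.x₁) v.1

/-- The partial derivative in `y` on the closed rectangle `Ω` (one-sided on the boundary). -/
def dy (Ω : Rect) (f : ℝ × ℝ → ℝ) (v : ℝ × ℝ) : ℝ :=
  derivWithin (fun t => f (v.1, t)) (Icc Ω.y₀ Ω.y₁) v.2

/-- The geometric information `𝒢 f = (f, f_x, f_y, f_xy)`. -/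
def geom (Ω : Rect) (f : ℝ × ℝ → ℝ) (v : ℝ × ℝ) : Fin 4 → ℝ :=
  ![f v, dx Ω f v, dy Ω f v, dx Ω (dy Ω f) v]

/-- Membership in the space `V_h = 𝒮(3, 3, 1, 1, T)` of bicubic `C¹` splines. Only the values on
the closed domain `Ω` matter. -/
def IsSpline (Ω : Rect) (T : Finset Rect) (s : ℝ × ℝ → ℝ) : Prop :=
  ContDiffOn ℝ 1 s Ω.carrier ∧
    ∀ K ∈ T, ∃ c : ℕ → ℕ → ℝ, ∀ v ∈ K.carrier,
      s v = ∑ i ∈ Finset.range 4, ∑ j ∈ Finset.range 4, c i j * v.1 ^ i * v.2 ^ j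

/-- The spline with prescribed geometric information `d z` at every basis vertex `z`. On `Ω` this
is the combination `∑ z, c_z ⬝ φ_z` of the PHT basis functions with coefficients
`c_z = B_z⁻¹ (d z)`, since `𝒢 φ_z` vanishes at all basis vertices other than `z`, and
`B_z = 𝒢 φ_zᵀ (z)`. -/
def interpSpline (Ω : Rect) (T : Finset Rect) (d : ℝ × ℝ → Fin 4 → ℝ) : ℝ × ℝ → ℝ :=
  Classical.epsilon fun s => IsSpline Ω T s ∧ ∀ z ∈ basisVertices Ω T, geom Ω s z = d z

/-- The interpolation operator `I_h`. -/
def interp (Ω : Rect) (T : Finset Rect) (f : ℝ × ℝ → ℝ) : ℝ × ℝ → ℝ :=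
  interpSpline Ω T (geom Ω f)

/-! ### The polynomial preserving recovery operator -/

/-- Bivariate polynomial functions of total degree at most four. -/
def IsQuartic (p : ℝ × ℝ → ℝ) : Prop :=
  ∃ c : ℕ → ℕ → ℝ, ∀ v : ℝ × ℝ,
    p v = ∑ i ∈ Finset.range 5, ∑ j ∈ Finset.range (5 - i), c i j * v.1 ^ i * v.2 ^ j

/-- A finite set of points determines quartic polynomials uniquely (equivalently: quartic
least-squares fits to data on these points are unique). -/
def DeterminesQuartics (B : Finset (ℝ × ℝ)) : Prop :=
  ∀ p, IsQuartic p → (∀ z ∈ B, p z = 0) → ∀ v, p v = 0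

/-- The `n`-th layer `ℒ(z, n)` around `z`. -/
def layer (T : Finset Rect) (z : ℝ × ℝ) : ℕ → Set (ℝ × ℝ)
  | 0 => {z}
  | n + 1 => ⋃ K ∈ T, ⋃ (_ : (K.carrier ∩ layer T z n).Nonempty), K.carrier

open scoped Classical in
/-- The basis vertices in `ℒ(z, n)`. -/
def layerPoints (Ω : Rect) (T : Finset Rect) (z : ℝ × ℝ) (n : ℕ) : Finset (ℝ × ℝ) :=
  (basisVertices Ω T).filter fun w => w ∈ layer T z n

/-- The smallest number `n_z` of layers whose basis vertices determine quartic polynomials. -/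
def layerNumber (Ω : Rect) (T : Finset Rect) (z : ℝ × ℝ) : ℕ :=
  sInf {n | DeterminesQuartics (layerPoints Ω T z n)}

/-- The sampling points `B_z`. -/
def samplingPoints (Ω : Rect) (T : Finset Rect) (z : ℝ × ℝ) : Finset (ℝ × ℝ) :=
  layerPoints Ω T z (layerNumber Ω T z)

/-- The local patch `Ω_z`. -/
def vertexPatch (Ω : Rect) (T : Finset Rect) (z : ℝ × ℝ) : Set (ℝ × ℝ) :=
  layer T z (layerNumber Ω T z)

/-- The quartic least-squares fit `p_z` to the values of `w` at the sampling points `B_z`. -/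
def fit (Ω : Rect) (T : Finset Rect) (w : ℝ × ℝ → ℝ) (z : ℝ × ℝ) : ℝ × ℝ → ℝ :=
  Classical.epsilon fun p => IsQuartic p ∧ ∀ q, IsQuartic q →
    ∑ b ∈ samplingPoints Ω T z, (p b - w b) ^ 2 ≤ ∑ b ∈ samplingPoints Ω T z, (q b - w b) ^ 2

/-- The recovered gradient `G_h w`: its two components are the splines whose geometric information
at each basis vertex `z` is `𝒢 (∂p_z/∂x) (z)` and `𝒢 (∂p_z/∂y) (z)`, respectively. -/
def recoveredGradient (Ω : Rect) (T : Finset Rect) (w : ℝ × ℝ → ℝ) (v : ℝ × ℝ) :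
    EuclideanSpace ℝ (Fin 2) :=
  !₂[interpSpline Ω T (fun z => geom Ω (dx Ω (fit Ω T w z)) z) v,
     interpSpline Ω T (fun z => geom Ω (dy Ω (fit Ω T w z)) z) v]

/-- The basis vertex `z` is active on `K`: some spline in the span of the four basis functions
of `z`, i.e. with zero geometric information at all other basis vertices, is not identically zero
on `K`. All basis vertices in `K` are active on `K`; if the four corners of `K` are basis vertices,
there are no others. -/
def IsActive (Ω : Rect) (T : Finset Rect) (K : Rect) (z : ℝ × ℝ) : Prop :=
  z ∈ basisVertices Ω T ∧ ∃ s, IsSpline Ω T s ∧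
    (∀ z' ∈ basisVertices Ω T, z' ≠ z → geom Ω s z' = 0) ∧ ∃ v ∈ K.carrier, s v ≠ 0

/-- The patch `Ω_K`: the union of the patches `Ω_z` over all basis vertices `z` active on `K`. -/
def elementPatch (Ω : Rect) (T : Finset Rect) (K : Rect) : Set (ℝ × ℝ) :=
  ⋃ z, ⋃ (_ : IsActive Ω T K z), vertexPatch Ω T z

/-! ### Sobolev spaces of integer order, with exponent two -/

/-- The classical partial derivative `∂^(a+b) f / ∂x^a ∂y^b` of a smooth function. -/
def partialDeriv (a b : ℕ) (f : ℝ × ℝ → ℝ) : ℝ × ℝ → ℝ :=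
  (fun (g : ℝ × ℝ → ℝ) v => fderiv ℝ g v (1, 0))^[a]
    ((fun (g : ℝ × ℝ → ℝ) v => fderiv ℝ g v (0, 1))^[b] f)

/-- `w` is a square integrable weak derivative of `u` of order `(a, b)` on the open set `U`. -/
def IsWeakDeriv (U : Set (ℝ × ℝ)) (a b : ℕ) (u w : ℝ × ℝ → ℝ) : Prop :=
  MemLp w 2 (volume.restrict U) ∧
    ∀ φ : ℝ × ℝ → ℝ, ContDiff ℝ ∞ φ → HasCompactSupport φ → tsupport φ ⊆ U →
      ∫ v in U, u v * partialDeriv a b φ v = (-1) ^ (a + b) * ∫ v in U, w v * φ v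

/-- `u ∈ H^k(U)`. -/
def MemSobolev (k : ℕ) (U : Set (ℝ × ℝ)) (u : ℝ × ℝ → ℝ) : Prop :=
  MemLp u 2 (volume.restrict U) ∧ ∀ a b, a + b ≤ k → ∃ w, IsWeakDeriv U a b u w

/-- A representative of the weak derivative of `u` of order `(a, b)` on `U`; it is unique almost
everywhere on `U`. -/
def weakDeriv (U : Set (ℝ × ℝ)) (a b : ℕ) (u : ℝ × ℝ → ℝ) : ℝ × ℝ → ℝ :=
  Classical.epsilon (IsWeakDeriv U a b u)

/-- The weak gradient of `u` on `U`. -/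
def weakGradient (U : Set (ℝ × ℝ)) (u : ℝ × ℝ → ℝ) (v : ℝ × ℝ) : EuclideanSpace ℝ (Fin 2) :=
  !₂[weakDeriv U 1 0 u v, weakDeriv U 0 1 u v]

/-- The norm of `H^k(U)`: `‖u‖² = ∑_{a + b ≤ k} ‖∂^(a+b) u / ∂x^a ∂y^b‖²` with `L²(U)` norms. -/
def sobolevNorm (k : ℕ) (U : Set (ℝ × ℝ)) (u : ℝ × ℝ → ℝ) : ℝ≥0∞ :=
  (∑ a ∈ Finset.range (k + 1), ∑ b ∈ Finset.range (k + 1 - a),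
    eLpNorm (weakDeriv U a b u) 2 (volume.restrict U) ^ 2) ^ (1 / 2 : ℝ)

end PHT

end

/-!
Write `η = 2⁻ˡ` for the scale of an element `K` of level `l`. The hypothesis on the diameters
implies that all elements of the patch `Ω_K` have levels within a fixed distance of `l`
(`IsDyadic.isUniformPatch`). The vertices of these elements lie on a grid of spacing comparable
with `η`, so the number of elements of the patch is bounded (`IsUniformPatch.card_le`) and, after
scaling by `η`, its points come from a fixed finite set (`exists_finite_offsets`).

The approximation comes from the Bramble–Hilbert lemma: on a rectangle of size comparable with `η`
there is a quartic `q` with `|u - q| ≤ C η⁴ ‖u‖` pointwise and `‖∇(u - q)‖ ≤ C η⁴ ‖u‖` in `L²`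
(`exists_scaled_quartic_approx`). For smooth functions, `q` is chosen such that the averages of all
derivatives of `u - q` up to order four vanish; then the Poincaré and Sobolev inequalities on a
rectangle apply (`IsJetFamily.exists_quartic`). A function in `H⁵` is reduced to its mollifications
on slightly smaller rectangles (`exists_quartic_approx`).

The patch `Ω_K` need not be convex, so the Bramble–Hilbert lemma is not available on it with a
uniform constant. But any two elements of the patch are connected inside the patch by a chain of
elements with common edge segments (`IsDyadic.exists_connIn_elementPatch`). Two such neighbours are
bridged by a rectangle in their union, and quartics that are close on a rectangle are close on the
whole patch; hence the quartic `q` belonging to `K` is `η⁴`-close to `u` at all sampling points of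
the vertices that are active on `K` (`exists_quartic_near`). For a vertex that is active on `K`
without lying in `K`, the connectedness of its patch with `K` uses the mechanism by which
T-junctions transport data: the geometric information of a spline at a T-junction is determined by
Hermite interpolation along an edge of a coarser element.

Scaled sampling sets are subsets of a finite set that determine quartics, so that the constants in
the least-squares fits are bounded by a maximum over finitely many sets (`exists_uniform_bound`), and
the derivatives of `p_z - q` at `z` are of the expected order (`exists_fit_bound`). The first
derivatives of `q` are bicubic and hence splines. The difference between such a derivative and the
recovered spline is bounded on `K` by its data at the active vertices, since only boundedly many
interpolation steps separate the corners of `K` from vertices of coarser elements in the patch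
(`IsSpline.jetLE_of_data`, `exists_spline_bound`).

That data at the basis vertices can be prescribed and determine a spline, which the definition of the
recovered gradient presupposes, is proved on the way (`IsDyadic.exists_spline`,
`IsSpline.eq_zero_of_basis`).
-/

namespace PHT

noncomputable section

/-! ### Polynomials in two variables and Hermite interpolation -/

/-- The partial derivative of order `(a, b)` of the polynomial `∑ c i j * x ^ i * y ^ j`, where both
exponents are smaller than `N`. -/
def poly (N : ℕ) (c : ℕ → ℕ → ℝ) (a b : ℕ) (v : ℝ × ℝ) : ℝ :=
  ∑ i ∈ Finset.range N, ∑ j ∈ Finset.range N,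
    c i j * ((i.descFactorial a : ℝ) * v.1 ^ (i - a)) * ((j.descFactorial b : ℝ) * v.2 ^ (j - b))

lemma poly_zero_zero (N : ℕ) (c : ℕ → ℕ → ℝ) (v : ℝ × ℝ) :
    poly N c 0 0 v
      = ∑ i ∈ Finset.range N, ∑ j ∈ Finset.range N, c i j * v.1 ^ i * v.2 ^ j := by
  simp [poly]

lemma hasDerivAt_descFactorial_mul_pow (i a : ℕ) (x : ℝ) :
    HasDerivAt (fun t : ℝ => (i.descFactorial a : ℝ) * t ^ (i - a))
      ((i.descFactorial (a + 1) : ℝ) * x ^ (i - (a + 1))) x := by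
  have h := (hasDerivAt_pow (i - a) x).const_mul (i.descFactorial a : ℝ)
  refine h.congr_deriv ?_
  rw [Nat.descFactorial_succ, Nat.sub_sub]
  push_cast
  ring

lemma hasDerivAt_poly_fst (N : ℕ) (c : ℕ → ℕ → ℝ) (a b : ℕ) (x y : ℝ) :
    HasDerivAt (fun t => poly N c a b (t, y)) (poly N c (a + 1) b (x, y)) x := by
  unfold poly
  refine HasDerivAt.fun_sum fun i _ => HasDerivAt.fun_sum fun j _ => ?_
  exact ((hasDerivAt_descFactorial_mul_pow i a x).const_mul (c i j)).mul_const
    ((j.descFactorial b : ℝ) * y ^ (j - b))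

lemma hasDerivAt_poly_snd (N : ℕ) (c : ℕ → ℕ → ℝ) (a b : ℕ) (x y : ℝ) :
    HasDerivAt (fun t => poly N c a b (x, t)) (poly N c a (b + 1) (x, y)) y := by
  unfold poly
  refine HasDerivAt.fun_sum fun i _ => HasDerivAt.fun_sum fun j _ => ?_
  exact (hasDerivAt_descFactorial_mul_pow j b y).const_mul
    (c i j * ((i.descFactorial a : ℝ) * x ^ (i - a)))

lemma contDiff_poly (N : ℕ) (c : ℕ → ℕ → ℝ) (a b : ℕ) (n : WithTop ℕ∞) :
    ContDiff ℝ n (poly N c a b) := by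
  unfold poly
  fun_prop

lemma continuous_poly (N : ℕ) (c : ℕ → ℕ → ℝ) (a b : ℕ) : Continuous (poly N c a b) :=
  (contDiff_poly N c a b 0).continuous

lemma poly_sub (N : ℕ) (c c' : ℕ → ℕ → ℝ) (a b : ℕ) (v : ℝ × ℝ) :
    poly N (fun i j => c i j - c' i j) a b v = poly N c a b v - poly N c' a b v := by
  simp only [poly, ← Finset.sum_sub_distrib]
  refine Finset.sum_congr rfl fun i _ => Finset.sum_congr rfl fun j _ => ?_
  ring

lemma poly_add (N : ℕ) (c c' : ℕ → ℕ → ℝ) (a b : ℕ) (v : ℝ × ℝ) :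
    poly N (fun i j => c i j + c' i j) a b v = poly N c a b v + poly N c' a b v := by
  simp only [poly, ← Finset.sum_add_distrib]
  refine Finset.sum_congr rfl fun i _ => Finset.sum_congr rfl fun j _ => ?_
  ring

lemma poly_zero (N : ℕ) (a b : ℕ) (v : ℝ × ℝ) : poly N (fun _ _ => 0) a b v = 0 := by
  simp [poly]

/-- The geometric information of a bicubic polynomial, computed algebraically. -/
def jet (c : ℕ → ℕ → ℝ) (v : ℝ × ℝ) : Fin 4 → ℝ :=
  ![poly 4 c 0 0 v, poly 4 c 1 0 v, poly 4 c 0 1 v, poly 4 c 1 1 v]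

/-- `f` is a univariate cubic polynomial with derivative `f'`. -/
def IsCubic (f f' : ℝ → ℝ) : Prop :=
  ∃ A B C D : ℝ, ∀ t, f t = A + B * t + C * t ^ 2 + D * t ^ 3 ∧ f' t = B + 2 * C * t + 3 * D * t ^ 2

lemma isCubic_poly_fst (c : ℕ → ℕ → ℝ) (b : ℕ) (y : ℝ) :
    IsCubic (fun t => poly 4 c 0 b (t, y)) (fun t => poly 4 c 1 b (t, y)) := by
  let A : ℕ → ℝ := fun i => ∑ j ∈ Finset.range 4, c i j * ((j.descFactorial b : ℝ) * y ^ (j - b))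
  refine ⟨A 0, A 1, A 2, A 3, fun t => ⟨?_, ?_⟩⟩ <;>
  simp only [poly, A, Finset.sum_range_succ, Finset.sum_range_zero, Nat.descFactorial,
    Nat.sub_zero, Nat.reduceSub, pow_zero] <;> push_cast <;> ring

lemma isCubic_poly_snd (c : ℕ → ℕ → ℝ) (a : ℕ) (x : ℝ) :
    IsCubic (fun t => poly 4 c a 0 (x, t)) (fun t => poly 4 c a 1 (x, t)) := by
  let A : ℕ → ℝ := fun j => ∑ i ∈ Finset.range 4, c i j * ((i.descFactorial a : ℝ) * x ^ (i - a))
  refine ⟨A 0, A 1, A 2, A 3, fun t => ⟨?_, ?_⟩⟩ <;>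
  simp only [poly, A, Finset.sum_range_succ, Finset.sum_range_zero, Nat.descFactorial,
    Nat.sub_zero, Nat.reduceSub, pow_zero] <;> push_cast <;> ring

lemma IsCubic.hermite {f f' : ℝ → ℝ} (h : IsCubic f f') (a b τ : ℝ) :
    f (a + τ * (b - a)) = (1 - τ) ^ 2 * (1 + 2 * τ) * f a + (1 - τ) ^ 2 * τ * (b - a) * f' a
        + τ ^ 2 * (3 - 2 * τ) * f b - τ ^ 2 * (1 - τ) * (b - a) * f' b ∧
      (b - a) * f' (a + τ * (b - a)) = 6 * τ * (1 - τ) * (f b - f a)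
        + (1 - τ) * (1 - 3 * τ) * (b - a) * f' a + τ * (3 * τ - 2) * (b - a) * f' b := by
  obtain ⟨A, B, C, D, h⟩ := h
  simp only [fun t => (h t).1, fun t => (h t).2]
  constructor <;> ring

lemma IsCubic.hermite_bound {f f' : ℝ → ℝ} (h : IsCubic f f') {a b τ η κ E : ℝ} (hη : 0 < η)
    (hκ : 1 ≤ κ) (h1 : |b - a| ≤ κ * η) (h2 : η ≤ κ * |b - a|) (h0τ : 0 ≤ τ) (hτ1 : τ ≤ 1)
    (ha : |f a| ≤ E) (ha' : η * |f' a| ≤ E) (hb : |f b| ≤ E) (hb' : η * |f' b| ≤ E) :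
    |f (a + τ * (b - a))| ≤ 8 * κ * E ∧ η * |f' (a + τ * (b - a))| ≤ 8 * κ * E := by
  obtain ⟨e1, e2⟩ := h.hermite a b τ
  have hE : 0 ≤ E := (abs_nonneg _).trans ha
  have hL : 0 < |b - a| := by
    by_contra hcon
    have : |b - a| = 0 := le_antisymm (not_lt.1 hcon) (abs_nonneg _)
    rw [this] at h2
    linarith
  have hσ : 0 ≤ 1 - τ := by linarith
  have hLa : |b - a| * |f' a| ≤ κ * E :=
    calc |b - a| * |f' a| ≤ κ * η * |f' a| := by gcongr
      _ = κ * (η * |f' a|) := by ring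
      _ ≤ κ * E := by gcongr
  have hLb : |b - a| * |f' b| ≤ κ * E :=
    calc |b - a| * |f' b| ≤ κ * η * |f' b| := by gcongr
      _ = κ * (η * |f' b|) := by ring
      _ ≤ κ * E := by gcongr
  have hEκ : E ≤ κ * E := by nlinarith
  have key : ∀ (p X Y : ℝ), |p| ≤ 1 → |X| ≤ Y → |p * X| ≤ Y := fun p X Y hp hX => by
    rw [abs_mul]
    nlinarith [abs_nonneg p, abs_nonneg X]
  have unit : ∀ p : ℝ, 0 ≤ p → p ≤ 1 → |p| ≤ 1 := fun p h h' => by rwa [abs_of_nonneg h]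
  have m1 := mul_nonneg h0τ h0τ
  have m2 := mul_nonneg h0τ hσ
  have m3 := mul_nonneg hσ hσ
  have m4 := mul_nonneg m1 hσ
  have m5 := mul_nonneg m3 h0τ
  have m6 := mul_nonneg m1 h0τ
  constructor
  · rw [e1]
    have t1 := key _ (f a) E
      (unit ((1 - τ) ^ 2 * (1 + 2 * τ)) (by positivity) (by linarith)) ha
    have t2 := key _ ((b - a) * f' a) (κ * E)
      (unit ((1 - τ) ^ 2 * τ) (by positivity) (by linarith)) (by rwa [abs_mul])
    have t3 := key _ (f b) E
      (unit (τ ^ 2 * (3 - 2 * τ)) (mul_nonneg (by positivity) (by linarith)) (by linarith)) hb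
    have t4 := key _ ((b - a) * f' b) (κ * E)
      (unit (τ ^ 2 * (1 - τ)) (by positivity) (by linarith)) (by rwa [abs_mul])
    obtain ⟨t1, t1'⟩ := abs_le.1 t1
    obtain ⟨t2, t2'⟩ := abs_le.1 t2
    obtain ⟨t3, t3'⟩ := abs_le.1 t3
    obtain ⟨t4, t4'⟩ := abs_le.1 t4
    exact abs_le.2 ⟨by linarith, by linarith⟩
  · have key2 : |b - a| * |f' (a + τ * (b - a))| ≤ 3 * E + 2 * (|b - a| * (E / η)) := by
      rw [← abs_mul, e2]
      have t1 := key (4 * τ * (1 - τ)) ((f b - f a) / 2) E (unit _ (by positivity)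
        (by linarith [sq_nonneg (2 * τ - 1)])) (by rw [abs_le] at *; constructor <;> linarith)
      have g1 : |f' a| ≤ E / η := by rw [le_div_iff₀ hη]; linarith
      have g2 : |f' b| ≤ E / η := by rw [le_div_iff₀ hη]; linarith
      have t2 := key ((1 - τ) * (1 - 3 * τ)) ((b - a) * f' a) (|b - a| * (E / η))
        (by rw [abs_le]; constructor <;> linarith [sq_nonneg (3 * τ - 2)])
        (by rw [abs_mul]; gcongr)
      have t3 := key (τ * (3 * τ - 2)) ((b - a) * f' b) (|b - a| * (E / η))
        (by rw [abs_le]; constructor <;> linarith [sq_nonneg (3 * τ - 1)])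
        (by rw [abs_mul]; gcongr)
      obtain ⟨t1, t1'⟩ := abs_le.1 t1
      obtain ⟨t2, t2'⟩ := abs_le.1 t2
      obtain ⟨t3, t3'⟩ := abs_le.1 t3
      exact abs_le.2 ⟨by linarith, by linarith⟩
    have : |b - a| * (η * |f' (a + τ * (b - a))|) ≤ |b - a| * (8 * κ * E) := by
      calc |b - a| * (η * |f' (a + τ * (b - a))|) = η * (|b - a| * |f' (a + τ * (b - a))|) := by ring
        _ ≤ η * (3 * E + 2 * (|b - a| * (E / η))) := by gcongr
        _ = η * (3 * E) + 2 * |b - a| * E := by field_simp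
        _ ≤ κ * |b - a| * (3 * E) + 2 * |b - a| * (κ * E) := by gcongr
        _ ≤ |b - a| * (8 * κ * E) := by linarith [mul_nonneg hL.le (hE.trans hEκ)]
    exact le_of_mul_le_mul_left this hL

lemma IsCubic.eq_zero_of_hermite {f f' : ℝ → ℝ} (h : IsCubic f f') {a b τ : ℝ} (hab : a ≠ b)
    (h0τ : 0 < τ) (hτ1 : τ < 1) (ha : f a = 0) (ha' : f' a = 0)
    (ht : f (a + τ * (b - a)) = 0) (ht' : f' (a + τ * (b - a)) = 0) : f b = 0 ∧ f' b = 0 := by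
  obtain ⟨e1, e2⟩ := h.hermite a b τ
  rw [ha, ha', ht] at e1
  rw [ha, ha', ht'] at e2
  have hL : b - a ≠ 0 := sub_ne_zero.2 hab.symm
  have e1' : (3 - 2 * τ) * f b - (1 - τ) * ((b - a) * f' b) = 0 := by
    have : τ ^ 2 * ((3 - 2 * τ) * f b - (1 - τ) * ((b - a) * f' b)) = 0 := by linarith
    exact (mul_eq_zero.1 this).resolve_left (by positivity)
  have e2' : 6 * (1 - τ) * f b + (3 * τ - 2) * ((b - a) * f' b) = 0 := by
    have : τ * (6 * (1 - τ) * f b + (3 * τ - 2) * ((b - a) * f' b)) = 0 := by linarith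
    exact (mul_eq_zero.1 this).resolve_left h0τ.ne'
  have hb : τ * f b = 0 := by linear_combination (3 * τ - 2) * e1' + (1 - τ) * e2'
  have hfb : f b = 0 := (mul_eq_zero.1 hb).resolve_left h0τ.ne'
  refine ⟨hfb, ?_⟩
  rw [hfb] at e1'
  have : (1 - τ) * ((b - a) * f' b) = 0 := by linarith
  exact ((mul_eq_zero.1 ((mul_eq_zero.1 this).resolve_left (by linarith))).resolve_left hL)

/-- The point `w` divides the axis-parallel segment from `a` to `b` in the ratio `τ : 1 - τ`. -/
def OnEdge (a b : ℝ × ℝ) (τ : ℝ) (w : ℝ × ℝ) : Prop :=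
  (a.1 ≠ b.1 ∧ w.1 = a.1 + τ * (b.1 - a.1) ∧ a.2 = w.2 ∧ b.2 = w.2) ∨
  (a.2 ≠ b.2 ∧ w.2 = a.2 + τ * (b.2 - a.2) ∧ a.1 = w.1 ∧ b.1 = w.1)

/-- The size of geometric information, measured in the length unit `η`, is at most `E`. -/
def JetLE (η E : ℝ) (g : Fin 4 → ℝ) : Prop :=
  |g 0| ≤ E ∧ η * |g 1| ≤ E ∧ η * |g 2| ≤ E ∧ η ^ 2 * |g 3| ≤ E

lemma JetLE.mono {η E E' : ℝ} {g : Fin 4 → ℝ} (h : JetLE η E g) (hE : E ≤ E') : JetLE η E' g :=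
  ⟨h.1.trans hE, h.2.1.trans hE, h.2.2.1.trans hE, h.2.2.2.trans hE⟩

lemma JetLE.zero {η E : ℝ} (hE : 0 ≤ E) : JetLE η E 0 := by simp [JetLE, hE]

/-- Along a horizontal edge, the pairs `(f, f_x)` and `(f_y, f_xy)` are interpolated separately by
univariate cubic Hermite interpolation, and similarly for vertical edges. -/
lemma jetLE_of_onEdge {c : ℕ → ℕ → ℝ} {a b w : ℝ × ℝ} {τ η κ E : ℝ} (hw : OnEdge a b τ w)
    (hη : 0 < η) (hκ : 1 ≤ κ) (h0τ : 0 ≤ τ) (hτ1 : τ ≤ 1)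
    (h1 : |b.1 - a.1| ≤ κ * η) (h2 : |b.2 - a.2| ≤ κ * η)
    (h3 : a.1 ≠ b.1 → η ≤ κ * |b.1 - a.1|) (h4 : a.2 ≠ b.2 → η ≤ κ * |b.2 - a.2|)
    (ha : JetLE η E (jet c a)) (hb : JetLE η E (jet c b)) : JetLE η (8 * κ * E) (jet c w) := by
  obtain ⟨a1, a2⟩ := a
  obtain ⟨b1, b2⟩ := b
  obtain ⟨w1, w2⟩ := w
  simp only [OnEdge, JetLE, jet, Matrix.cons_val] at *
  obtain ⟨ha0, ha1, ha2, ha3⟩ := ha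
  obtain ⟨hb0, hb1, hb2, hb3⟩ := hb
  have e : ∀ x, η ^ 2 * |x| = η * |η * x| := fun x => by rw [abs_mul, abs_of_pos hη]; ring
  have e' : ∀ x, η * |x| = |η * x| := fun x => by rw [abs_mul, abs_of_pos hη]
  have hscale : ∀ {f f' : ℝ → ℝ}, IsCubic f f' → IsCubic (fun t => η * f t) (fun t => η * f' t) := by
    rintro f f' ⟨A, B, C, D, h⟩
    exact ⟨η * A, η * B, η * C, η * D, fun t =>
      ⟨by simp only [(h t).1]; ring, by simp only [(h t).2]; ring⟩⟩
  rcases hw with ⟨hne, rfl, rfl, rfl⟩ | ⟨hne, rfl, rfl, rfl⟩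
  · have A := (isCubic_poly_fst c 0 b2).hermite_bound hη hκ h1 (h3 hne) h0τ hτ1 ha0 ha1 hb0 hb1
    have B := (hscale (isCubic_poly_fst c 1 b2)).hermite_bound hη hκ h1 (h3 hne) h0τ hτ1
      ((e' _).symm.trans_le ha2) ((e _).symm.trans_le ha3) ((e' _).symm.trans_le hb2)
      ((e _).symm.trans_le hb3)
    exact ⟨A.1, A.2, (e' _).trans_le B.1, (e _).trans_le B.2⟩
  · have A := (isCubic_poly_snd c 0 b1).hermite_bound hη hκ h2 (h4 hne) h0τ hτ1 ha0 ha2 hb0 hb2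
    have B := (hscale (isCubic_poly_snd c 1 b1)).hermite_bound hη hκ h2 (h4 hne) h0τ hτ1
      ((e' _).symm.trans_le ha1) ((e _).symm.trans_le ha3) ((e' _).symm.trans_le hb1)
      ((e _).symm.trans_le hb3)
    exact ⟨A.1, (e' _).trans_le B.1, A.2, (e _).trans_le B.2⟩

/-- Hermite interpolation along an edge with zero data at one end is an injective function of the
data at the other end: the Wronskian of the two basis functions of that end has no zeros inside. -/
lemma jet_eq_zero_of_onEdge {c : ℕ → ℕ → ℝ} {a b w : ℝ × ℝ} {τ : ℝ} (hw : OnEdge a b τ w)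
    (h0τ : 0 < τ) (hτ1 : τ < 1) (ha : jet c a = 0) (hw0 : jet c w = 0) : jet c b = 0 := by
  obtain ⟨a1, a2⟩ := a
  obtain ⟨b1, b2⟩ := b
  obtain ⟨w1, w2⟩ := w
  simp only [OnEdge] at hw
  have comp : ∀ v, jet c v = 0 ↔ poly 4 c 0 0 v = 0 ∧ poly 4 c 1 0 v = 0 ∧ poly 4 c 0 1 v = 0 ∧
      poly 4 c 1 1 v = 0 := by
    intro v
    simp [jet, funext_iff, Fin.forall_fin_succ]
  rw [comp] at *
  obtain ⟨ha0, ha1, ha2, ha3⟩ := ha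
  obtain ⟨hb0, hb1, hb2, hb3⟩ := hw0
  rcases hw with ⟨hne, rfl, rfl, rfl⟩ | ⟨hne, rfl, rfl, rfl⟩
  · have A := (isCubic_poly_fst c 0 b2).eq_zero_of_hermite hne h0τ hτ1 ha0 ha1 hb0 hb1
    have B := (isCubic_poly_fst c 1 b2).eq_zero_of_hermite hne h0τ hτ1 ha2 ha3 hb2 hb3
    exact ⟨A.1, A.2, B.1, B.2⟩
  · have A := (isCubic_poly_snd c 0 b1).eq_zero_of_hermite hne h0τ hτ1 ha0 ha2 hb0 hb2
    have B := (isCubic_poly_snd c 1 b1).eq_zero_of_hermite hne h0τ hτ1 ha1 ha3 hb1 hb3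
    exact ⟨A.1, B.1, A.2, B.2⟩

/-- A bicubic polynomial is bounded on a rectangle by its geometric information at the corners. -/
lemma jetLE_of_corners {c : ℕ → ℕ → ℝ} {K : Rect} {η κ E : ℝ} (hη : 0 < η) (hκ : 1 ≤ κ)
    (hx : K.x₀ < K.x₁) (hy : K.y₀ < K.y₁)
    (h1 : K.x₁ - K.x₀ ≤ κ * η) (h2 : K.y₁ - K.y₀ ≤ κ * η)
    (h3 : η ≤ κ * (K.x₁ - K.x₀)) (h4 : η ≤ κ * (K.y₁ - K.y₀))
    (h : ∀ w ∈ K.corners, JetLE η E (jet c w)) {v : ℝ × ℝ} (hv : v ∈ K.carrier) :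
    JetLE η (8 * κ * (8 * κ * E)) (jet c v) := by
  obtain ⟨⟨hv1, hv2⟩, hv3, hv4⟩ := hv
  have hx' : 0 < K.x₁ - K.x₀ := sub_pos.2 hx
  have hy' : 0 < K.y₁ - K.y₀ := sub_pos.2 hy
  have hs1 : 0 ≤ (v.1 - K.x₀) / (K.x₁ - K.x₀) := div_nonneg (by linarith) hx'.le
  have hs2 : (v.1 - K.x₀) / (K.x₁ - K.x₀) ≤ 1 := (div_le_one hx').2 (by linarith)
  have ht1 : 0 ≤ (v.2 - K.y₀) / (K.y₁ - K.y₀) := div_nonneg (by linarith) hy'.le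
  have ht2 : (v.2 - K.y₀) / (K.y₁ - K.y₀) ≤ 1 := (div_le_one hy').2 (by linarith)
  have hz : 0 ≤ κ * η := by positivity
  have horizontal : ∀ y, (K.x₀, y) ∈ K.corners → (K.x₁, y) ∈ K.corners →
      JetLE η (8 * κ * E) (jet c (v.1, y)) := fun y hl hr => by
    refine jetLE_of_onEdge (a := (K.x₀, y)) (b := (K.x₁, y))
      (Or.inl ⟨hx.ne, ?_, rfl, rfl⟩) hη hκ hs1 hs2 (by rwa [abs_of_pos hx']) (by simpa using hz)
      (fun _ => by rwa [abs_of_pos hx']) (fun h => absurd rfl h) (h _ hl) (h _ hr)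
    simp only
    field_simp
    ring
  refine jetLE_of_onEdge (a := (v.1, K.y₀)) (b := (v.1, K.y₁))
      (Or.inr ⟨hy.ne, ?_, rfl, rfl⟩) hη hκ ht1 ht2 (by simpa using hz) (by rwa [abs_of_pos hy'])
      (fun h => absurd rfl h) (fun _ => by rwa [abs_of_pos hy']) (horizontal _ ?_ ?_)
      (horizontal _ ?_ ?_)
  · simp only
    field_simp
    ring
  all_goals simp [Rect.corners]

/-! ### Dyadic subdivision of an interval -/

/-- The nodes of level `l` of the dyadic subdivision of the intervals between the points `ξ i`. -/
def node (ξ : ℕ → ℝ) : ℕ → ℕ → ℝ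
  | 0, i => ξ i
  | l + 1, i => (node ξ l (i / 2) + node ξ l ((i + 1) / 2)) / 2

lemma node_two_mul (ξ : ℕ → ℝ) (l i : ℕ) : node ξ (l + 1) (2 * i) = node ξ l i := by
  have h1 : 2 * i / 2 = i := by omega
  have h2 : (2 * i + 1) / 2 = i := by omega
  rw [node, h1, h2]
  ring

lemma node_two_mul_add_one (ξ : ℕ → ℝ) (l i : ℕ) :
    node ξ (l + 1) (2 * i + 1) = (node ξ l i + node ξ l (i + 1)) / 2 := by
  have h1 : (2 * i + 1) / 2 = i := by omega
  have h2 : (2 * i + 1 + 1) / 2 = i + 1 := by omega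
  rw [node, h1, h2]

lemma node_step (ξ : ℕ → ℝ) (l i : ℕ) :
    node ξ l (i + 1) - node ξ l i = (ξ (i / 2 ^ l + 1) - ξ (i / 2 ^ l)) / 2 ^ l := by
  induction l generalizing i with
  | zero => simp [node]
  | succ l ih =>
    have h3 : i / 2 ^ (l + 1) = (i / 2) / 2 ^ l := by rw [pow_succ', Nat.div_div_eq_div_mul]
    rw [h3, pow_succ, ← div_div, ← ih (i / 2)]
    obtain ⟨j, rfl | rfl⟩ : ∃ j, i = 2 * j ∨ i = 2 * j + 1 := ⟨i / 2, by omega⟩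
    · rw [node_two_mul_add_one, node_two_mul]
      have h1 : 2 * j / 2 = j := by omega
      rw [h1]
      ring
    · rw [show 2 * j + 1 + 1 = 2 * (j + 1) by ring, node_two_mul_add_one, node_two_mul]
      have h1 : (2 * j + 1) / 2 = j := by omega
      rw [h1]
      ring

lemma node_strictMono {ξ : ℕ → ℝ} (hξ : StrictMono ξ) (l : ℕ) : StrictMono (node ξ l) := by
  refine strictMono_nat_of_lt_succ fun i => ?_
  have h := node_step ξ l i
  have : 0 < (ξ (i / 2 ^ l + 1) - ξ (i / 2 ^ l)) / 2 ^ l :=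
    div_pos (sub_pos.2 (hξ (Nat.lt_succ_self _))) (by positivity)
  linarith

lemma node_add (ξ : ℕ → ℝ) (l e i : ℕ) : node ξ (l + e) (2 ^ e * i) = node ξ l i := by
  induction e with
  | zero => simp
  | succ e ih =>
    rw [← add_assoc, show 2 ^ (e + 1) * i = 2 * (2 ^ e * i) by ring, node_two_mul, ih]

lemma node_of_le (ξ : ℕ → ℝ) {k l : ℕ} (h : k ≤ l) (i : ℕ) :
    node ξ l (2 ^ (l - k) * i) = node ξ k i := by
  conv_lhs => rw [← Nat.add_sub_cancel' h]
  rw [Nat.add_sub_cancel_left]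
  exact node_add ξ k (l - k) i

lemma node_eq_endpoint {ξ : ℕ → ℝ} (hξ : StrictMono ξ) {k l p q : ℕ} (h : k ≤ l)
    (h1 : node ξ l q ≤ node ξ k p) (h2 : node ξ k p ≤ node ξ l (q + 1)) :
    node ξ k p = node ξ l q ∨ node ξ k p = node ξ l (q + 1) := by
  rw [← node_of_le ξ h] at *
  have h1' := (node_strictMono hξ l).le_iff_le.1 h1
  have h2' := (node_strictMono hξ l).le_iff_le.1 h2
  rcases Nat.lt_or_ge q (2 ^ (l - k) * p) with h3 | h3
  · exact Or.inr (by rw [le_antisymm h2' h3])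
  · exact Or.inl (by rw [le_antisymm h3 h1'])

lemma node_odd_ne {ξ : ℕ → ℝ} (hξ : StrictMono ξ) {k l p i : ℕ} (h : k < l) (hi : Odd i) :
    node ξ l i ≠ node ξ k p := by
  rw [← node_of_le ξ h.le]
  intro h'
  obtain ⟨e, he⟩ : ∃ e, l - k = e + 1 := ⟨l - k - 1, by omega⟩
  have := (node_strictMono hξ l).injective h'
  rw [he, pow_succ] at this
  obtain ⟨j, rfl⟩ := hi
  have h2 : 2 * j + 1 = 2 * (2 ^ e * p) := by rw [this]; ring
  omega

/-- A dyadic interval of a coarser level that contains an odd node contains both neighbours of this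
node. -/
lemma node_odd_subset {ξ : ℕ → ℝ} (hξ : StrictMono ξ) {k l p i : ℕ} (h : k < l) (hi : Odd i)
    (h1 : node ξ k p ≤ node ξ l i) (h2 : node ξ l i ≤ node ξ k (p + 1)) :
    node ξ k p ≤ node ξ l (i - 1) ∧ node ξ l (i + 1) ≤ node ξ k (p + 1) := by
  have h1' := lt_of_le_of_ne h1 (node_odd_ne hξ h hi).symm
  have h2' := lt_of_le_of_ne h2 (node_odd_ne hξ h hi)
  rw [← node_of_le ξ h.le p] at *
  rw [← node_of_le ξ h.le (p + 1)] at *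
  rw [(node_strictMono hξ l).lt_iff_lt] at h1' h2'
  rw [(node_strictMono hξ l).le_iff_le, (node_strictMono hξ l).le_iff_le]
  omega

/-! ### Dyadic cells and grids -/

/-- The mesh lines of the first coordinate, continued with unit steps beyond the last one. -/
def TensorMesh.lineX (T₀ : TensorMesh) (i : ℕ) : ℝ :=
  T₀.x ⟨min i T₀.m, by omega⟩ + ((i - T₀.m : ℕ) : ℝ)

/-- The mesh lines of the second coordinate, continued with unit steps beyond the last one. -/
def TensorMesh.lineY (T₀ : TensorMesh) (j : ℕ) : ℝ :=
  T₀.y ⟨min j T₀.n, by omega⟩ + ((j - T₀.n : ℕ) : ℝ)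

lemma lineX_strictMono (T₀ : TensorMesh) : StrictMono T₀.lineX := by
  refine strictMono_nat_of_lt_succ fun i => ?_
  unfold TensorMesh.lineX
  rcases Nat.lt_or_ge i T₀.m with h | h
  · have h1 : T₀.x ⟨min i T₀.m, by omega⟩ < T₀.x ⟨min (i + 1) T₀.m, by omega⟩ :=
      T₀.x_strictMono (by rw [Fin.lt_def]; simp only; omega)
    have h2 : i - T₀.m = 0 := by omega
    have h3 : i + 1 - T₀.m = 0 := by omega
    rw [h2, h3]
    simpa using h1
  · have h1 : T₀.x ⟨min (i + 1) T₀.m, by omega⟩ = T₀.x ⟨min i T₀.m, by omega⟩ := by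
      congr 2; omega
    have h2 : i + 1 - T₀.m = (i - T₀.m) + 1 := by omega
    rw [h1, h2]
    push_cast
    linarith

lemma lineY_strictMono (T₀ : TensorMesh) : StrictMono T₀.lineY := by
  refine strictMono_nat_of_lt_succ fun i => ?_
  unfold TensorMesh.lineY
  rcases Nat.lt_or_ge i T₀.n with h | h
  · have h1 : T₀.y ⟨min i T₀.n, by omega⟩ < T₀.y ⟨min (i + 1) T₀.n, by omega⟩ :=
      T₀.y_strictMono (by rw [Fin.lt_def]; simp only; omega)
    have h2 : i - T₀.n = 0 := by omega
    have h3 : i + 1 - T₀.n = 0 := by omega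
    rw [h2, h3]
    simpa using h1
  · have h1 : T₀.y ⟨min (i + 1) T₀.n, by omega⟩ = T₀.y ⟨min i T₀.n, by omega⟩ := by
      congr 2; omega
    have h2 : i + 1 - T₀.n = (i - T₀.n) + 1 := by omega
    rw [h1, h2]
    push_cast
    linarith

/-- The cell with index `(i, j)` of the `l`-times uniformly refined tensor-product mesh. -/
def TensorMesh.cell (T₀ : TensorMesh) (l i j : ℕ) : Rect :=
  ⟨node T₀.lineX l i, node T₀.lineX l (i + 1), node T₀.lineY l j, node T₀.lineY l (j + 1)⟩

/-- `K` is a cell of the `l`-times uniformly refined tensor-product mesh. -/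
def IsCell (T₀ : TensorMesh) (l : ℕ) (K : Rect) : Prop := ∃ i j, K = T₀.cell l i j

/-- `v` is a vertex of the `l`-times uniformly refined tensor-product mesh. -/
def Grid (T₀ : TensorMesh) (l : ℕ) (v : ℝ × ℝ) : Prop :=
  ∃ i j, v = (node T₀.lineX l i, node T₀.lineY l j)

lemma Grid.mono {T₀ : TensorMesh} {k l : ℕ} {v : ℝ × ℝ} (h : Grid T₀ k v) (hkl : k ≤ l) :
    Grid T₀ l v := by
  obtain ⟨i, j, rfl⟩ := h
  exact ⟨2 ^ (l - k) * i, 2 ^ (l - k) * j, by rw [node_of_le _ hkl, node_of_le _ hkl]⟩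

lemma IsCell.lt {T₀ : TensorMesh} {l : ℕ} {K : Rect} (h : IsCell T₀ l K) :
    K.x₀ < K.x₁ ∧ K.y₀ < K.y₁ := by
  obtain ⟨i, j, rfl⟩ := h
  exact ⟨node_strictMono (lineX_strictMono T₀) l (Nat.lt_succ_self i),
    node_strictMono (lineY_strictMono T₀) l (Nat.lt_succ_self j)⟩

lemma IsCell.grid_of_mem_corners {T₀ : TensorMesh} {l : ℕ} {K : Rect} (h : IsCell T₀ l K)
    {v : ℝ × ℝ} (hv : v ∈ K.corners) : Grid T₀ l v := by
  obtain ⟨i, j, rfl⟩ := h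
  simp only [Rect.corners, Finset.mem_insert, Finset.mem_singleton] at hv
  rcases hv with rfl | rfl | rfl | rfl
  exacts [⟨i, j, rfl⟩, ⟨i + 1, j, rfl⟩, ⟨i, j + 1, rfl⟩, ⟨i + 1, j + 1, rfl⟩]

lemma mem_corners_iff {K : Rect} {v : ℝ × ℝ} :
    v ∈ K.corners ↔ (v.1 = K.x₀ ∨ v.1 = K.x₁) ∧ (v.2 = K.y₀ ∨ v.2 = K.y₁) := by
  obtain ⟨a, b⟩ := v
  simp only [Rect.corners, Finset.mem_insert, Finset.mem_singleton, Prod.mk.injEq]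
  tauto

lemma mem_carrier_iff {K : Rect} {v : ℝ × ℝ} :
    v ∈ K.carrier ↔ (K.x₀ ≤ v.1 ∧ v.1 ≤ K.x₁) ∧ K.y₀ ≤ v.2 ∧ v.2 ≤ K.y₁ := Iff.rfl

lemma IsCell.corners_subset {T₀ : TensorMesh} {l : ℕ} {K : Rect} (h : IsCell T₀ l K) {v : ℝ × ℝ}
    (hv : v ∈ K.corners) : v ∈ K.carrier := by
  have := h.lt
  rw [mem_corners_iff] at hv
  rw [mem_carrier_iff]
  obtain ⟨h1 | h1, h2 | h2⟩ := hv <;> rw [h1, h2] <;> exact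
    ⟨⟨by linarith, by linarith⟩, by linarith, by linarith⟩

lemma IsCell.mem_corners {T₀ : TensorMesh} {k l : ℕ} {K : Rect} (h : IsCell T₀ l K) (hkl : k ≤ l)
    {v : ℝ × ℝ} (hv : Grid T₀ k v) (hvK : v ∈ K.carrier) : v ∈ K.corners := by
  obtain ⟨i, j, rfl⟩ := h
  obtain ⟨p, q, rfl⟩ := hv
  rw [mem_carrier_iff] at hvK
  exact mem_corners_iff.2 ⟨node_eq_endpoint (lineX_strictMono T₀) hkl hvK.1.1 hvK.1.2,
    node_eq_endpoint (lineY_strictMono T₀) hkl hvK.2.1 hvK.2.2⟩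

/-! ### Dyadic partitions -/

/-- The interiors of two rectangles meet. -/
def Overlap (K L : Rect) : Prop :=
  (K.x₀ < L.x₁ ∧ L.x₀ < K.x₁) ∧ (K.y₀ < L.y₁ ∧ L.y₀ < K.y₁)

/-- The elements of `T` are dyadic cells that tile the domain. -/
structure IsDyadic (T₀ : TensorMesh) (T : Finset Rect) : Prop where
  isCell : ∀ K ∈ T, ∃ l, IsCell T₀ l K
  subset : ∀ K ∈ T, K.carrier ⊆ T₀.domain.carrier
  cover : ∀ v ∈ T₀.domain.carrier, ∃ K ∈ T, v ∈ K.carrier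
  eq_of_overlap : ∀ K ∈ T, ∀ L ∈ T, Overlap K L → K = L

lemma mem_elements_iff {T₀ : TensorMesh} {K : Rect} :
    K ∈ T₀.elements ↔ ∃ i j, i < T₀.m ∧ j < T₀.n ∧ K = T₀.cell 0 i j := by
  classical
  have hX : ∀ i (h : i < T₀.m + 1), T₀.lineX i = T₀.x ⟨i, h⟩ := fun i h => by
    have h2 : i - T₀.m = 0 := by omega
    simp only [TensorMesh.lineX, h2]
    rw [Nat.cast_zero, add_zero]
    congr 2; omega
  have hY : ∀ i (h : i < T₀.n + 1), T₀.lineY i = T₀.y ⟨i, h⟩ := fun i h => by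
    have h2 : i - T₀.n = 0 := by omega
    simp only [TensorMesh.lineY, h2]
    rw [Nat.cast_zero, add_zero]
    congr 2; omega
  simp only [TensorMesh.elements, Finset.mem_image, Finset.mem_univ, true_and, Prod.exists]
  constructor
  · rintro ⟨⟨i, hi⟩, ⟨j, hj⟩, rfl⟩
    refine ⟨i, j, hi, hj, ?_⟩
    simp only [TensorMesh.cell, node]
    rw [hX i (by omega), hX (i + 1) (by omega), hY j (by omega), hY (j + 1) (by omega)]
    rfl
  · rintro ⟨i, j, hi, hj, rfl⟩
    refine ⟨⟨i, hi⟩, ⟨j, hj⟩, ?_⟩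
    simp only [TensorMesh.cell, node]
    rw [hX i (by omega), hX (i + 1) (by omega), hY j (by omega), hY (j + 1) (by omega)]
    rfl

lemma domain_eq (T₀ : TensorMesh) :
    T₀.domain = ⟨T₀.lineX 0, T₀.lineX T₀.m, T₀.lineY 0, T₀.lineY T₀.n⟩ := by
  simp [TensorMesh.domain, TensorMesh.lineX, TensorMesh.lineY, Fin.last]

lemma exists_mem_interval (f : ℕ → ℝ) {n : ℕ} (hn : 0 < n) {t : ℝ} (h0 : f 0 ≤ t)
    (h1 : t ≤ f n) : ∃ i < n, f i ≤ t ∧ t ≤ f (i + 1) := by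
  induction n with
  | zero => omega
  | succ n ih =>
    by_cases h : f n ≤ t
    · exact ⟨n, Nat.lt_succ_self n, h, h1⟩
    · rcases Nat.eq_zero_or_pos n with rfl | hn'
      · exact absurd h0 h
      · obtain ⟨i, hi, hit⟩ := ih hn' (le_of_not_ge h)
        exact ⟨i, by omega, hit⟩

lemma isDyadic_elements (T₀ : TensorMesh) : IsDyadic T₀ T₀.elements where
  isCell K hK := by
    obtain ⟨i, j, -, -, rfl⟩ := mem_elements_iff.1 hK
    exact ⟨0, i, j, rfl⟩
  subset K hK := by
    obtain ⟨i, j, hi, hj, rfl⟩ := mem_elements_iff.1 hK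
    rw [domain_eq]
    refine Set.prod_mono (Set.Icc_subset_Icc ?_ ?_) (Set.Icc_subset_Icc ?_ ?_)
    exacts [(lineX_strictMono T₀).monotone (Nat.zero_le _), (lineX_strictMono T₀).monotone hi,
      (lineY_strictMono T₀).monotone (Nat.zero_le _), (lineY_strictMono T₀).monotone hj]
  cover v hv := by
    rw [domain_eq] at hv
    obtain ⟨i, hi, hi'⟩ := exists_mem_interval T₀.lineX T₀.m_pos hv.1.1 hv.1.2
    obtain ⟨j, hj, hj'⟩ := exists_mem_interval T₀.lineY T₀.n_pos hv.2.1 hv.2.2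
    exact ⟨_, mem_elements_iff.2 ⟨i, j, hi, hj, rfl⟩, hi', hj'⟩
  eq_of_overlap K hK L hL h := by
    obtain ⟨i, j, -, -, rfl⟩ := mem_elements_iff.1 hK
    obtain ⟨p, q, -, -, rfl⟩ := mem_elements_iff.1 hL
    simp only [Overlap, TensorMesh.cell, (node_strictMono (lineX_strictMono T₀) 0).lt_iff_lt,
      (node_strictMono (lineY_strictMono T₀) 0).lt_iff_lt] at h
    have h1 : i = p := by omega
    have h2 : j = q := by omega
    rw [h1, h2]

lemma mem_children_iff {K L : Rect} : L ∈ K.children ↔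
    ((L.x₀ = K.x₀ ∧ L.x₁ = (K.x₀ + K.x₁) / 2) ∨ (L.x₀ = (K.x₀ + K.x₁) / 2 ∧ L.x₁ = K.x₁)) ∧
    ((L.y₀ = K.y₀ ∧ L.y₁ = (K.y₀ + K.y₁) / 2) ∨ (L.y₀ = (K.y₀ + K.y₁) / 2 ∧ L.y₁ = K.y₁)) := by
  simp only [Rect.children, Finset.mem_insert, Finset.mem_singleton, Rect.ext_iff]
  tauto

lemma IsCell.child {T₀ : TensorMesh} {l : ℕ} {K L : Rect} (h : IsCell T₀ l K)
    (hL : L ∈ K.children) : IsCell T₀ (l + 1) L := by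
  obtain ⟨i, j, rfl⟩ := h
  have e : ∀ (ξ : ℕ → ℝ) (i : ℕ), node ξ (l + 1) (2 * i + 1 + 1) = node ξ l (i + 1) := fun ξ i => by
    rw [← node_two_mul ξ l (i + 1)]; rfl
  obtain ⟨hx, hy⟩ := mem_children_iff.1 hL
  simp only [TensorMesh.cell] at hx hy
  rcases hx with ⟨h1, h2⟩ | ⟨h1, h2⟩ <;> rcases hy with ⟨h3, h4⟩ | ⟨h3, h4⟩
  · refine ⟨2 * i, 2 * j, ?_⟩
    rw [Rect.ext_iff, h1, h2, h3, h4]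
    simp only [TensorMesh.cell, node_two_mul, node_two_mul_add_one, and_self]
  · refine ⟨2 * i, 2 * j + 1, ?_⟩
    rw [Rect.ext_iff, h1, h2, h3, h4]
    simp only [TensorMesh.cell, node_two_mul, node_two_mul_add_one, e, and_self]
  · refine ⟨2 * i + 1, 2 * j, ?_⟩
    rw [Rect.ext_iff, h1, h2, h3, h4]
    simp only [TensorMesh.cell, node_two_mul, node_two_mul_add_one, e, and_self]
  · refine ⟨2 * i + 1, 2 * j + 1, ?_⟩
    rw [Rect.ext_iff, h1, h2, h3, h4]
    simp only [TensorMesh.cell, node_two_mul_add_one, e, and_self]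

lemma Overlap.of_le {K L K' L' : Rect} (h : Overlap K' L')
    (hK : K.x₀ ≤ K'.x₀ ∧ K'.x₁ ≤ K.x₁ ∧ K.y₀ ≤ K'.y₀ ∧ K'.y₁ ≤ K.y₁)
    (hL : L.x₀ ≤ L'.x₀ ∧ L'.x₁ ≤ L.x₁ ∧ L.y₀ ≤ L'.y₀ ∧ L'.y₁ ≤ L.y₁) : Overlap K L := by
  obtain ⟨⟨h1, h2⟩, h3, h4⟩ := h
  exact ⟨⟨by linarith, by linarith⟩, by linarith, by linarith⟩

lemma child_le {K L : Rect} (hK : K.x₀ < K.x₁ ∧ K.y₀ < K.y₁) (hL : L ∈ K.children) :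
    K.x₀ ≤ L.x₀ ∧ L.x₁ ≤ K.x₁ ∧ K.y₀ ≤ L.y₀ ∧ L.y₁ ≤ K.y₁ := by
  obtain ⟨hx, hy⟩ := mem_children_iff.1 hL
  rcases hx with ⟨h1, h2⟩ | ⟨h1, h2⟩ <;> rcases hy with ⟨h3, h4⟩ | ⟨h3, h4⟩ <;>
    rw [h1, h2, h3, h4] <;> exact ⟨by linarith, by linarith, by linarith, by linarith⟩

lemma child_eq_of_overlap {K L L' : Rect} (hL : L ∈ K.children)
    (hL' : L' ∈ K.children) (h : Overlap L L') : L = L' := by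
  obtain ⟨hx, hy⟩ := mem_children_iff.1 hL
  obtain ⟨hx', hy'⟩ := mem_children_iff.1 hL'
  obtain ⟨⟨h1, h2⟩, h3, h4⟩ := h
  rw [Rect.ext_iff]
  have ex : L.x₀ = L'.x₀ ∧ L.x₁ = L'.x₁ := by
    rcases hx with ⟨g1, g2⟩ | ⟨g1, g2⟩ <;> rcases hx' with ⟨g3, g4⟩ | ⟨g3, g4⟩ <;>
      exact ⟨by linarith, by linarith⟩
  have ey : L.y₀ = L'.y₀ ∧ L.y₁ = L'.y₁ := by
    rcases hy with ⟨g1, g2⟩ | ⟨g1, g2⟩ <;> rcases hy' with ⟨g3, g4⟩ | ⟨g3, g4⟩ <;>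
      exact ⟨by linarith, by linarith⟩
  exact ⟨ex.1, ex.2, ey.1, ey.2⟩

lemma exists_child_mem {K : Rect} {v : ℝ × ℝ} (hv : v ∈ K.carrier) :
    ∃ L ∈ K.children, v ∈ L.carrier := by
  obtain ⟨⟨h1, h2⟩, h3, h4⟩ := hv
  rcases le_total v.1 ((K.x₀ + K.x₁) / 2) with hx | hx <;>
    rcases le_total v.2 ((K.y₀ + K.y₁) / 2) with hy | hy
  · exact ⟨⟨K.x₀, (K.x₀ + K.x₁) / 2, K.y₀, (K.y₀ + K.y₁) / 2⟩, by simp [Rect.children],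
      ⟨h1, hx⟩, h3, hy⟩
  · exact ⟨⟨K.x₀, (K.x₀ + K.x₁) / 2, (K.y₀ + K.y₁) / 2, K.y₁⟩, by simp [Rect.children],
      ⟨h1, hx⟩, hy, h4⟩
  · exact ⟨⟨(K.x₀ + K.x₁) / 2, K.x₁, K.y₀, (K.y₀ + K.y₁) / 2⟩, by simp [Rect.children],
      ⟨hx, h2⟩, h3, hy⟩
  · exact ⟨⟨(K.x₀ + K.x₁) / 2, K.x₁, (K.y₀ + K.y₁) / 2, K.y₁⟩, by simp [Rect.children],
      ⟨hx, h2⟩, hy, h4⟩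

lemma IsHierarchical.isDyadic {T₀ : TensorMesh} {T : Finset Rect} (h : IsHierarchical T₀ T) :
    IsDyadic T₀ T := by
  classical
  induction h with
  | init => exact isDyadic_elements T₀
  | refine T S _ hS ih =>
    have lt : ∀ K ∈ T, K.x₀ < K.x₁ ∧ K.y₀ < K.y₁ := fun K hK => (ih.isCell K hK).choose_spec.lt
    -- Every element of the new mesh lies in an element of the old mesh.
    have old : ∀ K' ∈ (T \ S) ∪ S.biUnion Rect.children, ∃ K ∈ T,
        (K.x₀ ≤ K'.x₀ ∧ K'.x₁ ≤ K.x₁ ∧ K.y₀ ≤ K'.y₀ ∧ K'.y₁ ≤ K.y₁) ∧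
        ((K' = K ∧ K ∉ S) ∨ (K ∈ S ∧ K' ∈ K.children)) := by
      intro K' hK'
      rw [Finset.mem_union, Finset.mem_sdiff, Finset.mem_biUnion] at hK'
      rcases hK' with ⟨h1, h2⟩ | ⟨K, hK, hKK'⟩
      · exact ⟨K', h1, ⟨le_rfl, le_rfl, le_rfl, le_rfl⟩, Or.inl ⟨rfl, h2⟩⟩
      · exact ⟨K, hS hK, child_le (lt K (hS hK)) hKK', Or.inr ⟨hK, hKK'⟩⟩
    refine ⟨fun K' hK' => ?_, fun K' hK' => ?_, fun v hv => ?_, fun K' hK' L' hL' hO => ?_⟩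
    · obtain ⟨K, hK, -, ⟨rfl, -⟩ | ⟨-, hc⟩⟩ := old K' hK'
      · exact ih.isCell _ hK
      · obtain ⟨l, hl⟩ := ih.isCell K hK
        exact ⟨l + 1, hl.child hc⟩
    · obtain ⟨K, hK, ⟨h1, h2, h3, h4⟩, -⟩ := old K' hK'
      exact (Set.prod_mono (Set.Icc_subset_Icc h1 h2) (Set.Icc_subset_Icc h3 h4)).trans
        (ih.subset K hK)
    · obtain ⟨K, hK, hvK⟩ := ih.cover v hv
      by_cases hKS : K ∈ S
      · obtain ⟨L, hL, hvL⟩ := exists_child_mem hvK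
        exact ⟨L, Finset.mem_union_right _ (Finset.mem_biUnion.2 ⟨K, hKS, hL⟩), hvL⟩
      · exact ⟨K, Finset.mem_union_left _ (Finset.mem_sdiff.2 ⟨hK, hKS⟩), hvK⟩
    · obtain ⟨K, hK, hle, hK2⟩ := old K' hK'
      obtain ⟨L, hL, hle', hL2⟩ := old L' hL'
      obtain rfl := ih.eq_of_overlap K hK L hL (hO.of_le hle hle')
      rcases hK2 with ⟨rfl, h1⟩ | ⟨h1, h2⟩ <;> rcases hL2 with ⟨rfl, h3⟩ | ⟨h3, h4⟩
      · rfl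
      · exact absurd h3 h1
      · exact absurd h1 h3
      · exact child_eq_of_overlap h2 h4 hO

/-! ### Vertices, T-junctions and adjacency -/

section
variable {T₀ : TensorMesh} {T : Finset Rect}

lemma IsDyadic.lt (hT : IsDyadic T₀ T) {K : Rect} (hK : K ∈ T) : K.x₀ < K.x₁ ∧ K.y₀ < K.y₁ :=
  (hT.isCell K hK).choose_spec.lt

lemma mem_vertices_iff {v : ℝ × ℝ} : v ∈ vertices T ↔ ∃ K ∈ T, v ∈ K.corners := by
  classical
  simp [vertices]

/-- The rectangle `K` contains `v` together with a piece of the quadrant in direction `d` at `v`. -/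
def HasQuadrant (K : Rect) (v d : ℝ × ℝ) : Prop :=
  v ∈ K.carrier ∧ ((0 < d.1 → v.1 < K.x₁) ∧ (d.1 < 0 → K.x₀ < v.1)) ∧
    ((0 < d.2 → v.2 < K.y₁) ∧ (d.2 < 0 → K.y₀ < v.2))

lemma HasQuadrant.overlap {K L : Rect} {v d : ℝ × ℝ} (h1 : d.1 ≠ 0) (h2 : d.2 ≠ 0)
    (hK : HasQuadrant K v d) (hL : HasQuadrant L v d) : Overlap K L := by
  obtain ⟨⟨⟨a1, a2⟩, a3, a4⟩, ⟨a5, a6⟩, a7, a8⟩ := hK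
  obtain ⟨⟨⟨b1, b2⟩, b3, b4⟩, ⟨b5, b6⟩, b7, b8⟩ := hL
  constructor
  · rcases lt_or_gt_of_ne h1 with h | h
    · have := a6 h; have := b6 h
      exact ⟨by linarith, by linarith⟩
    · have := a5 h; have := b5 h
      exact ⟨by linarith, by linarith⟩
  · rcases lt_or_gt_of_ne h2 with h | h
    · have := a8 h; have := b8 h
      exact ⟨by linarith, by linarith⟩
    · have := a7 h; have := b7 h
      exact ⟨by linarith, by linarith⟩

lemma isClosed_carrier (K : Rect) : IsClosed K.carrier := isClosed_Icc.prod isClosed_Icc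

lemma isCompact_carrier (K : Rect) : IsCompact K.carrier := isCompact_Icc.prod isCompact_Icc

lemma IsDyadic.exists_hasQuadrant (hT : IsDyadic T₀ T) {v d : ℝ × ℝ}
    (h : HasQuadrant T₀.domain v d) : ∃ K ∈ T, HasQuadrant K v d := by
  have one : ∀ {a b t δ : ℝ}, (a ≤ t ∧ t ≤ b) → (0 < δ → t < b) → (δ < 0 → a < t) →
      ∃ ε > 0, ∀ s, 0 ≤ s → s ≤ ε → a ≤ t + s * δ ∧ t + s * δ ≤ b := by
    intro a b t δ ht h1 h2
    rcases lt_trichotomy δ 0 with hδ | rfl | hδ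
    · refine ⟨(t - a) / (-δ), div_pos (sub_pos.2 (h2 hδ)) (neg_pos.2 hδ), fun s hs0 hs => ?_⟩
      rw [le_div_iff₀ (neg_pos.2 hδ)] at hs
      exact ⟨by linarith, by nlinarith⟩
    · exact ⟨1, one_pos, fun s _ _ => by simpa using ht⟩
    · refine ⟨(b - t) / δ, div_pos (sub_pos.2 (h1 hδ)) hδ, fun s hs0 hs => ?_⟩
      rw [le_div_iff₀ hδ] at hs
      exact ⟨by nlinarith, by linarith⟩
  obtain ⟨hv, ⟨hx1, hx2⟩, hy1, hy2⟩ := h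
  obtain ⟨ε₁, hε₁, H1⟩ := one hv.1 hx1 hx2
  obtain ⟨ε₂, hε₂, H2⟩ := one hv.2 hy1 hy2
  let s : ℕ → ℝ := fun n => min ε₁ ε₂ / (n + 1)
  have hs : ∀ n, 0 < s n := fun n => div_pos (lt_min hε₁ hε₂) (by positivity)
  have hs' : ∀ n, s n ≤ min ε₁ ε₂ := fun n =>
    div_le_self (lt_min hε₁ hε₂).le (by linarith [(Nat.cast_nonneg n : (0 : ℝ) ≤ n)])
  have hmem : ∀ n, ∃ K : T, v + s n • d ∈ K.1.carrier := fun n => by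
    obtain ⟨K, hK, h⟩ := hT.cover (v + s n • d)
      ⟨H1 _ (hs n).le ((hs' n).trans (min_le_left _ _)),
        H2 _ (hs n).le ((hs' n).trans (min_le_right _ _))⟩
    exact ⟨⟨K, hK⟩, h⟩
  choose K hK using hmem
  obtain ⟨L, hL⟩ := Finite.exists_infinite_fiber K
  have hinf : (K ⁻¹' {L}).Infinite := Set.infinite_coe_iff.1 hL
  have hfreq : ∃ᶠ n in Filter.atTop, v + s n • d ∈ L.1.carrier := by
    rw [Nat.frequently_atTop_iff_infinite]
    exact hinf.mono fun n hn => by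
      have : K n = L := hn
      simpa [this] using hK n
  have hlim : Filter.Tendsto (fun n => v + s n • d) Filter.atTop (nhds v) := by
    have h0 : Filter.Tendsto s Filter.atTop (nhds 0) :=
      tendsto_const_nhds.div_atTop
        (Filter.tendsto_atTop_add_const_right _ 1 tendsto_natCast_atTop_atTop)
    simpa using (tendsto_const_nhds (x := v)).add (h0.smul_const d)
  have hvL : v ∈ L.1.carrier := (isClosed_carrier L.1).mem_of_frequently_of_tendsto hfreq hlim
  obtain ⟨n, hn⟩ := hfreq.exists
  refine ⟨L.1, L.2, hvL, ⟨fun h => ?_, fun h => ?_⟩, fun h => ?_, fun h => ?_⟩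
  · have : v.1 + s n * d.1 ≤ L.1.x₁ := hn.1.2
    nlinarith [hs n, mul_pos (hs n) h]
  · have : L.1.x₀ ≤ v.1 + s n * d.1 := hn.1.1
    nlinarith [hs n, mul_pos (hs n) (neg_pos.2 h)]
  · have : v.2 + s n * d.2 ≤ L.1.y₁ := hn.2.2
    nlinarith [hs n, mul_pos (hs n) h]
  · have : L.1.y₀ ≤ v.2 + s n * d.2 := hn.2.1
    nlinarith [hs n, mul_pos (hs n) (neg_pos.2 h)]

end

section
variable {T₀ : TensorMesh} {T : Finset Rect}

/-- An element that contains a point in the interior of another element equals that element. -/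
lemma IsDyadic.eq_of_mem_interior (hT : IsDyadic T₀ T) {K L : Rect} (hK : K ∈ T) (hL : L ∈ T)
    {w : ℝ × ℝ} (hw : w ∈ L.carrier) (hx : K.x₀ < w.1 ∧ w.1 < K.x₁)
    (hy : K.y₀ < w.2 ∧ w.2 < K.y₁) : L = K := by
  obtain ⟨⟨h1, h2⟩, h3, h4⟩ := hw
  exact hT.eq_of_overlap L hL K hK ⟨⟨by linarith, by linarith⟩, by linarith, by linarith⟩

lemma IsDyadic.not_corner_of_interior (hT : IsDyadic T₀ T) {K L : Rect} (hK : K ∈ T) (hL : L ∈ T)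
    {w : ℝ × ℝ} (hw : w ∈ L.corners) (hx : K.x₀ < w.1 ∧ w.1 < K.x₁)
    (hy : K.y₀ < w.2 ∧ w.2 < K.y₁) : False := by
  obtain ⟨l, hl⟩ := hT.isCell L hL
  obtain rfl := hT.eq_of_mem_interior hK hL (hl.corners_subset hw) hx hy
  rcases (mem_corners_iff.1 hw).1 with h | h <;> rw [h] at hx
  exacts [lt_irrefl _ hx.1, lt_irrefl _ hx.2]

lemma domain_lt (T₀ : TensorMesh) : T₀.domain.x₀ < T₀.domain.x₁ ∧ T₀.domain.y₀ < T₀.domain.y₁ := by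
  rw [domain_eq]
  exact ⟨lineX_strictMono T₀ T₀.m_pos, lineY_strictMono T₀ T₀.n_pos⟩

lemma IsDyadic.domain_le (hT : IsDyadic T₀ T) {K : Rect} (hK : K ∈ T) :
    (T₀.domain.x₀ ≤ K.x₀ ∧ K.x₁ ≤ T₀.domain.x₁) ∧
      (T₀.domain.y₀ ≤ K.y₀ ∧ K.y₁ ≤ T₀.domain.y₁) := by
  have h := hT.lt hK
  have h1 := hT.subset K hK (a := (K.x₀, K.y₀)) ⟨⟨le_rfl, h.1.le⟩, le_rfl, h.2.le⟩
  have h2 := hT.subset K hK (a := (K.x₁, K.y₁)) ⟨⟨h.1.le, le_rfl⟩, h.2.le, le_rfl⟩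
  exact ⟨⟨h1.1.1, h2.1.2⟩, h1.2.1, h2.2.2⟩

lemma frontier_carrier (Ω : Rect) {w : ℝ × ℝ} (hw : w ∈ frontier Ω.carrier) :
    (w.1 = Ω.x₀ ∨ w.1 = Ω.x₁) ∨ (w.2 = Ω.y₀ ∨ w.2 = Ω.y₁) := by
  rw [Rect.carrier, (isClosed_Icc.prod isClosed_Icc).frontier_eq, interior_prod_eq, interior_Icc,
    interior_Icc] at hw
  obtain ⟨⟨⟨h1, h2⟩, h3, h4⟩, h⟩ := hw
  by_contra! hcon
  exact h ⟨⟨lt_of_le_of_ne h1 hcon.1.1.symm, lt_of_le_of_ne h2 hcon.1.2⟩,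
    lt_of_le_of_ne h3 hcon.2.1.symm, lt_of_le_of_ne h4 hcon.2.2⟩

/-- A basis vertex is a corner of every element that contains it; on the boundary this holds since
no element lies on the other side of the boundary edge. -/
lemma IsDyadic.mem_basisVertices_iff (hT : IsDyadic T₀ T) {w : ℝ × ℝ} :
    w ∈ basisVertices T₀.domain T ↔
      w ∈ vertices T ∧ ∀ K ∈ T, w ∈ K.carrier → w ∈ K.corners := by
  classical
  rw [basisVertices, Finset.mem_filter]
  refine and_congr_right fun hv => ⟨fun h => ?_, Or.inr⟩
  rcases h with h | h
  swap
  · exact h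
  intro K hK hwK
  obtain ⟨L, hL, hwL⟩ := mem_vertices_iff.1 hv
  have hLlt := hT.lt hL
  have hKlt := hT.lt hK
  have hKd := hT.domain_le hK
  have hLd := hT.domain_le hL
  obtain ⟨⟨k1, k2⟩, k3, k4⟩ := hwK
  have hLw : w ∈ L.carrier := by
    obtain ⟨l, hl⟩ := hT.isCell L hL
    exact hl.corners_subset hwL
  obtain ⟨⟨l1, l2⟩, l3, l4⟩ := hLw
  by_contra hc
  have hLK : L ≠ K := fun e => hc (e ▸ hwL)
  refine hLK (hT.eq_of_overlap L hL K hK ?_)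
  rw [mem_corners_iff] at hwL hc
  rcases frontier_carrier _ h with h | h
  · -- on a vertical boundary edge, `w` is strictly between the end points of an edge of `K`
    have hx : w.1 = K.x₀ ∨ w.1 = K.x₁ := by
      rcases h with h | h
      · exact Or.inl (le_antisymm (by linarith) k1)
      · exact Or.inr (le_antisymm k2 (by linarith))
    have hy : K.y₀ < w.2 ∧ w.2 < K.y₁ := by
      rw [not_and_or, not_or, not_or] at hc
      rcases hc with hc | hc
      · exact absurd hx (not_or.2 hc)
      · exact ⟨lt_of_le_of_ne k3 (Ne.symm hc.1), lt_of_le_of_ne k4 hc.2⟩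
    refine ⟨?_, by linarith, by linarith⟩
    rcases h with h | h <;> exact ⟨by linarith, by linarith⟩
  · have hy : w.2 = K.y₀ ∨ w.2 = K.y₁ := by
      rcases h with h | h
      · exact Or.inl (le_antisymm (by linarith) k3)
      · exact Or.inr (le_antisymm k4 (by linarith))
    have hx : K.x₀ < w.1 ∧ w.1 < K.x₁ := by
      rw [not_and_or, not_or, not_or] at hc
      rcases hc with hc | hc
      · exact ⟨lt_of_le_of_ne k1 (Ne.symm hc.1), lt_of_le_of_ne k2 hc.2⟩
      · exact absurd hy (not_or.2 hc)
    refine ⟨⟨by linarith, by linarith⟩, ?_⟩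
    rcases h with h | h <;> exact ⟨by linarith, by linarith⟩

lemma IsDyadic.mem_corners_of_basis (hT : IsDyadic T₀ T) {w : ℝ × ℝ}
    (hw : w ∈ basisVertices T₀.domain T) {K : Rect} (hK : K ∈ T) (hwK : w ∈ K.carrier) :
    w ∈ K.corners :=
  (hT.mem_basisVertices_iff.1 hw).2 K hK hwK

/-- Two elements share an edge segment of positive length. -/
def EdgeAdj (K L : Rect) : Prop :=
  ((K.y₁ = L.y₀ ∨ L.y₁ = K.y₀) ∧ K.x₀ < L.x₁ ∧ L.x₀ < K.x₁) ∨
  ((K.x₁ = L.x₀ ∨ L.x₁ = K.x₀) ∧ K.y₀ < L.y₁ ∧ L.y₀ < K.y₁)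

lemma EdgeAdj.symm {K L : Rect} (h : EdgeAdj K L) : EdgeAdj L K := by
  rcases h with ⟨h1, h2, h3⟩ | ⟨h1, h2, h3⟩
  exacts [Or.inl ⟨h1.symm, h3, h2⟩, Or.inr ⟨h1.symm, h3, h2⟩]

/-- A vertex of a mesh that is strictly inside a horizontal edge of `K` belongs to elements on the
other side of this edge only. -/
lemma IsDyadic.edgeAdj_of_horizontal (hT : IsDyadic T₀ T) {K L : Rect} (hK : K ∈ T) (hL : L ∈ T)
    {w : ℝ × ℝ} (hw : w ∈ L.corners) (hx : K.x₀ < w.1 ∧ w.1 < K.x₁)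
    (hy : w.2 = K.y₀ ∨ w.2 = K.y₁) : EdgeAdj L K ∧
      ((w.2 = K.y₀ → L.y₁ = w.2) ∧ (w.2 = K.y₁ → L.y₀ = w.2)) := by
  have hKlt := hT.lt hK
  have hLlt := hT.lt hL
  have hne : ¬ Overlap L K := fun h => by
    obtain rfl := hT.eq_of_overlap L hL K hK h
    rcases (mem_corners_iff.1 hw).1 with h | h <;> rw [h] at hx
    exacts [lt_irrefl _ hx.1, lt_irrefl _ hx.2]
  have hwL : w ∈ L.carrier := by
    obtain ⟨l, hl⟩ := hT.isCell L hL
    exact hl.corners_subset hw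
  obtain ⟨⟨l1, l2⟩, l3, l4⟩ := hwL
  have a1 : w.2 = K.y₀ → L.y₁ = w.2 := fun h => by
    by_contra hc
    have := lt_of_le_of_ne l4 (Ne.symm hc)
    exact hne ⟨⟨by linarith, by linarith⟩, by linarith, by linarith⟩
  have a2 : w.2 = K.y₁ → L.y₀ = w.2 := fun h => by
    by_contra hc
    have := lt_of_le_of_ne l3 hc
    exact hne ⟨⟨by linarith, by linarith⟩, by linarith, by linarith⟩
  refine ⟨Or.inl ⟨?_, by linarith, by linarith⟩, a1, a2⟩
  rcases hy with h | h
  · exact Or.inl ((a1 h).trans h)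
  · exact Or.inr (h.symm.trans (a2 h).symm)

lemma IsDyadic.edgeAdj_of_vertical (hT : IsDyadic T₀ T) {K L : Rect} (hK : K ∈ T) (hL : L ∈ T)
    {w : ℝ × ℝ} (hw : w ∈ L.corners) (hy : K.y₀ < w.2 ∧ w.2 < K.y₁)
    (hx : w.1 = K.x₀ ∨ w.1 = K.x₁) : EdgeAdj L K ∧
      ((w.1 = K.x₀ → L.x₁ = w.1) ∧ (w.1 = K.x₁ → L.x₀ = w.1)) := by
  have hKlt := hT.lt hK
  have hLlt := hT.lt hL
  have hne : ¬ Overlap L K := fun h => by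
    obtain rfl := hT.eq_of_overlap L hL K hK h
    rcases (mem_corners_iff.1 hw).2 with h | h <;> rw [h] at hy
    exacts [lt_irrefl _ hy.1, lt_irrefl _ hy.2]
  have hwL : w ∈ L.carrier := by
    obtain ⟨l, hl⟩ := hT.isCell L hL
    exact hl.corners_subset hw
  obtain ⟨⟨l1, l2⟩, l3, l4⟩ := hwL
  have a1 : w.1 = K.x₀ → L.x₁ = w.1 := fun h => by
    by_contra hc
    have := lt_of_le_of_ne l2 (Ne.symm hc)
    exact hne ⟨⟨by linarith, by linarith⟩, by linarith, by linarith⟩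
  have a2 : w.1 = K.x₁ → L.x₀ = w.1 := fun h => by
    by_contra hc
    have := lt_of_le_of_ne l1 hc
    exact hne ⟨⟨by linarith, by linarith⟩, by linarith, by linarith⟩
  refine ⟨Or.inr ⟨?_, by linarith, by linarith⟩, a1, a2⟩
  rcases hx with h | h
  · exact Or.inl ((a1 h).trans h)
  · exact Or.inr (h.symm.trans (a2 h).symm)

/-- If a corner `a` of `K`, of the same level as `K`, lies strictly inside a horizontal edge of a
coarser element, then no vertex of the mesh is strictly inside the edge of `K` on the same line
that ends in `a`. -/
lemma IsDyadic.basis_of_horizontal (hT : IsDyadic T₀ T) {K : Rect} (hK : K ∈ T) {l i j : ℕ}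
    (hcell : K = T₀.cell l i j) {w : ℝ × ℝ} (hw : w ∈ vertices T) (hx : K.x₀ < w.1 ∧ w.1 < K.x₁)
    (hy : w.2 = K.y₀ ∨ w.2 = K.y₁) :
    ∃ p, (p = i ∨ p = i + 1) ∧ (node T₀.lineX l p, w.2) ∈ basisVertices T₀.domain T ∧
      ∀ k < l, ¬ Grid T₀ k (node T₀.lineX l p, w.2) := by
  obtain ⟨p, hp, hodd⟩ : ∃ p, (p = i ∨ p = i + 1) ∧ (0 < l → Odd p) := by
    rcases Nat.even_or_odd i with h | h
    · exact ⟨i + 1, Or.inr rfl, fun _ => h.add_one⟩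
    · exact ⟨i, Or.inl rfl, fun _ => h⟩
  have hKl : IsCell T₀ l K := ⟨i, j, hcell⟩
  have haK : (node T₀.lineX l p, w.2) ∈ K.corners := by
    rw [mem_corners_iff]
    refine ⟨?_, hy⟩
    rw [hcell]
    rcases hp with rfl | rfl
    exacts [Or.inl rfl, Or.inr rfl]
  refine ⟨p, hp, hT.mem_basisVertices_iff.2 ⟨mem_vertices_iff.2 ⟨K, hK, haK⟩, ?_⟩, ?_⟩
  swap
  · rintro k hk ⟨q, r, h⟩
    exact node_odd_ne (lineX_strictMono T₀) hk (hodd (by omega)) (Prod.ext_iff.1 h).1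
  intro K' hK' haK'
  obtain ⟨k, q, r, hcell'⟩ := hT.isCell K' hK'
  have hKk : IsCell T₀ k K' := ⟨q, r, hcell'⟩
  rcases Nat.lt_or_ge k l with hkl | hkl
  swap
  · exact hKk.mem_corners hkl (hKl.grid_of_mem_corners haK) haK'
  exfalso
  have hpo := hodd (by omega)
  have haK'x := haK'.1
  rw [hcell'] at haK'x
  have hsub := node_odd_subset (lineX_strictMono T₀) hkl hpo haK'x.1 haK'x.2
  have hx' : K'.x₀ < w.1 ∧ w.1 < K'.x₁ := by
    rw [hcell] at hx
    rw [hcell']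
    have hp1 : 1 ≤ p := hpo.pos
    have m := (node_strictMono (lineX_strictMono T₀) l).monotone
    exact ⟨hsub.1.trans_lt ((m (by omega)).trans_lt hx.1),
      (hx.2.trans_le (m (by omega))).trans_le hsub.2⟩
  have hax : K'.x₀ < node T₀.lineX l p ∧ node T₀.lineX l p < K'.x₁ := by
    rw [hcell']
    exact ⟨lt_of_le_of_ne haK'x.1 (node_odd_ne (lineX_strictMono T₀) hkl hpo).symm,
      lt_of_le_of_ne haK'x.2 (node_odd_ne (lineX_strictMono T₀) hkl hpo)⟩
  have hay : w.2 = K'.y₀ ∨ w.2 = K'.y₁ := by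
    by_contra hcon
    rw [not_or] at hcon
    exact hT.not_corner_of_interior hK' hK haK hax
      ⟨lt_of_le_of_ne haK'.2.1 (Ne.symm hcon.1), lt_of_le_of_ne haK'.2.2 hcon.2⟩
  -- `K` and `K'` lie on different sides of the line, so no element has the corner `w`
  have hside := (hT.edgeAdj_of_horizontal hK' hK haK hax hay).2
  obtain ⟨L, hL, hwL⟩ := mem_vertices_iff.1 hw
  have s1 := (hT.edgeAdj_of_horizontal hK hL hwL hx hy).2
  have s2 := (hT.edgeAdj_of_horizontal hK' hL hwL hx' hay).2
  have hKlt := hT.lt hK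
  have hLlt := hT.lt hL
  simp only at hside
  rcases hay with h | h
  · have h1 := hside.1 h
    have h2 := s1.2 h1.symm
    have h3 := s2.1 h
    linarith
  · have h1 := hside.2 h
    have h2 := s1.1 h1.symm
    have h3 := s2.2 h
    linarith

lemma IsDyadic.basis_of_vertical (hT : IsDyadic T₀ T) {K : Rect} (hK : K ∈ T) {l i j : ℕ}
    (hcell : K = T₀.cell l i j) {w : ℝ × ℝ} (hw : w ∈ vertices T) (hy : K.y₀ < w.2 ∧ w.2 < K.y₁)
    (hx : w.1 = K.x₀ ∨ w.1 = K.x₁) :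
    ∃ p, (p = j ∨ p = j + 1) ∧ (w.1, node T₀.lineY l p) ∈ basisVertices T₀.domain T ∧
      ∀ k < l, ¬ Grid T₀ k (w.1, node T₀.lineY l p) := by
  obtain ⟨p, hp, hodd⟩ : ∃ p, (p = j ∨ p = j + 1) ∧ (0 < l → Odd p) := by
    rcases Nat.even_or_odd j with h | h
    · exact ⟨j + 1, Or.inr rfl, fun _ => h.add_one⟩
    · exact ⟨j, Or.inl rfl, fun _ => h⟩
  have hKl : IsCell T₀ l K := ⟨i, j, hcell⟩
  have haK : (w.1, node T₀.lineY l p) ∈ K.corners := by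
    rw [mem_corners_iff]
    refine ⟨hx, ?_⟩
    rw [hcell]
    rcases hp with rfl | rfl
    exacts [Or.inl rfl, Or.inr rfl]
  refine ⟨p, hp, hT.mem_basisVertices_iff.2 ⟨mem_vertices_iff.2 ⟨K, hK, haK⟩, ?_⟩, ?_⟩
  swap
  · rintro k hk ⟨q, r, h⟩
    exact node_odd_ne (lineY_strictMono T₀) hk (hodd (by omega)) (Prod.ext_iff.1 h).2
  intro K' hK' haK'
  obtain ⟨k, q, r, hcell'⟩ := hT.isCell K' hK'
  have hKk : IsCell T₀ k K' := ⟨q, r, hcell'⟩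
  rcases Nat.lt_or_ge k l with hkl | hkl
  swap
  · exact hKk.mem_corners hkl (hKl.grid_of_mem_corners haK) haK'
  exfalso
  have hpo := hodd (by omega)
  have haK'y := haK'.2
  rw [hcell'] at haK'y
  have hsub := node_odd_subset (lineY_strictMono T₀) hkl hpo haK'y.1 haK'y.2
  have hy' : K'.y₀ < w.2 ∧ w.2 < K'.y₁ := by
    rw [hcell] at hy
    rw [hcell']
    have hp1 : 1 ≤ p := hpo.pos
    have m := (node_strictMono (lineY_strictMono T₀) l).monotone
    exact ⟨hsub.1.trans_lt ((m (by omega)).trans_lt hy.1),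
      (hy.2.trans_le (m (by omega))).trans_le hsub.2⟩
  have hay : K'.y₀ < node T₀.lineY l p ∧ node T₀.lineY l p < K'.y₁ := by
    rw [hcell']
    exact ⟨lt_of_le_of_ne haK'y.1 (node_odd_ne (lineY_strictMono T₀) hkl hpo).symm,
      lt_of_le_of_ne haK'y.2 (node_odd_ne (lineY_strictMono T₀) hkl hpo)⟩
  have hax : w.1 = K'.x₀ ∨ w.1 = K'.x₁ := by
    by_contra hcon
    rw [not_or] at hcon
    exact hT.not_corner_of_interior hK' hK haK
      ⟨lt_of_le_of_ne haK'.1.1 (Ne.symm hcon.1), lt_of_le_of_ne haK'.1.2 hcon.2⟩ hay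
  have hside := (hT.edgeAdj_of_vertical hK' hK haK hay hax).2
  obtain ⟨L, hL, hwL⟩ := mem_vertices_iff.1 hw
  have s1 := (hT.edgeAdj_of_vertical hK hL hwL hy hx).2
  have s2 := (hT.edgeAdj_of_vertical hK' hL hwL hy' hax).2
  have hKlt := hT.lt hK
  have hLlt := hT.lt hL
  simp only at hside
  rcases hax with h | h
  · have h1 := hside.1 h
    have h2 := s1.2 h1.symm
    have h3 := s2.1 h
    linarith
  · have h1 := hside.2 h
    have h2 := s1.1 h1.symm
    have h3 := s2.2 h
    linarith

/-- The edge that carries a T-junction `w`: at least one of its end points is a basis vertex `a`,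
of the same level as the element `K`, and all elements with corner `w` are adjacent to `K`. -/
lemma IsDyadic.exists_edge (hT : IsDyadic T₀ T) {w : ℝ × ℝ} (hw : w ∈ vertices T)
    (hwb : w ∉ basisVertices T₀.domain T) :
    ∃ K ∈ T, w ∈ K.carrier ∧ ∃ l, IsCell T₀ l K ∧ ¬ Grid T₀ l w ∧ ∃ a ∈ K.corners, ∃ b ∈ K.corners, ∃ τ,
      OnEdge a b τ w ∧ 0 < τ ∧ τ < 1 ∧ a ≠ b ∧ a ∈ basisVertices T₀.domain T ∧
      (∀ k < l, ¬ Grid T₀ k a) ∧ ∀ L ∈ T, w ∈ L.corners → EdgeAdj L K := by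
  have hex : ∃ K ∈ T, w ∈ K.carrier ∧ w ∉ K.corners := by
    by_contra! hcon
    exact hwb (hT.mem_basisVertices_iff.2 ⟨hw, hcon⟩)
  obtain ⟨K, hK, hwK, hwc⟩ := hex
  obtain ⟨l, i, j, hcell⟩ := hT.isCell K hK
  have hKl : IsCell T₀ l K := ⟨i, j, hcell⟩
  have hKlt := hT.lt hK
  have ratio : ∀ {s e t : ℝ}, s ≠ e → (s < t ∧ t < e ∨ e < t ∧ t < s) →
      t = s + (t - s) / (e - s) * (e - s) ∧ 0 < (t - s) / (e - s) ∧ (t - s) / (e - s) < 1 := by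
    intro s e t hse h
    have h0 : e - s ≠ 0 := sub_ne_zero.2 hse.symm
    refine ⟨by rw [div_mul_cancel₀ _ h0]; ring, ?_⟩
    rcases h with ⟨h1, h2⟩ | ⟨h1, h2⟩
    · rw [div_lt_one (by linarith)]
      exact ⟨div_pos (by linarith) (by linarith), by linarith⟩
    · rw [div_lt_one_of_neg (by linarith)]
      exact ⟨div_pos_of_neg_of_neg (by linarith) (by linarith), by linarith⟩
  refine ⟨K, hK, hwK, l, hKl, fun hg => hwc (hKl.mem_corners le_rfl hg hwK), ?_⟩
  obtain ⟨L₀, hL₀, hwL₀⟩ := mem_vertices_iff.1 hw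
  by_cases hx : w.1 = K.x₀ ∨ w.1 = K.x₁
  · have hy : K.y₀ < w.2 ∧ w.2 < K.y₁ := by
      have : ¬ (w.2 = K.y₀ ∨ w.2 = K.y₁) := fun h => hwc (mem_corners_iff.2 ⟨hx, h⟩)
      rw [not_or] at this
      exact ⟨lt_of_le_of_ne hwK.2.1 (Ne.symm this.1), lt_of_le_of_ne hwK.2.2 this.2⟩
    obtain ⟨p, hp, hpb, hpl⟩ := hT.basis_of_vertical hK hcell hw hy hx
    have hadj : ∀ L ∈ T, w ∈ L.corners → EdgeAdj L K := fun L hL hwL =>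
      (hT.edgeAdj_of_vertical hK hL hwL hy hx).1
    rcases hp with rfl | rfl
    · have e : node T₀.lineY l p = K.y₀ := by rw [hcell]; rfl
      rw [e] at hpb hpl
      obtain ⟨r1, r2, r3⟩ := ratio hKlt.2.ne (Or.inl hy)
      exact ⟨(w.1, K.y₀), mem_corners_iff.2 ⟨hx, Or.inl rfl⟩, (w.1, K.y₁),
        mem_corners_iff.2 ⟨hx, Or.inr rfl⟩, _, Or.inr ⟨hKlt.2.ne, r1, rfl, rfl⟩, r2, r3,
        fun h => hKlt.2.ne (Prod.ext_iff.1 h).2, hpb, hpl, hadj⟩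
    · have e : node T₀.lineY l (j + 1) = K.y₁ := by rw [hcell]; rfl
      rw [e] at hpb hpl
      obtain ⟨r1, r2, r3⟩ := ratio hKlt.2.ne' (Or.inr hy)
      exact ⟨(w.1, K.y₁), mem_corners_iff.2 ⟨hx, Or.inr rfl⟩, (w.1, K.y₀),
        mem_corners_iff.2 ⟨hx, Or.inl rfl⟩, _, Or.inr ⟨hKlt.2.ne', r1, rfl, rfl⟩, r2, r3,
        fun h => hKlt.2.ne' (Prod.ext_iff.1 h).2, hpb, hpl, hadj⟩
  · have hx' : K.x₀ < w.1 ∧ w.1 < K.x₁ := by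
      rw [not_or] at hx
      exact ⟨lt_of_le_of_ne hwK.1.1 (Ne.symm hx.1), lt_of_le_of_ne hwK.1.2 hx.2⟩
    have hy : w.2 = K.y₀ ∨ w.2 = K.y₁ := by
      by_contra hcon
      rw [not_or] at hcon
      exact hT.not_corner_of_interior hK hL₀ hwL₀ hx'
        ⟨lt_of_le_of_ne hwK.2.1 (Ne.symm hcon.1), lt_of_le_of_ne hwK.2.2 hcon.2⟩
    obtain ⟨p, hp, hpb, hpl⟩ := hT.basis_of_horizontal hK hcell hw hx' hy
    have hadj : ∀ L ∈ T, w ∈ L.corners → EdgeAdj L K := fun L hL hwL =>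
      (hT.edgeAdj_of_horizontal hK hL hwL hx' hy).1
    rcases hp with rfl | rfl
    · have e : node T₀.lineX l p = K.x₀ := by rw [hcell]; rfl
      rw [e] at hpb hpl
      obtain ⟨r1, r2, r3⟩ := ratio hKlt.1.ne (Or.inl hx')
      exact ⟨(K.x₀, w.2), mem_corners_iff.2 ⟨Or.inl rfl, hy⟩, (K.x₁, w.2),
        mem_corners_iff.2 ⟨Or.inr rfl, hy⟩, _, Or.inl ⟨hKlt.1.ne, r1, rfl, rfl⟩, r2, r3,
        fun h => hKlt.1.ne (Prod.ext_iff.1 h).1, hpb, hpl, hadj⟩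
    · have e : node T₀.lineX l (i + 1) = K.x₁ := by rw [hcell]; rfl
      rw [e] at hpb hpl
      obtain ⟨r1, r2, r3⟩ := ratio hKlt.1.ne' (Or.inr hx')
      exact ⟨(K.x₁, w.2), mem_corners_iff.2 ⟨Or.inr rfl, hy⟩, (K.x₀, w.2),
        mem_corners_iff.2 ⟨Or.inl rfl, hy⟩, _, Or.inl ⟨hKlt.1.ne', r1, rfl, rfl⟩, r2, r3,
        fun h => hKlt.1.ne' (Prod.ext_iff.1 h).1, hpb, hpl, hadj⟩

/-- Every element has a corner that is a basis vertex: a corner with two odd indices, which is the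
centre of the parent element. -/
lemma IsDyadic.exists_basis_corner (hT : IsDyadic T₀ T) {K : Rect} (hK : K ∈ T) :
    ∃ z ∈ K.corners, z ∈ basisVertices T₀.domain T := by
  obtain ⟨l, i, j, hcell⟩ := hT.isCell K hK
  have hKl : IsCell T₀ l K := ⟨i, j, hcell⟩
  have odd : ∀ i : ℕ, ∃ p, (p = i ∨ p = i + 1) ∧ Odd p := fun i => by
    rcases Nat.even_or_odd i with h | h
    · exact ⟨i + 1, Or.inr rfl, h.add_one⟩
    · exact ⟨i, Or.inl rfl, h⟩
  obtain ⟨p, hp, hpo⟩ := odd i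
  obtain ⟨q, hq, hqo⟩ := odd j
  have hc : (node T₀.lineX l p, node T₀.lineY l q) ∈ K.corners := by
    rw [mem_corners_iff, hcell]
    refine ⟨?_, ?_⟩
    · rcases hp with rfl | rfl
      exacts [Or.inl rfl, Or.inr rfl]
    · rcases hq with rfl | rfl
      exacts [Or.inl rfl, Or.inr rfl]
  refine ⟨_, hc, hT.mem_basisVertices_iff.2 ⟨mem_vertices_iff.2 ⟨K, hK, hc⟩, ?_⟩⟩
  intro K' hK' hK'c
  obtain ⟨k, r, s, hcell'⟩ := hT.isCell K' hK'
  rcases Nat.lt_or_ge k l with hkl | hkl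
  swap
  · exact IsCell.mem_corners ⟨r, s, hcell'⟩ hkl (hKl.grid_of_mem_corners hc) hK'c
  exfalso
  have hK'c' := hK'c
  rw [hcell', mem_carrier_iff] at hK'c'
  refine hT.not_corner_of_interior hK' hK hc ?_ ?_ <;> rw [hcell']
  · exact ⟨lt_of_le_of_ne hK'c'.1.1 (node_odd_ne (lineX_strictMono T₀) hkl hpo).symm,
      lt_of_le_of_ne hK'c'.1.2 (node_odd_ne (lineX_strictMono T₀) hkl hpo)⟩
  · exact ⟨lt_of_le_of_ne hK'c'.2.1 (node_odd_ne (lineY_strictMono T₀) hkl hqo).symm,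
      lt_of_le_of_ne hK'c'.2.2 (node_odd_ne (lineY_strictMono T₀) hkl hqo)⟩

/-! ### Connectedness of patches -/

/-- `K` and `L` are elements inside `P` that share an edge segment. -/
def AdjIn (T : Finset Rect) (P : Set (ℝ × ℝ)) (K L : Rect) : Prop :=
  (K ∈ T ∧ K.carrier ⊆ P) ∧ (L ∈ T ∧ L.carrier ⊆ P) ∧ EdgeAdj K L

/-- The elements `K` and `L` are connected through edges inside `P`. -/
def ConnIn (T : Finset Rect) (P : Set (ℝ × ℝ)) : Rect → Rect → Prop :=
  Relation.ReflTransGen (AdjIn T P)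

lemma ConnIn.symm {P : Set (ℝ × ℝ)} {K L : Rect} (h : ConnIn T P K L) : ConnIn T P L K := by
  have hs : Std.Symm (AdjIn T P) := ⟨fun A B h => ⟨h.2.1, h.1, h.2.2.symm⟩⟩
  exact (inferInstance : Std.Symm (Relation.ReflTransGen (AdjIn T P))).symm _ _ h

lemma ConnIn.mono {P Q : Set (ℝ × ℝ)} (hPQ : P ⊆ Q) {K L : Rect} (h : ConnIn T P K L) :
    ConnIn T Q K L :=
  Relation.ReflTransGen.mono (p := AdjIn T Q) (fun _ _ h => ⟨⟨h.1.1, h.1.2.trans hPQ⟩,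
    ⟨h.2.1.1, h.2.1.2.trans hPQ⟩, h.2.2⟩) _ _ h

/-- The elements around a point are connected through the elements around this point. -/
lemma IsDyadic.connIn_of_mem (hT : IsDyadic T₀ T) {P : Set (ℝ × ℝ)} {v : ℝ × ℝ}
    (hP : ∀ K ∈ T, v ∈ K.carrier → K.carrier ⊆ P) {K L : Rect} (hK : K ∈ T) (hL : L ∈ T)
    (hvK : v ∈ K.carrier) (hvL : v ∈ L.carrier) : ConnIn T P K L := by
  have quad : ∀ K ∈ T, v ∈ K.carrier → ∃ d : ℝ × ℝ, d.1 ≠ 0 ∧ d.2 ≠ 0 ∧ HasQuadrant K v d := by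
    intro K hK hv
    have hlt := hT.lt hK
    obtain ⟨d1, h1, h1'⟩ : ∃ d1 : ℝ, d1 ≠ 0 ∧ (0 < d1 → v.1 < K.x₁) ∧ (d1 < 0 → K.x₀ < v.1) := by
      rcases lt_or_ge v.1 K.x₁ with h | h
      · exact ⟨1, one_ne_zero, fun _ => h, fun h => absurd h (by norm_num)⟩
      · exact ⟨-1, by norm_num, fun h => absurd h (by norm_num), fun _ => by linarith⟩
    obtain ⟨d2, h2, h2'⟩ : ∃ d2 : ℝ, d2 ≠ 0 ∧ (0 < d2 → v.2 < K.y₁) ∧ (d2 < 0 → K.y₀ < v.2) := by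
      rcases lt_or_ge v.2 K.y₁ with h | h
      · exact ⟨1, one_ne_zero, fun _ => h, fun h => absurd h (by norm_num)⟩
      · exact ⟨-1, by norm_num, fun h => absurd h (by norm_num), fun _ => by linarith⟩
    exact ⟨(d1, d2), h1, h2, hv, h1', h2'⟩
  have touch : ∀ {a b a' b' t d d' : ℝ}, (a ≤ t ∧ t ≤ b) → (a' ≤ t ∧ t ≤ b') → a < b → a' < b' →
      d ≠ 0 → d' ≠ 0 → ((0 < d → t < b) ∧ (d < 0 → a < t)) →
      ((0 < d' → t < b') ∧ (d' < 0 → a' < t)) → (a < b' ∧ a' < b) ∨ (b = a' ∨ b' = a) := by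
    intro a b a' b' t d d' h1 h2 h3 h4 h5 h6 h7 h8
    by_cases e1 : b = a'
    · exact Or.inr (Or.inl e1)
    by_cases e2 : b' = a
    · exact Or.inr (Or.inr e2)
    exact Or.inl ⟨lt_of_le_of_ne (h1.1.trans h2.2) (Ne.symm e2),
      lt_of_le_of_ne (h2.1.trans h1.2) (Ne.symm e1)⟩
  obtain ⟨d, hd1, hd2, hd⟩ := quad K hK hvK
  obtain ⟨e, he1, he2, he⟩ := quad L hL hvL
  have hKd := hT.domain_le hK
  have hLd := hT.domain_le hL
  have step : ∀ A ∈ T, ∀ B ∈ T, v ∈ A.carrier → v ∈ B.carrier →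
      (Overlap A B ∨ EdgeAdj A B) → ConnIn T P A B := by
    intro A hA B hB hvA hvB h
    rcases h with h | h
    · rw [hT.eq_of_overlap A hA B hB h]
      exact Relation.ReflTransGen.refl
    · exact Relation.ReflTransGen.single ⟨⟨hA, hP A hA hvA⟩, ⟨hB, hP B hB hvB⟩, h⟩
  -- the element in the quadrant that has the first direction of `K` and the second one of `L`
  obtain ⟨N, hN, hNq⟩ := hT.exists_hasQuadrant (v := v) (d := (d.1, e.2))
    ⟨hT.subset K hK hvK,
      ⟨fun h => (hd.2.1.1 h).trans_le hKd.1.2, fun h => hKd.1.1.trans_lt (hd.2.1.2 h)⟩,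
      ⟨fun h => (he.2.2.1 h).trans_le hLd.2.2, fun h => hLd.2.1.trans_lt (he.2.2.2 h)⟩⟩
  have hvN := hNq.1
  refine Relation.ReflTransGen.trans (b := N) (step K hK N hN hvK hvN ?_)
    (step N hN L hL hvN hvL ?_)
  · have hx : K.x₀ < N.x₁ ∧ N.x₀ < K.x₁ :=
      (HasQuadrant.overlap (d := (d.1, 1)) (K := ⟨K.x₀, K.x₁, v.2, v.2 + 1⟩)
        (L := ⟨N.x₀, N.x₁, v.2, v.2 + 1⟩) hd1 one_ne_zero
        ⟨⟨hvK.1, le_rfl, by linarith⟩, hd.2.1, fun _ => by simp, fun h => absurd h (by norm_num)⟩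
        ⟨⟨hvN.1, le_rfl, by linarith⟩, hNq.2.1, fun _ => by simp,
          fun h => absurd h (by norm_num)⟩).1
    rcases touch hvK.2 hvN.2 (hT.lt hK).2 (hT.lt hN).2 hd2 he2 hd.2.2 hNq.2.2 with h | h
    · exact Or.inl ⟨hx, h⟩
    · exact Or.inr (Or.inl ⟨h, hx⟩)
  · have hy : N.y₀ < L.y₁ ∧ L.y₀ < N.y₁ :=
      (HasQuadrant.overlap (d := (1, e.2)) (K := ⟨v.1, v.1 + 1, N.y₀, N.y₁⟩)
        (L := ⟨v.1, v.1 + 1, L.y₀, L.y₁⟩) one_ne_zero he2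
        ⟨⟨⟨le_rfl, by linarith⟩, hvN.2⟩, ⟨fun _ => by simp, fun h => absurd h (by norm_num)⟩,
          hNq.2.2⟩
        ⟨⟨⟨le_rfl, by linarith⟩, hvL.2⟩, ⟨fun _ => by simp, fun h => absurd h (by norm_num)⟩,
          he.2.2⟩).2
    rcases touch hvN.1 hvL.1 (hT.lt hN).1 (hT.lt hL).1 hd1 he1 hNq.2.1 he.2.1 with h | h
    · exact Or.inl ⟨h, hy⟩
    · exact Or.inr (Or.inr ⟨h, hy⟩)

end

section
variable {T₀ : TensorMesh} {T : Finset Rect}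

/-! ### Layers -/

lemma mem_layer_succ {z v : ℝ × ℝ} {n : ℕ} : v ∈ layer T z (n + 1) ↔
    ∃ K ∈ T, (K.carrier ∩ layer T z n).Nonempty ∧ v ∈ K.carrier := by
  simp only [layer, mem_iUnion, exists_prop]

lemma carrier_subset_layer_succ {z : ℝ × ℝ} {n : ℕ} {K : Rect} (hK : K ∈ T)
    (h : (K.carrier ∩ layer T z n).Nonempty) : K.carrier ⊆ layer T z (n + 1) :=
  fun _ hv => mem_layer_succ.2 ⟨K, hK, h, hv⟩

lemma IsDyadic.layer_subset_succ (hT : IsDyadic T₀ T) {z : ℝ × ℝ} (hz : z ∈ T₀.domain.carrier)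
    (n : ℕ) : layer T z n ⊆ layer T z (n + 1) := by
  intro v hv
  cases n with
  | zero =>
    obtain rfl : v = z := hv
    obtain ⟨K, hK, hvK⟩ := hT.cover v hz
    exact mem_layer_succ.2 ⟨K, hK, ⟨v, hvK, rfl⟩, hvK⟩
  | succ n =>
    obtain ⟨K, hK, -, hvK⟩ := mem_layer_succ.1 hv
    exact mem_layer_succ.2 ⟨K, hK, ⟨v, hvK, hv⟩, hvK⟩

lemma IsDyadic.layer_mono (hT : IsDyadic T₀ T) {z : ℝ × ℝ} (hz : z ∈ T₀.domain.carrier) :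
    Monotone (layer T z) :=
  monotone_nat_of_le_succ (hT.layer_subset_succ hz)

lemma IsDyadic.layer_subset_domain (hT : IsDyadic T₀ T) {z : ℝ × ℝ} (hz : z ∈ T₀.domain.carrier)
    (n : ℕ) : layer T z n ⊆ T₀.domain.carrier := by
  refine (hT.layer_subset_succ hz n).trans fun v hv => ?_
  obtain ⟨K, hK, -, hvK⟩ := mem_layer_succ.1 hv
  exact hT.subset K hK hvK

/-- The elements of a layer are connected, inside this layer, with the elements around its
centre. -/
lemma IsDyadic.connIn_layer (hT : IsDyadic T₀ T) {z : ℝ × ℝ} (hz : z ∈ T₀.domain.carrier) {n : ℕ}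
    {K L : Rect} (hK : K ∈ T) (hKn : (K.carrier ∩ layer T z n).Nonempty) (hL : L ∈ T)
    (hzL : z ∈ L.carrier) : ConnIn T (layer T z (n + 1)) K L := by
  induction n generalizing K with
  | zero =>
    obtain ⟨v, hvK, rfl⟩ := hKn
    have hv : v ∈ layer T v 0 := rfl
    exact hT.connIn_of_mem (fun A hA hvA => carrier_subset_layer_succ hA ⟨v, hvA, hv⟩) hK hL hvK hzL
  | succ n ih =>
    obtain ⟨v, hvK, hv⟩ := hKn
    obtain ⟨N, hN, hNn, hvN⟩ := mem_layer_succ.1 hv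
    exact Relation.ReflTransGen.trans
      (hT.connIn_of_mem (fun A hA hvA => carrier_subset_layer_succ hA ⟨v, hvA, hv⟩) hK hN hvK hvN)
      ((ih hN hNn).mono (hT.layer_subset_succ hz _))

/-- Since the domain is connected, finitely many layers cover it. -/
lemma IsDyadic.exists_domain_subset_layer (hT : IsDyadic T₀ T) {z : ℝ × ℝ}
    (hz : z ∈ T₀.domain.carrier) : ∃ n, T₀.domain.carrier ⊆ layer T z n := by
  classical
  let S : Set (ℝ × ℝ) := ⋃ n, layer T z n
  have hS : ∀ K ∈ T, (K.carrier ∩ S).Nonempty → K.carrier ⊆ S := by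
    rintro K hK ⟨v, hvK, hv⟩
    obtain ⟨n, hn⟩ := mem_iUnion.1 hv
    exact (carrier_subset_layer_succ hK ⟨v, hvK, hn⟩).trans (subset_iUnion _ _)
  let A : Set (ℝ × ℝ) := ⋃ K ∈ T.filter fun K => (K.carrier ∩ S).Nonempty, K.carrier
  let B : Set (ℝ × ℝ) := ⋃ K ∈ T.filter fun K => ¬ (K.carrier ∩ S).Nonempty, K.carrier
  have hA : IsClosed A := isClosed_biUnion_finset fun K _ => isClosed_carrier K
  have hB : IsClosed B := isClosed_biUnion_finset fun K _ => isClosed_carrier K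
  have hAS : A ⊆ S := iUnion₂_subset fun K hK =>
    hS K (Finset.mem_filter.1 hK).1 (Finset.mem_filter.1 hK).2
  have hBS : ∀ v ∈ B, v ∉ S := by
    intro v hv hvS
    obtain ⟨K, hK, hvK⟩ := mem_iUnion₂.1 hv
    exact (Finset.mem_filter.1 hK).2 ⟨v, hvK, hvS⟩
  have hcov : T₀.domain.carrier ⊆ A ∪ B := by
    intro v hv
    obtain ⟨K, hK, hvK⟩ := hT.cover v hv
    by_cases h : (K.carrier ∩ S).Nonempty
    · exact Or.inl (mem_iUnion₂.2 ⟨K, Finset.mem_filter.2 ⟨hK, h⟩, hvK⟩)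
    · exact Or.inr (mem_iUnion₂.2 ⟨K, Finset.mem_filter.2 ⟨hK, h⟩, hvK⟩)
  have hconn : IsPreconnected T₀.domain.carrier := isPreconnected_Icc.prod isPreconnected_Icc
  have hzS : z ∈ S := mem_iUnion.2 ⟨0, rfl⟩
  have hzA : z ∈ A := (hcov hz).resolve_right fun h => hBS z h hzS
  have hdom : T₀.domain.carrier ⊆ A := by
    intro v hv
    refine (hcov hv).resolve_right fun hvB => ?_
    obtain ⟨w, -, hwA, hwB⟩ := (isPreconnected_closed_iff.1 hconn) A B hA hB hcov
      ⟨z, hz, hzA⟩ ⟨v, hv, hvB⟩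
    exact hBS w hwB (hAS hwA)
  have hn : ∀ K : T, ∃ n, (K.1.carrier ∩ layer T z n).Nonempty := by
    rintro ⟨K, hK⟩
    obtain ⟨l, hl⟩ := hT.isCell K hK
    have hc : (K.x₀, K.y₀) ∈ K.carrier := hl.corners_subset (by simp [Rect.corners])
    obtain ⟨n, hn⟩ := mem_iUnion.1 (hAS (hdom (hT.subset K hK hc)))
    exact ⟨n, _, hc, hn⟩
  choose f hf using hn
  refine ⟨Finset.univ.sup f + 1, fun v hv => ?_⟩
  obtain ⟨K, hK, hvK⟩ := hT.cover v hv
  obtain ⟨w, hw, hwn⟩ := hf ⟨K, hK⟩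
  exact mem_layer_succ.2 ⟨K, hK, ⟨w, hw,
    hT.layer_mono hz (Finset.le_sup (f := f) (Finset.mem_univ _)) hwn⟩, hvK⟩

lemma IsDyadic.basisVertices_subset (hT : IsDyadic T₀ T) {z : ℝ × ℝ}
    (hz : z ∈ basisVertices T₀.domain T) : z ∈ T₀.domain.carrier := by
  obtain ⟨K, hK, hzK⟩ := mem_vertices_iff.1 (hT.mem_basisVertices_iff.1 hz).1
  obtain ⟨l, hl⟩ := hT.isCell K hK
  exact hT.subset K hK (hl.corners_subset hzK)

lemma mem_layerPoints {Ω : Rect} {z w : ℝ × ℝ} {n : ℕ} :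
    w ∈ layerPoints Ω T z n ↔ w ∈ basisVertices Ω T ∧ w ∈ layer T z n := by
  simp [layerPoints]

lemma IsDyadic.determines_samplingPoints (hT : IsDyadic T₀ T)
    (hdet : DeterminesQuartics (basisVertices T₀.domain T)) {z : ℝ × ℝ}
    (hz : z ∈ T₀.domain.carrier) : DeterminesQuartics (samplingPoints T₀.domain T z) := by
  obtain ⟨n, hn⟩ := hT.exists_domain_subset_layer hz
  have : n ∈ {n | DeterminesQuartics (layerPoints T₀.domain T z n)} := fun p hp h0 =>
    hdet p hp fun w hw => h0 w (mem_layerPoints.2 ⟨hw, hn (hT.basisVertices_subset hw)⟩)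
  exact Nat.sInf_mem ⟨n, this⟩

lemma IsDyadic.layerNumber_pos (hT : IsDyadic T₀ T)
    (hdet : DeterminesQuartics (basisVertices T₀.domain T)) {z : ℝ × ℝ}
    (hz : z ∈ T₀.domain.carrier) : 0 < layerNumber T₀.domain T z := by
  by_contra hcon
  have h := hT.determines_samplingPoints hdet hz
  rw [samplingPoints, Nat.eq_zero_of_not_pos hcon] at h
  have h1 := h (fun v => v.1 - z.1)
    ⟨fun i j => if i = 0 ∧ j = 0 then -z.1 else if i = 1 ∧ j = 0 then 1 else 0, fun v => by
      simp [Finset.sum_range_succ]; ring⟩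
    (fun w hw => by
      have : w = z := (mem_layerPoints.1 hw).2
      simp [this]) (z.1 + 1, 0)
  simp at h1

lemma IsDyadic.carrier_subset_vertexPatch (hT : IsDyadic T₀ T)
    (hdet : DeterminesQuartics (basisVertices T₀.domain T)) {z : ℝ × ℝ}
    (hz : z ∈ T₀.domain.carrier) {K : Rect} (hK : K ∈ T) (hzK : z ∈ K.carrier) :
    K.carrier ⊆ vertexPatch T₀.domain T z := by
  have h : K.carrier ⊆ layer T z 1 := carrier_subset_layer_succ hK ⟨z, hzK, rfl⟩
  exact h.trans (hT.layer_mono hz (hT.layerNumber_pos hdet hz))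

/-- Every point of the patch of `z` lies in an element of this patch that is connected with all
elements around `z`. -/
lemma IsDyadic.exists_connIn_vertexPatch (hT : IsDyadic T₀ T)
    (hdet : DeterminesQuartics (basisVertices T₀.domain T)) {z : ℝ × ℝ}
    (hz : z ∈ T₀.domain.carrier) {L : Rect} (hL : L ∈ T) (hzL : z ∈ L.carrier) {b : ℝ × ℝ}
    (hb : b ∈ vertexPatch T₀.domain T z) :
    ∃ K ∈ T, b ∈ K.carrier ∧ K.carrier ⊆ vertexPatch T₀.domain T z ∧
      ConnIn T (vertexPatch T₀.domain T z) K L := by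
  obtain ⟨n, hn⟩ : ∃ n, layerNumber T₀.domain T z = n + 1 :=
    ⟨_, (Nat.succ_pred_eq_of_pos (hT.layerNumber_pos hdet hz)).symm⟩
  rw [vertexPatch, hn] at hb ⊢
  obtain ⟨K, hK, hKn, hbK⟩ := mem_layer_succ.1 hb
  exact ⟨K, hK, hbK, carrier_subset_layer_succ hK hKn, hT.connIn_layer hz hK hKn hL hzL⟩

/-! ### Derivatives of splines -/

lemma IsSpline.exists_poly {Ω : Rect} {s : ℝ × ℝ → ℝ} (hs : IsSpline Ω T s) {K : Rect} (hK : K ∈ T) :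
    ∃ c, ∀ v ∈ K.carrier, s v = poly 4 c 0 0 v := by
  obtain ⟨c, hc⟩ := hs.2 K hK
  exact ⟨c, fun v hv => by rw [hc v hv, poly_zero_zero]⟩

lemma hasDerivWithinAt_slice_fst {Ω : Rect} {s : ℝ × ℝ → ℝ} (hs : ContDiffOn ℝ 1 s Ω.carrier)
    {v : ℝ × ℝ} (hv : v ∈ Ω.carrier) :
    DifferentiableWithinAt ℝ (fun t => s (t, v.2)) (Icc Ω.x₀ Ω.x₁) v.1 := by
  have h := (hs.differentiableOn one_ne_zero) v hv
  refine DifferentiableWithinAt.comp (t := Ω.carrier) (g := s) (f := fun t => (t, v.2)) v.1 h ?_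
    fun t ht => ⟨ht, hv.2⟩
  fun_prop

lemma hasDerivWithinAt_slice_snd {Ω : Rect} {s : ℝ × ℝ → ℝ} (hs : ContDiffOn ℝ 1 s Ω.carrier)
    {v : ℝ × ℝ} (hv : v ∈ Ω.carrier) :
    DifferentiableWithinAt ℝ (fun t => s (v.1, t)) (Icc Ω.y₀ Ω.y₁) v.2 := by
  have h := (hs.differentiableOn one_ne_zero) v hv
  refine DifferentiableWithinAt.comp (t := Ω.carrier) (g := s) (f := fun t => (v.1, t)) v.2 h ?_
    fun t ht => ⟨hv.1, ht⟩
  fun_prop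

/-- The derivative of a function on `[a, b]` may be computed on a nondegenerate subinterval on which
it agrees with a differentiable function. -/
lemma derivWithin_eq_of_eqOn {f g : ℝ → ℝ} {a b a' b' t g' : ℝ} (hab : a' < b')
    (hsub : Icc a' b' ⊆ Icc a b) (ht : t ∈ Icc a' b')
    (hf : DifferentiableWithinAt ℝ f (Icc a b) t) (heq : EqOn f g (Icc a' b'))
    (hg : HasDerivAt g g' t) : derivWithin f (Icc a b) t = g' := by
  have h1 : HasDerivWithinAt f (derivWithin f (Icc a b) t) (Icc a' b') t :=
    hf.hasDerivWithinAt.mono hsub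
  have h2 : HasDerivWithinAt f g' (Icc a' b') t :=
    hg.hasDerivWithinAt.congr heq (heq ht)
  exact (uniqueDiffOn_Icc hab t ht).eq_deriv _ h1 h2

lemma IsDyadic.Icc_subset (hT : IsDyadic T₀ T) {K : Rect} (hK : K ∈ T) :
    Icc K.x₀ K.x₁ ⊆ Icc T₀.domain.x₀ T₀.domain.x₁ ∧ Icc K.y₀ K.y₁ ⊆ Icc T₀.domain.y₀ T₀.domain.y₁ :=
  ⟨Icc_subset_Icc (hT.domain_le hK).1.1 (hT.domain_le hK).1.2,
    Icc_subset_Icc (hT.domain_le hK).2.1 (hT.domain_le hK).2.2⟩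

lemma IsSpline.dx_eq (hT : IsDyadic T₀ T) {s : ℝ × ℝ → ℝ} (hs : IsSpline T₀.domain T s) {K : Rect}
    (hK : K ∈ T) {c : ℕ → ℕ → ℝ} (hc : ∀ v ∈ K.carrier, s v = poly 4 c 0 0 v) {v : ℝ × ℝ}
    (hv : v ∈ K.carrier) : dx T₀.domain s v = poly 4 c 1 0 v :=
  derivWithin_eq_of_eqOn (hT.lt hK).1 (hT.Icc_subset hK).1 hv.1
    (hasDerivWithinAt_slice_fst hs.1 (hT.subset K hK hv))
    (fun t ht => hc (t, v.2) ⟨ht, hv.2⟩) (hasDerivAt_poly_fst 4 c 0 0 v.1 v.2)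

lemma IsSpline.dy_eq (hT : IsDyadic T₀ T) {s : ℝ × ℝ → ℝ} (hs : IsSpline T₀.domain T s) {K : Rect}
    (hK : K ∈ T) {c : ℕ → ℕ → ℝ} (hc : ∀ v ∈ K.carrier, s v = poly 4 c 0 0 v) {v : ℝ × ℝ}
    (hv : v ∈ K.carrier) : dy T₀.domain s v = poly 4 c 0 1 v :=
  derivWithin_eq_of_eqOn (hT.lt hK).2 (hT.Icc_subset hK).2 hv.2
    (hasDerivWithinAt_slice_snd hs.1 (hT.subset K hK hv))
    (fun t ht => hc (v.1, t) ⟨hv.1, ht⟩) (hasDerivAt_poly_snd 4 c 0 0 v.1 v.2)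

/-- The mixed derivatives of the two polynomial pieces agree along a common vertical segment, since
the first derivatives in `x` do. -/
lemma IsSpline.mixed_eq (hT : IsDyadic T₀ T) {s : ℝ × ℝ → ℝ} (hs : IsSpline T₀.domain T s)
    {K L : Rect} (hK : K ∈ T) (hL : L ∈ T) {c c' : ℕ → ℕ → ℝ}
    (hc : ∀ v ∈ K.carrier, s v = poly 4 c 0 0 v) (hc' : ∀ v ∈ L.carrier, s v = poly 4 c' 0 0 v)
    {v : ℝ × ℝ} (hvK : v ∈ K.carrier) (hvL : v ∈ L.carrier) {a b : ℝ} (hab : a < b)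
    (hav : v.2 ∈ Icc a b) (haK : Icc a b ⊆ Icc K.y₀ K.y₁) (haL : Icc a b ⊆ Icc L.y₀ L.y₁) :
    poly 4 c 1 1 v = poly 4 c' 1 1 v := by
  have h1 : HasDerivWithinAt (fun t => poly 4 c 1 0 (v.1, t)) (poly 4 c 1 1 v) (Icc a b) v.2 :=
    (hasDerivAt_poly_snd 4 c 1 0 v.1 v.2).hasDerivWithinAt
  have h2 : HasDerivWithinAt (fun t => poly 4 c' 1 0 (v.1, t)) (poly 4 c' 1 1 v) (Icc a b) v.2 :=
    (hasDerivAt_poly_snd 4 c' 1 0 v.1 v.2).hasDerivWithinAt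
  have heq : EqOn (fun t => poly 4 c 1 0 (v.1, t)) (fun t => poly 4 c' 1 0 (v.1, t)) (Icc a b) :=
    fun t ht => by
      have e1 := hs.dx_eq hT hK hc (v := (v.1, t)) ⟨hvK.1, haK ht⟩
      have e2 := hs.dx_eq hT hL hc' (v := (v.1, t)) ⟨hvL.1, haL ht⟩
      exact e1.symm.trans e2
  exact (uniqueDiffOn_Icc hab _ hav).eq_deriv _ h1 (h2.congr heq (heq hav))

/-- The geometric information of a spline at any point can be computed from any of the polynomial
pieces at this point; in particular the mixed derivative exists although a spline is only `C¹`. -/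
lemma IsSpline.geom_eq_jet (hT : IsDyadic T₀ T) {s : ℝ × ℝ → ℝ} (hs : IsSpline T₀.domain T s)
    {K : Rect} (hK : K ∈ T) {c : ℕ → ℕ → ℝ} (hc : ∀ v ∈ K.carrier, s v = poly 4 c 0 0 v)
    {v : ℝ × ℝ} (hv : v ∈ K.carrier) : geom T₀.domain s v = jet c v := by
  have hvΩ := hT.subset K hK hv
  have hKlt := hT.lt hK
  have hmix : dx T₀.domain (dy T₀.domain s) v = poly 4 c 1 1 v := by
    -- one-sided derivatives from the left (`σ = -1`) and from the right (`σ = 1`)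
    obtain ⟨τ, hτ0, hτ⟩ : ∃ τ : ℝ, τ ≠ 0 ∧ (0 < τ → v.2 < K.y₁) ∧ (τ < 0 → K.y₀ < v.2) := by
      rcases lt_or_ge v.2 K.y₁ with h | h
      · exact ⟨1, one_ne_zero, fun _ => h, fun h => absurd h (by norm_num)⟩
      · exact ⟨-1, by norm_num, fun h => absurd h (by norm_num), fun _ => by linarith⟩
    have side : ∀ σ : ℝ, ((0 < σ → v.1 < T₀.domain.x₁) ∧ (σ < 0 → T₀.domain.x₀ < v.1)) →
        ∃ L ∈ T, HasQuadrant L v (σ, τ) ∧ HasDerivWithinAt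
          (fun t => dy T₀.domain s (t, v.2)) (poly 4 c 1 1 v) (Icc L.x₀ L.x₁) v.1 := by
      intro σ hσ
      obtain ⟨L, hL, hLq⟩ := hT.exists_hasQuadrant (v := v) (d := (σ, τ))
        ⟨hvΩ, hσ, fun h => (hτ.1 h).trans_le (hT.domain_le hK).2.2,
          fun h => (hT.domain_le hK).2.1.trans_lt (hτ.2 h)⟩
      obtain ⟨c', hc'⟩ := hs.exists_poly hL
      have hvL := hLq.1
      have hmixed : poly 4 c 1 1 v = poly 4 c' 1 1 v := by
        rcases lt_or_gt_of_ne hτ0 with h | h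
        · have h1 := hτ.2 h
          have h2 : L.y₀ < v.2 := hLq.2.2.2 h
          exact hs.mixed_eq hT hK hL hc hc' hv hvL (max_lt h1 h2)
            ⟨max_le h1.le h2.le, le_rfl⟩ (Icc_subset_Icc (le_max_left _ _) hv.2.2)
            (Icc_subset_Icc (le_max_right _ _) hvL.2.2)
        · have h1 := hτ.1 h
          have h2 : v.2 < L.y₁ := hLq.2.2.1 h
          exact hs.mixed_eq hT hK hL hc hc' hv hvL (lt_min h1 h2)
            ⟨le_rfl, le_min h1.le h2.le⟩ (Icc_subset_Icc hv.2.1 (min_le_left _ _))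
            (Icc_subset_Icc hvL.2.1 (min_le_right _ _))
      refine ⟨L, hL, hLq, ?_⟩
      rw [hmixed]
      have heq : EqOn (fun t => dy T₀.domain s (t, v.2)) (fun t => poly 4 c' 0 1 (t, v.2))
          (Icc L.x₀ L.x₁) := fun t ht => hs.dy_eq hT hL hc' (v := (t, v.2)) ⟨ht, hvL.2⟩
      exact (hasDerivAt_poly_fst 4 c' 0 1 v.1 v.2).hasDerivWithinAt.congr heq (heq hvL.1)
    have hright : HasDerivWithinAt (fun t => dy T₀.domain s (t, v.2)) (poly 4 c 1 1 v)
        (Icc v.1 T₀.domain.x₁) v.1 := by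
      rcases lt_or_ge v.1 T₀.domain.x₁ with h | h
      · obtain ⟨L, -, hLq, hd⟩ := side 1 ⟨fun _ => h, fun h => absurd h (by norm_num)⟩
        refine hd.mono_of_mem_nhdsWithin ?_
        have h1 : v.1 < L.x₁ := hLq.2.1.1 one_pos
        have : Icc v.1 L.x₁ ∈ nhdsWithin v.1 (Icc v.1 T₀.domain.x₁) :=
          Filter.mem_of_superset (inter_mem_nhdsWithin _ (Iio_mem_nhds h1))
            fun t ht => ⟨ht.1.1, le_of_lt ht.2⟩
        exact Filter.mem_of_superset this (Icc_subset_Icc hLq.1.1.1 le_rfl)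
      · rw [Icc_eq_singleton_iff.2 ⟨rfl, le_antisymm h hvΩ.1.2⟩]
        exact HasFDerivWithinAt.of_subsingleton subsingleton_singleton
    have hleft : HasDerivWithinAt (fun t => dy T₀.domain s (t, v.2)) (poly 4 c 1 1 v)
        (Icc T₀.domain.x₀ v.1) v.1 := by
      rcases lt_or_ge T₀.domain.x₀ v.1 with h | h
      · obtain ⟨L, -, hLq, hd⟩ := side (-1) ⟨fun h => absurd h (by norm_num), fun _ => h⟩
        refine hd.mono_of_mem_nhdsWithin ?_
        have h1 : L.x₀ < v.1 := hLq.2.1.2 (by norm_num)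
        have : Icc L.x₀ v.1 ∈ nhdsWithin v.1 (Icc T₀.domain.x₀ v.1) :=
          Filter.mem_of_superset (inter_mem_nhdsWithin _ (Ioi_mem_nhds h1))
            fun t ht => ⟨le_of_lt ht.2, ht.1.2⟩
        exact Filter.mem_of_superset this (Icc_subset_Icc le_rfl hLq.1.1.2)
      · rw [Icc_eq_singleton_iff.2 ⟨le_antisymm hvΩ.1.1 h, rfl⟩]
        exact HasFDerivWithinAt.of_subsingleton subsingleton_singleton
    have hunion := hleft.union hright
    rw [Icc_union_Icc_eq_Icc hvΩ.1.1 hvΩ.1.2] at hunion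
    exact hunion.derivWithin (uniqueDiffOn_Icc (domain_lt T₀).1 _ hvΩ.1)
  unfold geom jet
  rw [hc v hv, hs.dx_eq hT hK hc hv, hs.dy_eq hT hK hc hv, hmix]

end

/-! ### Univariate Hermite bumps -/

/-- `f` is continuously differentiable with derivative `f'`. -/
def IsC1 (f f' : ℝ → ℝ) : Prop := (∀ t, HasDerivAt f (f' t) t) ∧ Continuous f'

lemma IsC1.glue {f f' g g' : ℝ → ℝ} (hf : IsC1 f f') (hg : IsC1 g g') {a : ℝ} (h : f a = g a)
    (h' : f' a = g' a) :
    IsC1 (fun t => if t ≤ a then f t else g t) (fun t => if t ≤ a then f' t else g' t) := by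
  constructor
  · intro t
    beta_reduce
    rcases lt_trichotomy t a with ht | rfl | ht
    · rw [if_pos ht.le]
      refine (hf.1 t).congr_of_eventuallyEq ?_
      filter_upwards [Iio_mem_nhds ht] with x hx
      rw [if_pos (le_of_lt hx)]
    · rw [if_pos le_rfl, ← hasDerivWithinAt_univ, ← Iic_union_Ici (a := t)]
      refine HasDerivWithinAt.union ?_ ?_
      · exact (hf.1 t).hasDerivWithinAt.congr (fun x hx => if_pos hx) (if_pos le_rfl)
      · rw [h']
        refine (hg.1 t).hasDerivWithinAt.congr (fun x hx => ?_) ?_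
        · rcases eq_or_lt_of_le (show t ≤ x from hx) with rfl | hx'
          · rw [if_pos le_rfl, h]
          · rw [if_neg (not_le.2 hx')]
        · rw [if_pos le_rfl, h]
    · rw [if_neg (not_le.2 ht)]
      refine (hg.1 t).congr_of_eventuallyEq ?_
      filter_upwards [Ioi_mem_nhds ht] with x hx
      rw [if_neg (not_le.2 hx)]
  · exact Continuous.if_le hf.2 hg.2 continuous_id continuous_const fun x hx => by
      rw [show x = a from hx, h']

lemma IsC1.zero : IsC1 (fun _ => 0) (fun _ => 0) := ⟨fun _ => hasDerivAt_const _ _, continuous_const⟩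

/-- The cubic polynomial with value `α` and slope `β` at `c` that vanishes doubly at `e`. -/
def hermitePiece (c e α β t : ℝ) : ℝ :=
  (e - t) ^ 2 * (α * (1 + 2 * (t - c) / (e - c)) + β * (t - c)) / (e - c) ^ 2

/-- The derivative of `hermitePiece`. -/
def hermitePiece' (c e α β t : ℝ) : ℝ :=
  (-2 * (e - t) * (α * (1 + 2 * (t - c) / (e - c)) + β * (t - c))
    + (e - t) ^ 2 * (2 * α / (e - c) + β)) / (e - c) ^ 2

lemma isC1_hermitePiece (c e α β : ℝ) : IsC1 (hermitePiece c e α β) (hermitePiece' c e α β) := by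
  constructor
  · intro t
    have h1 : HasDerivAt (fun t : ℝ => (e - t) ^ 2) (-2 * (e - t)) t := by
      have := ((hasDerivAt_id t).const_sub e).pow 2
      refine this.congr_deriv ?_
      simp
    have h2 : HasDerivAt (fun t : ℝ => α * (1 + 2 * (t - c) / (e - c)) + β * (t - c))
        (2 * α / (e - c) + β) t := by
      have h3 := (hasDerivAt_id t).sub_const c
      have h4 := ((((h3.const_mul 2).div_const (e - c)).const_add 1).const_mul α).add
        (h3.const_mul β)
      refine h4.congr_deriv ?_
      ring
    exact (h1.mul h2).div_const _
  · unfold hermitePiece'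
    fun_prop

/-- A compactly supported `C¹` piecewise cubic function with nodes `l < c < r`, value `α` and slope
`β` at `c`. -/
def bump (l c r α β t : ℝ) : ℝ :=
  if t ≤ l then 0 else if t ≤ c then hermitePiece c l α β t else
    if t ≤ r then hermitePiece c r α β t else 0

/-- The derivative of `bump`. -/
def bump' (l c r α β t : ℝ) : ℝ :=
  if t ≤ l then 0 else if t ≤ c then hermitePiece' c l α β t else
    if t ≤ r then hermitePiece' c r α β t else 0

section
variable {l c r : ℝ} (α β : ℝ)

lemma hermitePiece_center {e : ℝ} (h : e ≠ c) :
    hermitePiece c e α β c = α ∧ hermitePiece' c e α β c = β := by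
  have h' : e - c ≠ 0 := sub_ne_zero.2 h
  constructor
  · simp only [hermitePiece, sub_self, mul_zero, zero_div, add_zero, mul_one]
    field_simp
  · simp only [hermitePiece', sub_self, mul_zero, zero_div, add_zero, mul_one]
    field_simp
    ring

lemma hermitePiece_end (c e : ℝ) : hermitePiece c e α β e = 0 ∧ hermitePiece' c e α β e = 0 := by
  simp [hermitePiece, hermitePiece']

lemma isC1_bump (hl : l < c) (hr : c < r) : IsC1 (bump l c r α β) (bump' l c r α β) := by
  refine IsC1.zero.glue (IsC1.glue (isC1_hermitePiece c l α β)
    (IsC1.glue (isC1_hermitePiece c r α β) IsC1.zero ?_ ?_) ?_ ?_) ?_ ?_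
  · exact (hermitePiece_end α β c r).1
  · exact (hermitePiece_end α β c r).2
  · rw [if_pos hr.le, (hermitePiece_center α β hl.ne).1, (hermitePiece_center α β hr.ne').1]
  · rw [if_pos hr.le, (hermitePiece_center α β hl.ne).2, (hermitePiece_center α β hr.ne').2]
  · rw [if_pos hl.le, (hermitePiece_end α β c l).1]
  · rw [if_pos hl.le, (hermitePiece_end α β c l).2]

lemma bump_center (hl : l < c) : bump l c r α β c = α ∧ bump' l c r α β c = β := by
  unfold bump bump'
  rw [if_neg (not_le.2 hl), if_pos le_rfl, if_neg (not_le.2 hl), if_pos le_rfl]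
  exact hermitePiece_center α β hl.ne

lemma bump_left {t : ℝ} (h : t ≤ l) : bump l c r α β t = 0 ∧ bump' l c r α β t = 0 := by
  simp [bump, bump', h]

lemma bump_right (hl : l < c) (hr : c < r) {t : ℝ} (h : r ≤ t) :
    bump l c r α β t = 0 ∧ bump' l c r α β t = 0 := by
  have h1 : ¬ t ≤ l := by linarith
  have h2 : ¬ t ≤ c := by linarith
  unfold bump bump'
  rw [if_neg h1, if_neg h2, if_neg h1, if_neg h2]
  rcases eq_or_lt_of_le h with rfl | h
  · rw [if_pos le_rfl, if_pos le_rfl]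
    exact hermitePiece_end α β c r
  · rw [if_neg (not_le.2 h), if_neg (not_le.2 h)]
    exact ⟨rfl, rfl⟩

lemma bump_eq_left {t : ℝ} (h1 : l ≤ t) (h2 : t ≤ c) :
    bump l c r α β t = hermitePiece c l α β t := by
  unfold bump
  rcases eq_or_lt_of_le h1 with rfl | h1
  · rw [if_pos le_rfl, (hermitePiece_end α β c l).1]
  · rw [if_neg (not_le.2 h1), if_pos h2]

lemma bump_eq_right (hl : l < c) (hr : c < r) {t : ℝ} (h1 : c ≤ t) (h2 : t ≤ r) :
    bump l c r α β t = hermitePiece c r α β t := by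
  rcases eq_or_lt_of_le h1 with rfl | h1
  · rw [(bump_center α β hl).1, (hermitePiece_center α β hr.ne').1]
  · unfold bump
    rw [if_neg (by linarith), if_neg (by linarith), if_pos h2]

end

/-- `f` agrees with a cubic polynomial on `[a, b]`. -/
def CubicOn (f : ℝ → ℝ) (a b : ℝ) : Prop :=
  ∃ A : ℕ → ℝ, ∀ t, a ≤ t → t ≤ b → f t = ∑ i ∈ Finset.range 4, A i * t ^ i

lemma cubicOn_hermitePiece (c e α β a b : ℝ) : CubicOn (hermitePiece c e α β) a b := by
  -- `(e - t) ^ 2 * (p + q * t) * k` expanded in powers of `t`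
  let k := 1 / (e - c) ^ 2
  let q := 2 * α / (e - c) + β
  let p := α - c * q
  refine ⟨fun i => match i with
    | 0 => k * (e ^ 2 * p)
    | 1 => k * (e ^ 2 * q - 2 * e * p)
    | 2 => k * (p - 2 * e * q)
    | _ => k * q, fun t _ _ => ?_⟩
  simp only [Finset.sum_range_succ, Finset.sum_range_zero, hermitePiece, k, p, q]
  ring

lemma CubicOn.zero {f : ℝ → ℝ} {a b : ℝ} (h : ∀ t, a ≤ t → t ≤ b → f t = 0) : CubicOn f a b :=
  ⟨fun _ => 0, fun t h1 h2 => by simp [h t h1 h2]⟩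

/-- The node before the `i`-th node, where an additional node precedes the first one. -/
def prevNode (ξ : ℕ → ℝ) (l i : ℕ) : ℝ := if i = 0 then node ξ l 0 - 1 else node ξ l (i - 1)

/-- The Hermite bump at the `i`-th node of level `l`. -/
def nodeBump (ξ : ℕ → ℝ) (l i : ℕ) (α β : ℝ) : ℝ → ℝ :=
  bump (prevNode ξ l i) (node ξ l i) (node ξ l (i + 1)) α β

/-- The derivative of `nodeBump`. -/
def nodeBump' (ξ : ℕ → ℝ) (l i : ℕ) (α β : ℝ) : ℝ → ℝ :=
  bump' (prevNode ξ l i) (node ξ l i) (node ξ l (i + 1)) α β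

section
variable {ξ : ℕ → ℝ} (hξ : StrictMono ξ) {l i : ℕ} (α β : ℝ)
include hξ

lemma prevNode_lt : prevNode ξ l i < node ξ l i := by
  unfold prevNode
  split_ifs with h
  · rw [h]; linarith
  · exact node_strictMono hξ l (by omega)

lemma isC1_nodeBump : IsC1 (nodeBump ξ l i α β) (nodeBump' ξ l i α β) :=
  isC1_bump α β (prevNode_lt hξ) (node_strictMono hξ l (Nat.lt_succ_self i))

lemma nodeBump_center : nodeBump ξ l i α β (node ξ l i) = α ∧ nodeBump' ξ l i α β (node ξ l i) = β :=
  bump_center α β (prevNode_lt hξ)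

lemma nodeBump_left {p : ℕ} (hp : p < i) {t : ℝ} (ht : t ≤ node ξ l p) :
    nodeBump ξ l i α β t = 0 ∧ nodeBump' ξ l i α β t = 0 := by
  refine bump_left α β (ht.trans ?_)
  rw [prevNode, if_neg (by omega)]
  exact (node_strictMono hξ l).monotone (by omega)

lemma nodeBump_right {p : ℕ} (hp : i < p) {t : ℝ} (ht : node ξ l p ≤ t) :
    nodeBump ξ l i α β t = 0 ∧ nodeBump' ξ l i α β t = 0 :=
  bump_right α β (prevNode_lt hξ) (node_strictMono hξ l (Nat.lt_succ_self i))
    (((node_strictMono hξ l).monotone hp).trans ht)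

lemma nodeBump_other {p : ℕ} (hp : p ≠ i) :
    nodeBump ξ l i α β (node ξ l p) = 0 ∧ nodeBump' ξ l i α β (node ξ l p) = 0 := by
  rcases lt_or_gt_of_ne hp with h | h
  exacts [nodeBump_left hξ α β h le_rfl, nodeBump_right hξ α β h le_rfl]

lemma cubicOn_nodeBump {k p : ℕ} (hk : l ≤ k) :
    CubicOn (nodeBump ξ l i α β) (node ξ k p) (node ξ k (p + 1)) := by
  -- the interval lies in the interval `[node ξ l q, node ξ l (q + 1)]` of level `l`
  obtain ⟨q, h1, h2⟩ : ∃ q, node ξ l q ≤ node ξ k p ∧ node ξ k (p + 1) ≤ node ξ l (q + 1) := by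
    refine ⟨p / 2 ^ (k - l), ?_, ?_⟩
    · rw [← node_of_le ξ hk]
      exact (node_strictMono hξ k).monotone (Nat.mul_div_le _ _)
    · rw [← node_of_le ξ hk]
      exact (node_strictMono hξ k).monotone (Nat.lt_mul_div_succ p (by positivity))
  have hi := node_strictMono hξ l (Nat.lt_succ_self i)
  rcases lt_trichotomy q i with h | rfl | h
  · rcases Nat.lt_or_ge (q + 1) i with h' | h'
    · exact CubicOn.zero fun t _ ht => (nodeBump_left hξ α β h' (ht.trans h2)).1
    · obtain rfl : i = q + 1 := by omega
      obtain ⟨A, hA⟩ := cubicOn_hermitePiece (node ξ l (q + 1)) (prevNode ξ l (q + 1)) α β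
        (node ξ k p) (node ξ k (p + 1))
      refine ⟨A, fun t ht1 ht2 => (bump_eq_left α β ?_ (ht2.trans h2)).trans (hA t ht1 ht2)⟩
      rw [prevNode, if_neg (by omega), Nat.add_sub_cancel]
      exact h1.trans ht1
  · obtain ⟨A, hA⟩ := cubicOn_hermitePiece (node ξ l q) (node ξ l (q + 1)) α β
        (node ξ k p) (node ξ k (p + 1))
    exact ⟨A, fun t ht1 ht2 => (bump_eq_right α β (prevNode_lt hξ) hi (h1.trans ht1)
      (ht2.trans h2)).trans (hA t ht1 ht2)⟩
  · exact CubicOn.zero fun t ht _ => (nodeBump_right hξ α β h (h1.trans ht)).1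

lemma nodeBump_eq_zero {k p : ℕ} (hk : k ≤ l)
    (h : ¬ (node ξ k p ≤ node ξ l i ∧ node ξ l i ≤ node ξ k (p + 1))) {t : ℝ}
    (h1 : node ξ k p ≤ t) (h2 : t ≤ node ξ k (p + 1)) : nodeBump ξ l i α β t = 0 := by
  rw [← node_of_le ξ hk] at *
  rw [← node_of_le ξ hk (p + 1)] at *
  rw [(node_strictMono hξ l).le_iff_le, (node_strictMono hξ l).le_iff_le] at h
  rcases Nat.lt_or_ge i (2 ^ (l - k) * p) with h' | h'
  · exact (nodeBump_right hξ α β h' h1).1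
  · exact (nodeBump_left hξ α β (by omega) h2).1

end

/-! ### Existence of interpolating splines -/

section
variable {T₀ : TensorMesh} {T : Finset Rect}

lemma IsSpline.add {Ω : Rect} {s t : ℝ × ℝ → ℝ} (hs : IsSpline Ω T s) (ht : IsSpline Ω T t) :
    IsSpline Ω T (fun v => s v + t v) := by
  refine ⟨hs.1.add ht.1, fun K hK => ?_⟩
  obtain ⟨c, hc⟩ := hs.exists_poly hK
  obtain ⟨c', hc'⟩ := ht.exists_poly hK
  exact ⟨fun i j => c i j + c' i j, fun v hv => by
    beta_reduce
    rw [hc v hv, hc' v hv, ← poly_add, poly_zero_zero]⟩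

lemma IsSpline.sub {Ω : Rect} {s t : ℝ × ℝ → ℝ} (hs : IsSpline Ω T s) (ht : IsSpline Ω T t) :
    IsSpline Ω T (fun v => s v - t v) := by
  refine ⟨hs.1.sub ht.1, fun K hK => ?_⟩
  obtain ⟨c, hc⟩ := hs.exists_poly hK
  obtain ⟨c', hc'⟩ := ht.exists_poly hK
  exact ⟨fun i j => c i j - c' i j, fun v hv => by
    beta_reduce
    rw [hc v hv, hc' v hv, ← poly_sub, poly_zero_zero]⟩

lemma IsSpline.zero (Ω : Rect) : IsSpline Ω T (fun _ => 0) :=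
  ⟨contDiffOn_const, fun _ _ => ⟨fun _ _ => 0, by simp⟩⟩

lemma IsSpline.sum {Ω : Rect} {ι : Type*} (A : Finset ι) {s : ι → ℝ × ℝ → ℝ}
    (hs : ∀ i ∈ A, IsSpline Ω T (s i)) : IsSpline Ω T (fun v => ∑ i ∈ A, s i v) := by
  classical
  induction A using Finset.induction_on with
  | empty => simpa using IsSpline.zero Ω
  | insert a A ha ih =>
    simp only [Finset.sum_insert ha]
    exact (hs a (Finset.mem_insert_self a A)).add
      (ih fun i hi => hs i (Finset.mem_insert_of_mem hi))

lemma jet_add (c c' : ℕ → ℕ → ℝ) (v : ℝ × ℝ) :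
    jet (fun i j => c i j + c' i j) v = jet c v + jet c' v := by
  ext i
  fin_cases i <;> simp [jet, poly_add]

lemma jet_sub (c c' : ℕ → ℕ → ℝ) (v : ℝ × ℝ) :
    jet (fun i j => c i j - c' i j) v = jet c v - jet c' v := by
  ext i
  fin_cases i <;> simp [jet, poly_sub]

lemma jet_zero (v : ℝ × ℝ) : jet (fun _ _ => 0) v = 0 := by
  ext i
  fin_cases i <;> simp [jet, poly_zero]

lemma IsSpline.geom_add (hT : IsDyadic T₀ T) {s t : ℝ × ℝ → ℝ} (hs : IsSpline T₀.domain T s)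
    (ht : IsSpline T₀.domain T t) {v : ℝ × ℝ} (hv : v ∈ T₀.domain.carrier) :
    geom T₀.domain (fun v => s v + t v) v = geom T₀.domain s v + geom T₀.domain t v := by
  obtain ⟨K, hK, hvK⟩ := hT.cover v hv
  obtain ⟨c, hc⟩ := hs.exists_poly hK
  obtain ⟨c', hc'⟩ := ht.exists_poly hK
  rw [hs.geom_eq_jet hT hK hc hvK, ht.geom_eq_jet hT hK hc' hvK, ← jet_add]
  exact (hs.add ht).geom_eq_jet hT hK (fun v hv => by rw [hc v hv, hc' v hv, ← poly_add]) hvK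

lemma IsSpline.geom_sub (hT : IsDyadic T₀ T) {s t : ℝ × ℝ → ℝ} (hs : IsSpline T₀.domain T s)
    (ht : IsSpline T₀.domain T t) {v : ℝ × ℝ} (hv : v ∈ T₀.domain.carrier) :
    geom T₀.domain (fun v => s v - t v) v = geom T₀.domain s v - geom T₀.domain t v := by
  obtain ⟨K, hK, hvK⟩ := hT.cover v hv
  obtain ⟨c, hc⟩ := hs.exists_poly hK
  obtain ⟨c', hc'⟩ := ht.exists_poly hK
  rw [hs.geom_eq_jet hT hK hc hvK, ht.geom_eq_jet hT hK hc' hvK, ← jet_sub]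
  exact (hs.sub ht).geom_eq_jet hT hK (fun v hv => by rw [hc v hv, hc' v hv, ← poly_sub]) hvK

lemma geom_zero (Ω : Rect) (v : ℝ × ℝ) : geom Ω (fun _ => 0) v = 0 := by
  have h1 : dy Ω (fun _ => 0) = fun _ => 0 := by
    ext w
    simp [dy]
  ext i
  fin_cases i <;> simp [geom, h1, dx]

lemma geom_sum (hT : IsDyadic T₀ T) {ι : Type*} (A : Finset ι) {s : ι → ℝ × ℝ → ℝ}
    (hs : ∀ i ∈ A, IsSpline T₀.domain T (s i)) {v : ℝ × ℝ} (hv : v ∈ T₀.domain.carrier) :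
    geom T₀.domain (fun v => ∑ i ∈ A, s i v) v = ∑ i ∈ A, geom T₀.domain (s i) v := by
  classical
  induction A using Finset.induction_on with
  | empty => simpa using geom_zero _ _
  | insert a A ha ih =>
    simp only [Finset.sum_insert ha]
    have h2 : ∀ i ∈ A, IsSpline T₀.domain T (s i) := fun i hi => hs i (Finset.mem_insert_of_mem hi)
    rw [← ih h2]
    exact (hs a (Finset.mem_insert_self a A)).geom_add hT (IsSpline.sum A h2) hv

lemma isSpline_mul {Ω : Rect} {f f' g g' : ℝ → ℝ} (hf : IsC1 f f') (hg : IsC1 g g')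
    (h : ∀ K ∈ T, (CubicOn f K.x₀ K.x₁ ∧ CubicOn g K.y₀ K.y₁) ∨
      ∀ v ∈ K.carrier, f v.1 = 0 ∨ g v.2 = 0) : IsSpline Ω T (fun v => f v.1 * g v.2) := by
  have smooth : ∀ {f f' : ℝ → ℝ}, IsC1 f f' → ContDiff ℝ 1 f := fun {f f'} h => by
    rw [contDiff_one_iff_deriv]
    have e : deriv f = f' := funext fun t => (h.1 t).deriv
    exact ⟨fun t => (h.1 t).differentiableAt, by rw [e]; exact h.2⟩
  constructor
  · exact (((smooth hf).comp contDiff_fst).mul ((smooth hg).comp contDiff_snd)).contDiffOn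
  · intro K hK
    rcases h K hK with ⟨⟨A, hA⟩, B, hB⟩ | h0
    · refine ⟨fun i j => A i * B j, fun v hv => ?_⟩
      beta_reduce
      rw [hA _ hv.1.1 hv.1.2, hB _ hv.2.1 hv.2.2, Finset.sum_mul_sum]
      refine Finset.sum_congr rfl fun i _ => Finset.sum_congr rfl fun j _ => ?_
      ring
    · refine ⟨fun _ _ => 0, fun v hv => ?_⟩
      simpa using h0 v hv

lemma geom_mul {Ω : Rect} (hΩ : Ω.x₀ < Ω.x₁ ∧ Ω.y₀ < Ω.y₁) {f f' g g' : ℝ → ℝ} (hf : IsC1 f f')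
    (hg : IsC1 g g') {v : ℝ × ℝ} (hv : v ∈ Ω.carrier) :
    geom Ω (fun v => f v.1 * g v.2) v
      = ![f v.1 * g v.2, f' v.1 * g v.2, f v.1 * g' v.2, f' v.1 * g' v.2] := by
  have hx : ∀ a : ℝ, derivWithin (fun t => f t * a) (Icc Ω.x₀ Ω.x₁) v.1 = f' v.1 * a := fun a =>
    ((hf.1 v.1).mul_const a).hasDerivWithinAt.derivWithin (uniqueDiffOn_Icc hΩ.1 _ hv.1)
  have hy : ∀ a : ℝ, derivWithin (fun t => a * g t) (Icc Ω.y₀ Ω.y₁) v.2 = a * g' v.2 := fun a =>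
    ((hg.1 v.2).const_mul a).hasDerivWithinAt.derivWithin (uniqueDiffOn_Icc hΩ.2 _ hv.2)
  unfold geom
  congr 1
  simp only [dx, dy, hx, hy]

/-- The dyadic level of a grid point: the first uniform refinement of which it is a vertex. -/
def HasLevel (T₀ : TensorMesh) (l : ℕ) (z : ℝ × ℝ) : Prop :=
  Grid T₀ l z ∧ ∀ k < l, ¬ Grid T₀ k z

lemma Grid.exists_hasLevel {l : ℕ} {z : ℝ × ℝ} (h : Grid T₀ l z) : ∃ k ≤ l, HasLevel T₀ k z := by
  classical
  have hex : ∃ k, Grid T₀ k z := ⟨l, h⟩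
  exact ⟨Nat.find hex, Nat.find_min' hex h, Nat.find_spec hex, fun k hk => Nat.find_min hex hk⟩

lemma IsDyadic.exists_grid (hT : IsDyadic T₀ T) {z : ℝ × ℝ} (hz : z ∈ vertices T) :
    ∃ l, Grid T₀ l z := by
  obtain ⟨K, hK, hzK⟩ := mem_vertices_iff.1 hz
  obtain ⟨l, hl⟩ := hT.isCell K hK
  exact ⟨l, hl.grid_of_mem_corners hzK⟩

/-- The tensor product Hermite bump of the level of `z` is a spline. Its geometric information
vanishes at all other grid points of this level, but possibly not at points of higher level. -/
lemma IsDyadic.exists_bump (hT : IsDyadic T₀ T) {z : ℝ × ℝ}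
    (hz : z ∈ basisVertices T₀.domain T) {l : ℕ} (hl : HasLevel T₀ l z) (d : Fin 4 → ℝ) :
    ∃ s, IsSpline T₀.domain T s ∧ geom T₀.domain s z = d ∧
      ∀ w ∈ T₀.domain.carrier, Grid T₀ l w → w ≠ z → geom T₀.domain s w = 0 := by
  obtain ⟨⟨i, j, hzij⟩, hmin⟩ := hl
  have hX := lineX_strictMono T₀
  have hY := lineY_strictMono T₀
  have hzΩ := hT.basisVertices_subset hz
  have spl : ∀ α β α' β', IsSpline T₀.domain T
      (fun v => nodeBump T₀.lineX l i α β v.1 * nodeBump T₀.lineY l j α' β' v.2) := by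
    intro α β α' β'
    refine isSpline_mul (isC1_nodeBump hX α β) (isC1_nodeBump hY α' β') fun K hK => ?_
    obtain ⟨k, p, q, hcell⟩ := hT.isCell K hK
    rcases Nat.lt_or_ge k l with hkl | hkl
    · right
      have hzK : z ∉ K.carrier := fun hzK =>
        hmin k hkl (IsCell.grid_of_mem_corners ⟨p, q, hcell⟩ (hT.mem_corners_of_basis hz hK hzK))
      intro v hv
      rw [hcell, mem_carrier_iff] at hv hzK
      rw [hzij, not_and_or] at hzK
      rcases hzK with h | h
      · exact Or.inl (nodeBump_eq_zero hX α β hkl.le h hv.1.1 hv.1.2)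
      · exact Or.inr (nodeBump_eq_zero hY α' β' hkl.le h hv.2.1 hv.2.2)
    · left
      rw [hcell]
      exact ⟨cubicOn_nodeBump hX α β hkl, cubicOn_nodeBump hY α' β' hkl⟩
  have gm : ∀ α β α' β', ∀ v ∈ T₀.domain.carrier, _ := fun α β α' β' v hv =>
    geom_mul (domain_lt T₀) (isC1_nodeBump (l := l) (i := i) hX α β)
      (isC1_nodeBump (l := l) (i := j) hY α' β') hv
  refine ⟨_, (spl 1 0 (d 0) (d 2)).add (spl 0 1 (d 1) (d 3)), ?_, ?_⟩
  · rw [(spl 1 0 (d 0) (d 2)).geom_add hT (spl 0 1 (d 1) (d 3)) hzΩ, gm _ _ _ _ z hzΩ,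
      gm _ _ _ _ z hzΩ, hzij]
    simp only [(nodeBump_center hX _ _).1, (nodeBump_center hX _ _).2,
      (nodeBump_center hY _ _).1, (nodeBump_center hY _ _).2]
    ext n
    fin_cases n <;> simp
  · rintro w hw ⟨i', j', hwij⟩ hne
    have h0 : ∀ α β α' β', geom T₀.domain
        (fun v => nodeBump T₀.lineX l i α β v.1 * nodeBump T₀.lineY l j α' β' v.2) w = 0 := by
      intro α β α' β'
      rw [gm _ _ _ _ w hw, hwij]
      by_cases hi : i' = i
      · have hj : j' ≠ j := fun hj => hne (by rw [hwij, hzij, hi, hj])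
        simp only [(nodeBump_other hY α' β' hj).1, (nodeBump_other hY α' β' hj).2]
        ext n
        fin_cases n <;> simp
      · simp only [(nodeBump_other hX α β hi).1, (nodeBump_other hX α β hi).2]
        ext n
        fin_cases n <;> simp
    rw [(spl 1 0 (d 0) (d 2)).geom_add hT (spl 0 1 (d 1) (d 3)) hw, h0, h0, add_zero]

/-- The geometric information at the basis vertices can be prescribed arbitrarily: by induction, it
is corrected at the basis vertices of one level after the other. -/
lemma IsDyadic.exists_spline (hT : IsDyadic T₀ T) (d : ℝ × ℝ → Fin 4 → ℝ) :
    ∃ s, IsSpline T₀.domain T s ∧ ∀ z ∈ basisVertices T₀.domain T, geom T₀.domain s z = d z := by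
  classical
  have level : ∀ n : ℕ, ∃ s, IsSpline T₀.domain T s ∧ ∀ z ∈ basisVertices T₀.domain T,
      (∃ k < n, Grid T₀ k z) → geom T₀.domain s z = d z := by
    intro n
    induction n with
    | zero => exact ⟨_, IsSpline.zero _, fun z _ ⟨k, hk, _⟩ => absurd hk (Nat.not_lt_zero k)⟩
    | succ n ih =>
      obtain ⟨s, hs, hsd⟩ := ih
      let A := (basisVertices T₀.domain T).filter fun z => HasLevel T₀ n z
      have hA : ∀ z : A, ∃ t, IsSpline T₀.domain T t ∧
          geom T₀.domain t z = d z - geom T₀.domain s z ∧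
          ∀ w ∈ T₀.domain.carrier, Grid T₀ n w → w ≠ z → geom T₀.domain t w = 0 := fun z =>
        hT.exists_bump (Finset.mem_filter.1 z.2).1 (Finset.mem_filter.1 z.2).2 _
      choose t ht1 ht2 ht3 using hA
      have hsum := IsSpline.sum (Finset.univ : Finset A) (fun z _ => ht1 z)
      refine ⟨_, hs.add hsum, fun w hw ⟨k, hk, hkw⟩ => ?_⟩
      have hwΩ := hT.basisVertices_subset hw
      have hwn : Grid T₀ n w := hkw.mono (by omega)
      rw [hs.geom_add hT hsum hwΩ, geom_sum hT _ (fun z _ => ht1 z) hwΩ]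
      by_cases hlow : ∃ k < n, Grid T₀ k w
      · rw [hsd w hw hlow, Finset.sum_eq_zero, add_zero]
        intro z _
        refine ht3 z w hwΩ hwn ?_
        rintro rfl
        obtain ⟨k, hk, hkw⟩ := hlow
        exact (Finset.mem_filter.1 z.2).2.2 k hk hkw
      · push Not at hlow
        have hwA : w ∈ A := Finset.mem_filter.2 ⟨hw, hwn, hlow⟩
        rw [Finset.sum_eq_single (⟨w, hwA⟩ : A) (fun z _ hz => ht3 z w hwΩ hwn fun e =>
          hz (Subtype.ext e.symm)) (fun h => absurd (Finset.mem_univ _) h), ht2]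
        simp
  have hbound : ∀ z : basisVertices T₀.domain T, ∃ l, Grid T₀ l z := fun z =>
    hT.exists_grid (hT.mem_basisVertices_iff.1 z.2).1
  choose f hf using hbound
  obtain ⟨s, hs, hsd⟩ := level (Finset.univ.sup f + 1)
  exact ⟨s, hs, fun z hz => hsd z hz ⟨f ⟨z, hz⟩,
    Nat.lt_succ_of_le (Finset.le_sup (f := f) (Finset.mem_univ _)), hf ⟨z, hz⟩⟩⟩

lemma IsDyadic.interpSpline_spec (hT : IsDyadic T₀ T) (d : ℝ × ℝ → Fin 4 → ℝ) :
    IsSpline T₀.domain T (interpSpline T₀.domain T d) ∧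
      ∀ z ∈ basisVertices T₀.domain T, geom T₀.domain (interpSpline T₀.domain T d) z = d z :=
  Classical.epsilon_spec (hT.exists_spline d)

end

section
variable {T₀ : TensorMesh} {T : Finset Rect}

/-! ### Propagation of geometric information through T-junctions -/

lemma OnEdge.symm {a b w : ℝ × ℝ} {τ : ℝ} (h : OnEdge a b τ w) : OnEdge b a (1 - τ) w := by
  rcases h with ⟨h1, h2, h3, h4⟩ | ⟨h1, h2, h3, h4⟩
  · exact Or.inl ⟨h1.symm, by rw [h2]; ring, h4, h3⟩
  · exact Or.inr ⟨h1.symm, by rw [h2]; ring, h4, h3⟩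

lemma jet_eq_zero_of_ends {c : ℕ → ℕ → ℝ} {a b w : ℝ × ℝ} {τ : ℝ} (hw : OnEdge a b τ w)
    (ha : jet c a = 0) (hb : jet c b = 0) : jet c w = 0 := by
  have cub : ∀ {f f' : ℝ → ℝ}, IsCubic f f' → ∀ {a b : ℝ}, a ≠ b → f a = 0 → f' a = 0 → f b = 0 →
      f' b = 0 → f (a + τ * (b - a)) = 0 ∧ f' (a + τ * (b - a)) = 0 := by
    intro f f' hf a b hab h1 h2 h3 h4
    obtain ⟨e1, e2⟩ := hf.hermite a b τ
    rw [h1, h2, h3, h4] at e1 e2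
    refine ⟨by rw [e1]; ring, ?_⟩
    exact (mul_eq_zero.1 (e2.trans (by ring))).resolve_left (sub_ne_zero.2 hab.symm)
  obtain ⟨a1, a2⟩ := a
  obtain ⟨b1, b2⟩ := b
  obtain ⟨w1, w2⟩ := w
  simp only [OnEdge] at hw
  have comp : ∀ v, jet c v = 0 ↔ poly 4 c 0 0 v = 0 ∧ poly 4 c 1 0 v = 0 ∧ poly 4 c 0 1 v = 0 ∧
      poly 4 c 1 1 v = 0 := by
    intro v
    simp [jet, funext_iff, Fin.forall_fin_succ]
  rw [comp] at *
  obtain ⟨ha0, ha1, ha2, ha3⟩ := ha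
  obtain ⟨hb0, hb1, hb2, hb3⟩ := hb
  rcases hw with ⟨hne, rfl, rfl, rfl⟩ | ⟨hne, rfl, rfl, rfl⟩
  · have A := cub (isCubic_poly_fst c 0 b2) hne ha0 ha1 hb0 hb1
    have B := cub (isCubic_poly_fst c 1 b2) hne ha2 ha3 hb2 hb3
    exact ⟨A.1, A.2, B.1, B.2⟩
  · have A := cub (isCubic_poly_snd c 0 b1) hne ha0 ha2 hb0 hb2
    have B := cub (isCubic_poly_snd c 1 b1) hne ha1 ha3 hb1 hb3
    exact ⟨A.1, B.1, A.2, B.2⟩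

lemma IsDyadic.corner_mem (hT : IsDyadic T₀ T) {K : Rect} (hK : K ∈ T) {w : ℝ × ℝ}
    (hw : w ∈ K.corners) : w ∈ K.carrier := by
  obtain ⟨l, hl⟩ := hT.isCell K hK
  exact hl.corners_subset hw

lemma IsSpline.geom_eq_zero_of_ends (hT : IsDyadic T₀ T) {s : ℝ × ℝ → ℝ}
    (hs : IsSpline T₀.domain T s) {K : Rect} (hK : K ∈ T) {a b w : ℝ × ℝ} {τ : ℝ}
    (ha : a ∈ K.corners) (hb : b ∈ K.corners) (hwK : w ∈ K.carrier) (hw : OnEdge a b τ w)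
    (h1 : geom T₀.domain s a = 0) (h2 : geom T₀.domain s b = 0) : geom T₀.domain s w = 0 := by
  obtain ⟨c, hc⟩ := hs.exists_poly hK
  rw [hs.geom_eq_jet hT hK hc (hT.corner_mem hK ha)] at h1
  rw [hs.geom_eq_jet hT hK hc (hT.corner_mem hK hb)] at h2
  rw [hs.geom_eq_jet hT hK hc hwK]
  exact jet_eq_zero_of_ends hw h1 h2

lemma IsSpline.geom_end_eq_zero (hT : IsDyadic T₀ T) {s : ℝ × ℝ → ℝ}
    (hs : IsSpline T₀.domain T s) {K : Rect} (hK : K ∈ T) {a b w : ℝ × ℝ} {τ : ℝ}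
    (ha : a ∈ K.corners) (hb : b ∈ K.corners) (hwK : w ∈ K.carrier) (hw : OnEdge a b τ w)
    (h0τ : 0 < τ) (hτ1 : τ < 1) (h1 : geom T₀.domain s a = 0) (h2 : geom T₀.domain s w = 0) :
    geom T₀.domain s b = 0 := by
  obtain ⟨c, hc⟩ := hs.exists_poly hK
  rw [hs.geom_eq_jet hT hK hc (hT.corner_mem hK ha)] at h1
  rw [hs.geom_eq_jet hT hK hc (hT.corner_mem hK hb)]
  rw [hs.geom_eq_jet hT hK hc hwK] at h2
  exact jet_eq_zero_of_onEdge hw h0τ hτ1 h1 h2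

/-- If the geometric information vanishes at the basis vertices of all elements of level less than
`n`, then it vanishes at all vertices of these elements: that of a T-junction is determined by the
end points of an edge of an element of smaller level. -/
lemma IsSpline.geom_eq_zero_of_level (hT : IsDyadic T₀ T) {s : ℝ × ℝ → ℝ}
    (hs : IsSpline T₀.domain T s) (n : ℕ)
    (h : ∀ z ∈ basisVertices T₀.domain T, ∀ K ∈ T, ∀ k < n, IsCell T₀ k K → z ∈ K.corners →
      geom T₀.domain s z = 0) :
    ∀ K ∈ T, ∀ k < n, IsCell T₀ k K → ∀ w ∈ K.corners, geom T₀.domain s w = 0 := by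
  induction n using Nat.strong_induction_on with
  | _ n ih =>
    intro K hK k hk hKk w hw
    by_cases hwb : w ∈ basisVertices T₀.domain T
    · exact h w hwb K hK k hk hKk hw
    · obtain ⟨K', hK', hwK', l, hl, hlw, a, ha, b, hb, τ, hτ, -⟩ :=
        hT.exists_edge (mem_vertices_iff.2 ⟨K, hK, hw⟩) hwb
      have hlk : l < k := by
        by_contra hcon
        exact hlw ((hKk.grid_of_mem_corners hw).mono (not_lt.1 hcon))
      have hrec := ih k hk (fun z hz L hL j hj => h z hz L hL j (hj.trans hk)) K' hK' l hlk hl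
      exact hs.geom_eq_zero_of_ends hT hK' ha hb hwK' hτ (hrec a ha) (hrec b hb)

lemma IsSpline.eq_zero_of_corners (hT : IsDyadic T₀ T) {s : ℝ × ℝ → ℝ}
    (hs : IsSpline T₀.domain T s) {K : Rect} (hK : K ∈ T)
    (h : ∀ w ∈ K.corners, geom T₀.domain s w = 0) {v : ℝ × ℝ} (hv : v ∈ K.carrier) : s v = 0 := by
  obtain ⟨c, hc⟩ := hs.exists_poly hK
  have hKlt := hT.lt hK
  have hx := sub_pos.2 hKlt.1
  have hy := sub_pos.2 hKlt.2
  have hix := one_div_pos.2 hx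
  have hiy := one_div_pos.2 hy
  have hκ : 1 ≤ 1 + (K.x₁ - K.x₀) + (K.y₁ - K.y₀) + 1 / (K.x₁ - K.x₀) + 1 / (K.y₁ - K.y₀) := by
    linarith
  have h1 : ∀ {d κ : ℝ}, 0 < d → 1 / d ≤ κ → 1 ≤ κ * d := fun {d κ} hd h => by
    rwa [div_le_iff₀ hd] at h
  have := jetLE_of_corners (c := c) (K := K) (E := 0) one_pos hκ hKlt.1 hKlt.2 (by linarith)
    (by linarith) (h1 hx (by linarith)) (h1 hy (by linarith)) (fun w hw => ?_) hv
  · rw [hc v hv]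
    have h0 := this.1
    simp only [mul_zero] at h0
    exact abs_eq_zero.1 (le_antisymm h0 (abs_nonneg _))
  · rw [← hs.geom_eq_jet hT hK hc (hT.corner_mem hK hw), h w hw]
    exact JetLE.zero le_rfl

lemma IsSpline.geom_eq_zero_of_eq_zero (hT : IsDyadic T₀ T) {s : ℝ × ℝ → ℝ}
    (hs : IsSpline T₀.domain T s) {K : Rect} (hK : K ∈ T) (h : ∀ v ∈ K.carrier, s v = 0)
    {w : ℝ × ℝ} (hw : w ∈ K.carrier) : geom T₀.domain s w = 0 := by
  rw [hs.geom_eq_jet hT hK (c := fun _ _ => 0) (fun v hv => by rw [h v hv, poly_zero]) hw,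
    jet_zero]

/-- A spline is determined by its geometric information at the basis vertices. -/
lemma IsSpline.eq_zero_of_basis (hT : IsDyadic T₀ T) {s : ℝ × ℝ → ℝ}
    (hs : IsSpline T₀.domain T s) (h : ∀ z ∈ basisVertices T₀.domain T, geom T₀.domain s z = 0)
    {v : ℝ × ℝ} (hv : v ∈ T₀.domain.carrier) : s v = 0 := by
  obtain ⟨K, hK, hvK⟩ := hT.cover v hv
  obtain ⟨k, hk⟩ := hT.isCell K hK
  exact hs.eq_zero_of_corners hT hK (hs.geom_eq_zero_of_level hT (k + 1)
    (fun z hz _ _ _ _ _ _ => h z hz) K hK k (Nat.lt_succ_self k) hk) hvK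

/-- If only data at basis vertices in `A` are nonzero, and these vertices touch no element of level
less than `m`, then at most `l - m` interpolation steps separate a vertex of level `l` from `A`. -/
lemma IsSpline.jetLE_of_data (hT : IsDyadic T₀ T) {s : ℝ × ℝ → ℝ} (hs : IsSpline T₀.domain T s)
    {A : Set (ℝ × ℝ)} {η κ D : ℝ} (hη : 0 < η) (hκ : 1 ≤ κ) (hD0 : 0 ≤ D) {m l : ℕ}
    (hA : ∀ z ∈ basisVertices T₀.domain T, z ∉ A → geom T₀.domain s z = 0)
    (hD : ∀ z ∈ basisVertices T₀.domain T, z ∈ A → JetLE η D (geom T₀.domain s z))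
    (hm : ∀ z ∈ basisVertices T₀.domain T, z ∈ A → ∀ K ∈ T, ∀ k, IsCell T₀ k K → z ∈ K.corners →
      m ≤ k)
    (hsize : ∀ K ∈ T, ∀ k, IsCell T₀ k K → m ≤ k → k ≤ l →
      (K.x₁ - K.x₀ ≤ κ * η ∧ K.y₁ - K.y₀ ≤ κ * η) ∧
      (η ≤ κ * (K.x₁ - K.x₀) ∧ η ≤ κ * (K.y₁ - K.y₀)))
    (n : ℕ) (hn : n ≤ l) {w : ℝ × ℝ} (hw : w ∈ vertices T) (hnw : Grid T₀ n w) :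
    JetLE η ((8 * κ) ^ (n - m) * D) (geom T₀.domain s w) := by
  induction n using Nat.strong_induction_on generalizing w with
  | _ n ih =>
    have h8 : 1 ≤ 8 * κ := by linarith
    by_cases hwb : w ∈ basisVertices T₀.domain T
    · by_cases hwA : w ∈ A
      · exact (hD w hwb hwA).mono (le_mul_of_one_le_left hD0 (one_le_pow₀ h8))
      · rw [hA w hwb hwA]
        exact JetLE.zero (by positivity)
    obtain ⟨K, hK, hwK, k, hk, hkw, a, ha, b, hb, τ, hτ, h0τ, hτ1, -⟩ := hT.exists_edge hw hwb
    have hkn : k < n := by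
      by_contra hcon
      exact hkw (hnw.mono (not_lt.1 hcon))
    rcases Nat.lt_or_ge k m with hkm | hkm
    · have hrec := hs.geom_eq_zero_of_level hT m (fun z hz L hL j hj hLj hzL => hA z hz fun hzA =>
        absurd (hm z hz hzA L hL j hLj hzL) (not_le.2 hj)) K hK k hkm hk
      rw [hs.geom_eq_zero_of_ends hT hK ha hb hwK hτ (hrec a ha) (hrec b hb)]
      exact JetLE.zero (by positivity)
    · have ra := ih k hkn (hkn.le.trans hn) (mem_vertices_iff.2 ⟨K, hK, ha⟩)
        (hk.grid_of_mem_corners ha)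
      have rb := ih k hkn (hkn.le.trans hn) (mem_vertices_iff.2 ⟨K, hK, hb⟩)
        (hk.grid_of_mem_corners hb)
      obtain ⟨⟨s1, s2⟩, s3, s4⟩ := hsize K hK k hk hkm (hkn.le.trans hn)
      have hlt := hT.lt hK
      obtain ⟨c, hc⟩ := hs.exists_poly hK
      rw [hs.geom_eq_jet hT hK hc (hT.corner_mem hK ha)] at ra
      rw [hs.geom_eq_jet hT hK hc (hT.corner_mem hK hb)] at rb
      rw [hs.geom_eq_jet hT hK hc hwK]
      have hz : 0 ≤ κ * η := by positivity
      rw [mem_corners_iff] at ha hb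
      have dist : ∀ {p q x y : ℝ}, p < q → (x = p ∨ x = q) → (y = p ∨ y = q) →
          |y - x| = 0 ∧ x = y ∨ |y - x| = q - p := by
        intro p q x y hpq hx hy
        rcases hx with rfl | rfl <;> rcases hy with rfl | rfl
        · simp
        · exact Or.inr (abs_of_pos (sub_pos.2 hpq))
        · right; rw [abs_sub_comm]; exact abs_of_pos (sub_pos.2 hpq)
        · simp
      have dx := dist hlt.1 ha.1 hb.1
      have dy := dist hlt.2 ha.2 hb.2
      refine (jetLE_of_onEdge hτ hη hκ h0τ.le hτ1.le ?_ ?_ ?_ ?_ ra rb).mono ?_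
      · rcases dx with ⟨h, -⟩ | h <;> rw [h]
        exacts [hz, s1]
      · rcases dy with ⟨h, -⟩ | h <;> rw [h]
        exacts [hz, s2]
      · intro hne
        rcases dx with ⟨-, h⟩ | h
        exacts [absurd h hne, h ▸ s3]
      · intro hne
        rcases dy with ⟨-, h⟩ | h
        exacts [absurd h hne, h ▸ s4]
      · rw [← mul_assoc, ← pow_succ']
        exact mul_le_mul_of_nonneg_right (pow_le_pow_right₀ h8 (by omega)) hD0

/-! ### Active vertices and connectedness of element patches -/

/-- On `K`, a spline may be replaced by the one that has the same data at the active vertices and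
zero data elsewhere. -/
lemma IsSpline.exists_active_part (hT : IsDyadic T₀ T) {s : ℝ × ℝ → ℝ}
    (hs : IsSpline T₀.domain T s) {K : Rect} (hK : K ∈ T) :
    ∃ t, IsSpline T₀.domain T t ∧ (∀ v ∈ K.carrier, t v = s v) ∧
      (∀ z ∈ basisVertices T₀.domain T, IsActive T₀.domain T K z →
        geom T₀.domain t z = geom T₀.domain s z) ∧
      ∀ z ∈ basisVertices T₀.domain T, ¬ IsActive T₀.domain T K z → geom T₀.domain t z = 0 := by
  classical
  obtain ⟨t, ht, htd⟩ := hT.exists_spline fun z =>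
    if IsActive T₀.domain T K z then geom T₀.domain s z else 0
  have hr : ∀ z, ∃ r, IsSpline T₀.domain T r ∧ ∀ w ∈ basisVertices T₀.domain T,
      geom T₀.domain r w = if w = z then geom T₀.domain s z else 0 := fun z => hT.exists_spline _
  choose r hr hrd using hr
  let I := (basisVertices T₀.domain T).filter fun z => ¬ IsActive T₀.domain T K z
  have hsum := IsSpline.sum I (fun z _ => hr z)
  have hzero : ∀ v ∈ T₀.domain.carrier, (s v - t v) - ∑ z ∈ I, r z v = 0 := by
    refine fun v hv => ((hs.sub ht).sub hsum).eq_zero_of_basis hT (fun w hw => ?_) hv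
    have hwΩ := hT.basisVertices_subset hw
    rw [(hs.sub ht).geom_sub hT hsum hwΩ, hs.geom_sub hT ht hwΩ,
      geom_sum hT I (fun z _ => hr z) hwΩ, htd w hw, Finset.sum_congr rfl fun z _ => hrd z w hw]
    rw [Finset.sum_ite_eq]
    by_cases hwA : IsActive T₀.domain T K w
    · simp [I, hwA]
    · simp [I, hwA, hw]
  refine ⟨t, ht, fun v hv => ?_, fun z hz hA => ?_, fun z hz hA => ?_⟩
  · have h0 : ∑ z ∈ I, r z v = 0 := by
      refine Finset.sum_eq_zero fun z hz => ?_
      obtain ⟨hzb, hzA⟩ := Finset.mem_filter.1 hz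
      by_contra hne
      exact hzA ⟨hzb, r z, hr z, fun w hw hwz => by rw [hrd z w hw, if_neg hwz], v, hv, hne⟩
    have := hzero v (hT.subset K hK hv)
    linarith
  · rw [htd z hz, if_pos hA]
  · rw [htd z hz, if_neg hA]

lemma IsDyadic.isActive_of_mem (hT : IsDyadic T₀ T) {K : Rect} {z : ℝ × ℝ}
    (hz : z ∈ basisVertices T₀.domain T) (hzK : z ∈ K.carrier) : IsActive T₀.domain T K z := by
  classical
  obtain ⟨s, hs, hsd⟩ := hT.exists_spline fun w => if w = z then fun _ => 1 else 0
  refine ⟨hz, s, hs, fun w hw hwz => by rw [hsd w hw, if_neg hwz], z, hzK, ?_⟩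
  have h := congrFun (hsd z hz) 0
  rw [if_pos rfl] at h
  have h0 : s z = 1 := h
  rw [h0]
  exact one_ne_zero

lemma IsDyadic.carrier_subset_elementPatch (hT : IsDyadic T₀ T)
    (hdet : DeterminesQuartics (basisVertices T₀.domain T)) {K L : Rect} {z : ℝ × ℝ}
    (hz : IsActive T₀.domain T K z) (hL : L ∈ T) (hzL : z ∈ L.carrier) :
    L.carrier ⊆ elementPatch T₀.domain T K :=
  (hT.carrier_subset_vertexPatch hdet (hT.basisVertices_subset hz.1) hL hzL).trans
    (subset_iUnion₂ (s := fun z (_ : IsActive T₀.domain T K z) => vertexPatch T₀.domain T z) z hz)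

lemma IsDyadic.self_subset_elementPatch (hT : IsDyadic T₀ T)
    (hdet : DeterminesQuartics (basisVertices T₀.domain T)) {K : Rect} (hK : K ∈ T) :
    K.carrier ⊆ elementPatch T₀.domain T K := by
  obtain ⟨z, hzK, hz⟩ := hT.exists_basis_corner hK
  have hzc := hT.corner_mem hK hzK
  exact hT.carrier_subset_elementPatch hdet (hT.isActive_of_mem hz hzc) hK hzc

/-- The basis end point `a` of the edge that carries the vertex `w` influences `w`: the other end
point `b` does not depend on the data at `a`, which has a higher level. -/
lemma IsSpline.geom_other_end (hT : IsDyadic T₀ T) {s : ℝ × ℝ → ℝ} (hs : IsSpline T₀.domain T s)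
    {a b : ℝ × ℝ} {K : Rect} (hK : K ∈ T) {l : ℕ} (hl : IsCell T₀ l K) (hb : b ∈ K.corners)
    (hab : a ≠ b) (hal : ∀ k < l, ¬ Grid T₀ k a)
    (h : ∀ z ∈ basisVertices T₀.domain T, z ≠ a → geom T₀.domain s z = 0) :
    geom T₀.domain s b = 0 := by
  by_cases hbb : b ∈ basisVertices T₀.domain T
  · exact h b hbb hab.symm
  obtain ⟨K', hK', hbK', k, hk, hkb, a', ha', b', hb', τ, hτ, -⟩ :=
    hT.exists_edge (mem_vertices_iff.2 ⟨K, hK, hb⟩) hbb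
  have hkl : k < l := by
    by_contra hcon
    exact hkb ((hl.grid_of_mem_corners hb).mono (not_lt.1 hcon))
  have hrec := hs.geom_eq_zero_of_level hT l (fun z hz L _ j hj hLj hzL => h z hz fun e =>
    hal j hj (e ▸ hLj.grid_of_mem_corners hzL)) K' hK' k hkl hk
  exact hs.geom_eq_zero_of_ends hT hK' ha' hb' hbK' hτ (hrec a' ha') (hrec b' hb')

/-- The path of T-junctions that connects a corner of `K` with a basis vertex that influences it
stays in the element patch of `K`. The hypothesis `H` says that the geometric information at `w`
influences `K`, unless there are nonzero data at basis vertices of at least the level of `w`. -/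
lemma IsDyadic.exists_connIn_of_influence (hT : IsDyadic T₀ T)
    (hdet : DeterminesQuartics (basisVertices T₀.domain T)) {K : Rect} (n : ℕ) {w : ℝ × ℝ}
    {L : Rect} (hL : L ∈ T) (hLP : L.carrier ⊆ elementPatch T₀.domain T K) (hw : w ∈ L.corners)
    (hn : HasLevel T₀ n w) (hconn : ConnIn T (elementPatch T₀.domain T K) K L)
    (H : ∀ s, IsSpline T₀.domain T s → (∀ z ∈ basisVertices T₀.domain T, z ≠ w →
      (∀ k < n, ¬ Grid T₀ k z) → geom T₀.domain s z = 0) → geom T₀.domain s w ≠ 0 →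
      ∃ v ∈ K.carrier, s v ≠ 0)
    {z : ℝ × ℝ} {s : ℝ × ℝ → ℝ} (hs : IsSpline T₀.domain T s)
    (hsz : ∀ z' ∈ basisVertices T₀.domain T, z' ≠ z → geom T₀.domain s z' = 0)
    (hsw : geom T₀.domain s w ≠ 0) :
    ∃ N ∈ T, z ∈ N.carrier ∧ ConnIn T (elementPatch T₀.domain T K) K N := by
  classical
  induction n using Nat.strong_induction_on generalizing w L with
  | _ n ih =>
    by_cases hwb : w ∈ basisVertices T₀.domain T
    · have hwz : w = z := by
        by_contra hne
        exact hsw (hsz w hwb hne)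
      exact ⟨L, hL, hwz ▸ hT.corner_mem hL hw, hconn⟩
    obtain ⟨K', hK', hwK', l, hl, hlw, a, ha, b, hb, τ, hτ, h0τ, hτ1, hab, hab', hal, hadj⟩ :=
      hT.exists_edge (mem_vertices_iff.2 ⟨L, hL, hw⟩) hwb
    have hln : l < n := by
      by_contra hcon
      exact hlw (hn.1.mono (not_lt.1 hcon))
    have hgrid : Grid T₀ l a := hl.grid_of_mem_corners ha
    -- the end point `a` is active on `K`
    have hact : IsActive T₀.domain T K a := by
      obtain ⟨r, hr, hrd⟩ := hT.exists_spline fun w => if w = a then fun _ => 1 else 0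
      have hr0 : ∀ z ∈ basisVertices T₀.domain T, z ≠ a → geom T₀.domain r z = 0 :=
        fun z hz hza => by rw [hrd z hz, if_neg hza]
      refine ⟨hab', r, hr, hr0, H r hr (fun z hz _ hzn => hr0 z hz fun e =>
        hzn l hln (e ▸ hgrid)) fun hrw => ?_⟩
      have hrb := hr.geom_other_end hT hK' hl hb hab hal hr0
      have hra := hr.geom_end_eq_zero hT hK' hb ha hwK' hτ.symm (by linarith) (by linarith) hrb hrw
      rw [hrd a hab', if_pos rfl] at hra
      exact one_ne_zero (congrFun hra 0)
    have haK' := hT.corner_mem hK' ha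
    have hK'P := hT.carrier_subset_elementPatch hdet hact hK' haK'
    have hconn' : ConnIn T (elementPatch T₀.domain T K) K K' :=
      hconn.tail ⟨⟨hL, hLP⟩, ⟨hK', hK'P⟩, hadj L hL hw⟩
    by_cases hsa : geom T₀.domain s a = 0
    swap
    · have haz : a = z := by
        by_contra hne
        exact hsa (hsz a hab' hne)
      exact ⟨K', hK', haz ▸ haK', hconn'⟩
    obtain ⟨m, hml, hm⟩ := (hl.grid_of_mem_corners hb).exists_hasLevel
    refine ih m (by omega) hK' hK'P hb hm hconn' ?_ ?_
    · intro t ht ht0 htb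
      have hta : geom T₀.domain t a = 0 := ht0 a hab' hab fun k hk => hal k (by omega)
      refine H t ht (fun z hz _ hzn => ht0 z hz ?_ fun k hk => hzn k (by omega)) fun htw => ?_
      · rintro rfl
        exact hzn m (by omega) hm.1
      · exact htb (ht.geom_end_eq_zero hT hK' ha hb hwK' hτ h0τ hτ1 hta htw)
    · intro hsb
      exact hsw (hs.geom_eq_zero_of_ends hT hK' ha hb hwK' hτ hsa hsb)

/-- Every point of the patch of an active vertex lies in an element that is connected with `K`
through edges inside the element patch. -/
lemma IsDyadic.exists_connIn_elementPatch (hT : IsDyadic T₀ T)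
    (hdet : DeterminesQuartics (basisVertices T₀.domain T)) {K : Rect} (hK : K ∈ T) {z : ℝ × ℝ}
    (hz : IsActive T₀.domain T K z) {b : ℝ × ℝ} (hb : b ∈ vertexPatch T₀.domain T z) :
    ∃ N ∈ T, b ∈ N.carrier ∧ N.carrier ⊆ elementPatch T₀.domain T K ∧
      ConnIn T (elementPatch T₀.domain T K) K N := by
  have hKP := hT.self_subset_elementPatch hdet hK
  obtain ⟨hzb, s, hs, hsz, v, hvK, hv⟩ := id hz
  have hzΩ := hT.basisVertices_subset hzb
  obtain ⟨w, hwK, hw⟩ : ∃ w ∈ K.corners, geom T₀.domain s w ≠ 0 := by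
    by_contra! hcon
    exact hv (hs.eq_zero_of_corners hT hK hcon hvK)
  obtain ⟨l, hl⟩ := hT.isCell K hK
  obtain ⟨n, -, hn⟩ := (hl.grid_of_mem_corners hwK).exists_hasLevel
  obtain ⟨L, hL, hzL, hconn⟩ := hT.exists_connIn_of_influence hdet n hK hKP hwK hn
    Relation.ReflTransGen.refl (fun t ht _ htw => by
      by_contra! hcon
      exact htw (ht.geom_eq_zero_of_eq_zero hT hK hcon (hT.corner_mem hK hwK))) hs hsz hw
  obtain ⟨N, hN, hbN, hNP, hNL⟩ := hT.exists_connIn_vertexPatch hdet hzΩ hL hzL hb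
  have hsub : vertexPatch T₀.domain T z ⊆ elementPatch T₀.domain T K :=
    subset_iUnion₂ (s := fun z (_ : IsActive T₀.domain T K z) => vertexPatch T₀.domain T z) z hz
  exact ⟨N, hN, hbN, hNP.trans hsub, hconn.trans (hNL.mono hsub).symm⟩

end

/-! ### Quartic polynomials -/

/-- The coefficients `c` are those of a polynomial of total degree at most four. -/
def IsQuarticCoeff (c : ℕ → ℕ → ℝ) : Prop := ∀ i j, 4 < i + j → c i j = 0

lemma poly_five_eq {c : ℕ → ℕ → ℝ} (v : ℝ × ℝ) (hc : IsQuarticCoeff c) : poly 5 c 0 0 v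
    = ∑ i ∈ Finset.range 5, ∑ j ∈ Finset.range (5 - i), c i j * v.1 ^ i * v.2 ^ j := by
  rw [poly_zero_zero]
  refine Finset.sum_congr rfl fun i hi => ?_
  symm
  refine Finset.sum_subset (Finset.range_subset_range.2 (by omega)) fun j hj hj' => ?_
  rw [Finset.mem_range] at hi hj hj'
  rw [hc i j (by omega), zero_mul, zero_mul]

lemma isQuartic_iff {p : ℝ × ℝ → ℝ} :
    IsQuartic p ↔ ∃ c, IsQuarticCoeff c ∧ ∀ v, p v = poly 5 c 0 0 v := by
  constructor
  · rintro ⟨c, hc⟩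
    have h : IsQuarticCoeff (fun i j => if 4 < i + j then 0 else c i j) := fun i j h => if_pos h
    refine ⟨_, h, fun v => ?_⟩
    rw [hc v, poly_five_eq v h]
    refine Finset.sum_congr rfl fun i hi => Finset.sum_congr rfl fun j hj => ?_
    rw [Finset.mem_range] at hi hj
    rw [if_neg (by omega)]
  · rintro ⟨c, hc, h⟩
    exact ⟨c, fun v => by rw [h v, poly_five_eq v hc]⟩

lemma IsQuarticCoeff.sub {c c' : ℕ → ℕ → ℝ} (h : IsQuarticCoeff c) (h' : IsQuarticCoeff c') :
    IsQuarticCoeff (fun i j => c i j - c' i j) := fun i j hij => by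
  simp only [h i j hij, h' i j hij, sub_zero]

/-- The exponents of the monomials of degree at most four. -/
def quarticIndex : Finset (ℕ × ℕ) :=
  (Finset.range 5 ×ˢ Finset.range 5).filter fun p => p.1 + p.2 ≤ 4

/-- The coefficient array of a polynomial given by its coefficients of degree at most four. -/
def extendCoeff (x : quarticIndex → ℝ) (i j : ℕ) : ℝ :=
  if h : (i, j) ∈ quarticIndex then x ⟨(i, j), h⟩ else 0

lemma isQuarticCoeff_extendCoeff (x : quarticIndex → ℝ) : IsQuarticCoeff (extendCoeff x) := by
  intro i j h
  refine dif_neg fun h' => ?_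
  have := (Finset.mem_filter.1 h').2
  simp only at this
  omega

lemma poly_extendCoeff (x : quarticIndex → ℝ) (a b : ℕ) (v : ℝ × ℝ) :
    poly 5 (extendCoeff x) a b v = ∑ p : quarticIndex, x p *
      ((p.1.1.descFactorial a : ℝ) * v.1 ^ (p.1.1 - a)) *
      ((p.1.2.descFactorial b : ℝ) * v.2 ^ (p.1.2 - b)) := by
  unfold poly
  rw [← Finset.sum_product', Finset.univ_eq_attach]
  have h : ∀ p : quarticIndex, x p = extendCoeff x p.1.1 p.1.2 := fun p => by
    rw [extendCoeff, dif_pos p.2]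
  simp_rw [h]
  rw [Finset.sum_attach quarticIndex (fun p => extendCoeff x p.1 p.2 *
      ((p.1.descFactorial a : ℝ) * v.1 ^ (p.1 - a)) *
      ((p.2.descFactorial b : ℝ) * v.2 ^ (p.2 - b)))]
  symm
  refine Finset.sum_subset (Finset.filter_subset _ _) fun p _ hp => ?_
  rw [extendCoeff, dif_neg hp, zero_mul, zero_mul]

lemma extendCoeff_restrict {c : ℕ → ℕ → ℝ} (hc : IsQuarticCoeff c) :
    extendCoeff (fun p => c p.1.1 p.1.2) = c := by
  ext i j
  unfold extendCoeff
  split_ifs with h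
  · rfl
  · refine (hc i j ?_).symm
    by_contra hcon
    exact h (Finset.mem_filter.2 ⟨Finset.mem_product.2
      ⟨Finset.mem_range.2 (by simp only; omega), Finset.mem_range.2 (by simp only; omega)⟩,
      by simp only; omega⟩)

/-- Evaluation of quartic polynomials at finitely many points. -/
def evalMap (S : Finset (ℝ × ℝ)) : (quarticIndex → ℝ) →ₗ[ℝ] (S → ℝ) where
  toFun x z := poly 5 (extendCoeff x) 0 0 z
  map_add' x y := by
    ext z
    simp only [poly_extendCoeff, Pi.add_apply, ← Finset.sum_add_distrib]
    refine Finset.sum_congr rfl fun p _ => ?_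
    ring
  map_smul' r x := by
    ext z
    simp only [poly_extendCoeff, Pi.smul_apply, smul_eq_mul, RingHom.id_apply, Finset.mul_sum]
    refine Finset.sum_congr rfl fun p _ => ?_
    ring

lemma poly_eq_zero_iff {c : ℕ → ℕ → ℝ} (hc : IsQuarticCoeff c) (h : ∀ v, poly 5 c 0 0 v = 0) :
    c = fun _ _ => 0 := by
  -- five zeros determine a univariate polynomial of degree four
  have one : ∀ a : ℕ → ℝ, (∀ t : ℝ, ∑ i ∈ Finset.range 5, a i * t ^ i = 0) → ∀ i < 5, a i = 0 := by
    intro a ha i hi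
    have h0 := ha 0
    have h1 := ha 1
    have h2 := ha 2
    have h3 := ha 3
    have h4 := ha 4
    simp only [Finset.sum_range_succ, Finset.sum_range_zero] at h0 h1 h2 h3 h4
    interval_cases i <;> linarith
  ext i j
  by_cases hij : 4 < i + j
  · exact hc i j hij
  have h1 : ∀ t : ℝ, ∀ j < 5, ∑ i ∈ Finset.range 5, c i j * t ^ i = 0 := by
    intro t
    refine one _ fun s => ?_
    have := h (t, s)
    rw [poly_zero_zero, Finset.sum_comm] at this
    rw [← this]
    refine Finset.sum_congr rfl fun j _ => ?_
    rw [Finset.sum_mul]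
  exact one (fun i => c i j) (fun t => h1 t j (by omega)) i (by omega)

/-- The coefficients of a quartic polynomial are bounded by its values at points that determine
quartic polynomials. -/
lemma DeterminesQuartics.exists_bound {S : Finset (ℝ × ℝ)} (hS : DeterminesQuartics S) :
    ∃ C : ℝ, 0 ≤ C ∧ ∀ c, IsQuarticCoeff c → ∀ E, 0 ≤ E → (∀ z ∈ S, |poly 5 c 0 0 z| ≤ E) →
      ∀ i j, |c i j| ≤ C * E := by
  have hker : LinearMap.ker (evalMap S) = ⊥ := by
    rw [LinearMap.ker_eq_bot']
    intro x hx
    have hq := isQuarticCoeff_extendCoeff x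
    have h0 := hS (poly 5 (extendCoeff x) 0 0) (isQuartic_iff.2 ⟨_, hq, fun _ => rfl⟩)
      (fun z hz => congrFun hx ⟨z, hz⟩)
    have h1 := poly_eq_zero_iff hq h0
    ext p
    have h2 := congrFun (congrFun h1 p.1.1) p.1.2
    rwa [extendCoeff, dif_pos p.2] at h2
  obtain ⟨C, -, hC⟩ := LinearMap.exists_antilipschitzWith (evalMap S) hker
  refine ⟨C, C.2, fun c hc E hE h i j => ?_⟩
  by_cases hij : 4 < i + j
  · rw [hc i j hij, abs_zero]
    exact mul_nonneg C.2 hE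
  have hmem : (i, j) ∈ quarticIndex := Finset.mem_filter.2 ⟨Finset.mem_product.2
      ⟨Finset.mem_range.2 (by simp only; omega), Finset.mem_range.2 (by simp only; omega)⟩,
      by simp only; omega⟩
  have h1 := hC.le_mul_norm (map_zero (evalMap S)) (fun p : quarticIndex => c p.1.1 p.1.2)
  have h2 : ‖evalMap S (fun p : quarticIndex => c p.1.1 p.1.2)‖ ≤ E := by
    rw [pi_norm_le_iff_of_nonneg hE]
    intro z
    have : evalMap S (fun p : quarticIndex => c p.1.1 p.1.2) z = poly 5 c 0 0 z := by
      change poly 5 (extendCoeff _) 0 0 z = _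
      rw [extendCoeff_restrict hc]
    rw [this]
    exact h z z.2
  calc |c i j| = ‖(fun p : quarticIndex => c p.1.1 p.1.2) ⟨(i, j), hmem⟩‖ := rfl
    _ ≤ ‖(fun p : quarticIndex => c p.1.1 p.1.2)‖ :=
        norm_le_pi_norm (fun p : quarticIndex => c p.1.1 p.1.2) ⟨(i, j), hmem⟩
    _ ≤ C * ‖evalMap S (fun p : quarticIndex => c p.1.1 p.1.2)‖ := h1
    _ ≤ C * E := mul_le_mul_of_nonneg_left h2 C.2

lemma exists_uniform_bound (F : Finset (ℝ × ℝ)) :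
    ∃ C : ℝ, 0 ≤ C ∧ ∀ S ⊆ F, DeterminesQuartics S → ∀ c, IsQuarticCoeff c → ∀ E, 0 ≤ E →
      (∀ z ∈ S, |poly 5 c 0 0 z| ≤ E) → ∀ i j, |c i j| ≤ C * E := by
  classical
  have h : ∀ S : Finset (ℝ × ℝ), ∃ C : ℝ, 0 ≤ C ∧ (DeterminesQuartics S → ∀ c, IsQuarticCoeff c →
      ∀ E, 0 ≤ E → (∀ z ∈ S, |poly 5 c 0 0 z| ≤ E) → ∀ i j, |c i j| ≤ C * E) := by
    intro S
    by_cases hS : DeterminesQuartics S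
    · obtain ⟨C, h0, hC⟩ := hS.exists_bound
      exact ⟨C, h0, fun _ => hC⟩
    · exact ⟨0, le_rfl, fun h => absurd h hS⟩
  choose C h0 hC using h
  refine ⟨∑ S ∈ F.powerset, C S, Finset.sum_nonneg fun S _ => h0 S, ?_⟩
  intro S hSF hS c hc E hE h i j
  refine (hC S hS c hc E hE h i j).trans (mul_le_mul_of_nonneg_right ?_ hE)
  exact Finset.single_le_sum (fun S _ => h0 S) (Finset.mem_powerset.2 hSF)

/-- The coefficients of the Taylor expansion at `o`, in variables scaled by `η₁` and `η₂`. -/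
def taylorCoeff (c : ℕ → ℕ → ℝ) (o : ℝ × ℝ) (η₁ η₂ : ℝ) (k l : ℕ) : ℝ :=
  η₁ ^ k * η₂ ^ l / (k.factorial * l.factorial) * poly 5 c k l o

lemma poly_eq_zero_of_lt {c : ℕ → ℕ → ℝ} (hc : IsQuarticCoeff c) {a b : ℕ} (h : 4 < a + b)
    (v : ℝ × ℝ) : poly 5 c a b v = 0 := by
  refine Finset.sum_eq_zero fun i _ => Finset.sum_eq_zero fun j _ => ?_
  rcases Nat.lt_or_ge i a with hi | hi
  · rw [Nat.descFactorial_eq_zero_iff_lt.2 hi]; simp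
  rcases Nat.lt_or_ge j b with hj | hj
  · rw [Nat.descFactorial_eq_zero_iff_lt.2 hj]; simp
  rw [hc i j (by omega)]; simp

lemma IsQuarticCoeff.taylor {c : ℕ → ℕ → ℝ} (hc : IsQuarticCoeff c) (o : ℝ × ℝ) (η₁ η₂ : ℝ) :
    IsQuarticCoeff (taylorCoeff c o η₁ η₂) := fun k l h => by
  rw [taylorCoeff, poly_eq_zero_of_lt hc h, mul_zero]

lemma add_pow_eq_taylor {i : ℕ} (hi : i < 5) (o t : ℝ) : (o + t) ^ i
    = ∑ k ∈ Finset.range 5, t ^ k / k.factorial * ((i.descFactorial k : ℝ) * o ^ (i - k)) := by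
  interval_cases i <;>
  simp only [Finset.sum_range_succ, Finset.sum_range_zero, Nat.descFactorial, Nat.factorial] <;>
  norm_num <;> ring

lemma poly_taylor (c : ℕ → ℕ → ℝ) (o : ℝ × ℝ) (η₁ η₂ : ℝ) (v : ℝ × ℝ) :
    poly 5 (taylorCoeff c o η₁ η₂) 0 0 v = poly 5 c 0 0 (o.1 + η₁ * v.1, o.2 + η₂ * v.2) := by
  rw [poly_zero_zero, poly_zero_zero]
  have h : ∀ i ∈ Finset.range 5, ∀ j ∈ Finset.range 5,
      c i j * (o.1 + η₁ * v.1) ^ i * (o.2 + η₂ * v.2) ^ j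
      = ∑ k ∈ Finset.range 5, ∑ l ∈ Finset.range 5,
        η₁ ^ k * η₂ ^ l / (k.factorial * l.factorial) * (c i j *
          ((i.descFactorial k : ℝ) * o.1 ^ (i - k)) * ((j.descFactorial l : ℝ) * o.2 ^ (j - l)))
          * v.1 ^ k * v.2 ^ l := by
    intro i hi j hj
    rw [add_pow_eq_taylor (Finset.mem_range.1 hi), add_pow_eq_taylor (Finset.mem_range.1 hj),
      mul_assoc, Finset.sum_mul_sum, Finset.mul_sum]
    refine Finset.sum_congr rfl fun k _ => ?_
    rw [Finset.mul_sum]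
    refine Finset.sum_congr rfl fun l _ => ?_
    rw [mul_pow, mul_pow, ← div_mul_div_comm]
    ring
  rw [Finset.sum_congr rfl fun i hi => Finset.sum_congr rfl fun j hj => h i hi j hj]
  unfold taylorCoeff poly
  simp only [Finset.mul_sum, Finset.sum_mul]
  -- move the sums over `k` and `l` to the outside
  have swap : ∀ f : ℕ → ℕ → ℕ → ℕ → ℝ, ∀ A : Finset ℕ,
      ∑ k ∈ A, ∑ l ∈ A, ∑ i ∈ A, ∑ j ∈ A, f k l i j
        = ∑ i ∈ A, ∑ j ∈ A, ∑ k ∈ A, ∑ l ∈ A, f k l i j := by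
    intro f A
    calc _ = ∑ k ∈ A, ∑ i ∈ A, ∑ j ∈ A, ∑ l ∈ A, f k l i j := by
          refine Finset.sum_congr rfl fun k _ => ?_
          rw [Finset.sum_comm]
          refine Finset.sum_congr rfl fun i _ => ?_
          rw [Finset.sum_comm]
      _ = _ := by
          rw [Finset.sum_comm]
          refine Finset.sum_congr rfl fun i _ => ?_
          rw [Finset.sum_comm]
  exact swap (fun k l i j => η₁ ^ k * η₂ ^ l / (k.factorial * l.factorial) * (c i j *
          ((i.descFactorial k : ℝ) * o.1 ^ (i - k)) * ((j.descFactorial l : ℝ) * o.2 ^ (j - l)))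
          * v.1 ^ k * v.2 ^ l) (Finset.range 5)

/-- The points `(i, j)` with `0 ≤ i, j ≤ 4`. -/
def unitGrid : Finset (ℝ × ℝ) :=
  (Finset.range 5 ×ˢ Finset.range 5).image fun p => ((p.1 : ℝ), (p.2 : ℝ))

lemma determinesQuartics_unitGrid : DeterminesQuartics unitGrid := by
  have one : ∀ a : ℕ → ℝ, (∀ t < 5, ∑ i ∈ Finset.range 5, a i * (t : ℕ) ^ i = 0) →
      ∀ i < 5, a i = 0 := by
    intro a ha i hi
    have h0 := ha 0 (by norm_num)
    have h1 := ha 1 (by norm_num)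
    have h2 := ha 2 (by norm_num)
    have h3 := ha 3 (by norm_num)
    have h4 := ha 4 (by norm_num)
    simp only [Finset.sum_range_succ, Finset.sum_range_zero] at h0 h1 h2 h3 h4
    push_cast at h0 h1 h2 h3 h4
    interval_cases i <;> linarith
  intro p hp h v
  obtain ⟨c, -, hpc⟩ := isQuartic_iff.1 hp
  have h1 : ∀ t < 5, ∀ j < 5, ∑ i ∈ Finset.range 5, c i j * (t : ℕ) ^ i = 0 := by
    intro t ht
    refine one _ fun s hs => ?_
    have := h (t, s) (Finset.mem_image.2 ⟨(t, s), by simp [ht, hs], rfl⟩)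
    rw [hpc, poly_zero_zero, Finset.sum_comm] at this
    rw [← this]
    refine Finset.sum_congr rfl fun j _ => ?_
    rw [Finset.sum_mul]
  have h2 : ∀ i < 5, ∀ j < 5, c i j = 0 := fun i hi j hj =>
    one (fun i => c i j) (fun t ht => h1 t ht j hj) i hi
  rw [hpc, poly_zero_zero]
  refine Finset.sum_eq_zero fun i hi => Finset.sum_eq_zero fun j hj => ?_
  rw [h2 i (Finset.mem_range.1 hi) j (Finset.mem_range.1 hj)]
  simp

lemma abs_poly_le {c : ℕ → ℕ → ℝ} {B R : ℝ} (hR : 1 ≤ R) (hc : ∀ i j, |c i j| ≤ B) {v : ℝ × ℝ}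
    (h1 : |v.1| ≤ R) (h2 : |v.2| ≤ R) : |poly 5 c 0 0 v| ≤ 25 * B * R ^ 8 := by
  have hB : 0 ≤ B := (abs_nonneg _).trans (hc 0 0)
  have pw : ∀ {t : ℝ}, |t| ≤ R → ∀ i < 5, |t| ^ i ≤ R ^ 4 := fun {t} ht i hi =>
    (pow_le_pow_left₀ (abs_nonneg t) ht i).trans (pow_le_pow_right₀ hR (by omega))
  rw [poly_zero_zero]
  have : ∀ i ∈ Finset.range 5, ∀ j ∈ Finset.range 5, |c i j * v.1 ^ i * v.2 ^ j| ≤ B * R ^ 8 := by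
    intro i hi j hj
    rw [abs_mul, abs_mul, abs_pow, abs_pow, mul_assoc]
    refine mul_le_mul (hc i j) ?_ (by positivity) hB
    calc _ ≤ R ^ 4 * R ^ 4 := mul_le_mul (pw h1 i (Finset.mem_range.1 hi))
          (pw h2 j (Finset.mem_range.1 hj)) (by positivity) (by positivity)
      _ = R ^ 8 := by ring
  calc _ ≤ ∑ i ∈ Finset.range 5, |∑ j ∈ Finset.range 5, c i j * v.1 ^ i * v.2 ^ j| :=
        Finset.abs_sum_le_sum_abs _ _
    _ ≤ ∑ i ∈ Finset.range 5, ∑ j ∈ Finset.range 5, |c i j * v.1 ^ i * v.2 ^ j| :=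
        Finset.sum_le_sum fun i _ => Finset.abs_sum_le_sum_abs _ _
    _ ≤ ∑ i ∈ Finset.range 5, ∑ j ∈ Finset.range 5, B * R ^ 8 :=
        Finset.sum_le_sum fun i hi => Finset.sum_le_sum fun j hj => this i hi j hj
    _ = 25 * B * R ^ 8 := by simp; ring

/-- A quartic polynomial that is bounded on a rectangle is bounded on larger rectangles. -/
lemma exists_growth_bound : ∃ C : ℝ, 0 ≤ C ∧ ∀ c, IsQuarticCoeff c → ∀ (o : ℝ × ℝ) (a b E R : ℝ),
    0 < a → 0 < b → 0 ≤ E → 1 ≤ R →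
    (∀ v : ℝ × ℝ, v.1 ∈ Icc o.1 (o.1 + a) → v.2 ∈ Icc o.2 (o.2 + b) → |poly 5 c 0 0 v| ≤ E) →
    ∀ v : ℝ × ℝ, |v.1 - o.1| ≤ R * a → |v.2 - o.2| ≤ R * b →
      |poly 5 c 0 0 v| ≤ C * R ^ 8 * E := by
  obtain ⟨C, hC0, hC⟩ := determinesQuartics_unitGrid.exists_bound
  refine ⟨25 * 4 ^ 8 * C, by positivity, fun c hc o a b E R ha hb hE hR h v h1 h2 => ?_⟩
  have hco := hC _ (hc.taylor o (a / 4) (b / 4)) E hE fun z hz => by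
    rw [poly_taylor]
    obtain ⟨⟨i, j⟩, hij, rfl⟩ := Finset.mem_image.1 hz
    simp only [Finset.mem_product, Finset.mem_range] at hij
    have hi : (i : ℝ) ≤ 4 := by exact_mod_cast Nat.le_of_lt_succ hij.1
    have hj : (j : ℝ) ≤ 4 := by exact_mod_cast Nat.le_of_lt_succ hij.2
    have hi0 : (0 : ℝ) ≤ i := Nat.cast_nonneg i
    have hj0 : (0 : ℝ) ≤ j := Nat.cast_nonneg j
    exact h _ ⟨by simp only; nlinarith, by simp only; nlinarith⟩
      ⟨by simp only; nlinarith, by simp only; nlinarith⟩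
  have e := poly_taylor c o (a / 4) (b / 4) ((v.1 - o.1) / (a / 4), (v.2 - o.2) / (b / 4))
  have e1 : o.1 + a / 4 * ((v.1 - o.1) / (a / 4)) = v.1 := by field_simp; ring
  have e2 : o.2 + b / 4 * ((v.2 - o.2) / (b / 4)) = v.2 := by field_simp; ring
  rw [e1, e2] at e
  rw [show v = (v.1, v.2) from rfl, ← e]
  have hle := abs_poly_le (R := 4 * R) (by linarith) hco
    (v := ((v.1 - o.1) / (a / 4), (v.2 - o.2) / (b / 4)))
    (by rw [abs_div, abs_of_pos (by positivity : (0 : ℝ) < a / 4), div_le_iff₀ (by positivity)]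
        linarith)
    (by rw [abs_div, abs_of_pos (by positivity : (0 : ℝ) < b / 4), div_le_iff₀ (by positivity)]
        linarith)
  refine hle.trans_eq ?_
  ring

/-! ### Least-squares fits -/

lemma exists_leastSquares (S : Finset (ℝ × ℝ)) (w : ℝ × ℝ → ℝ) :
    ∃ p, IsQuartic p ∧ ∀ q, IsQuartic q →
      ∑ b ∈ S, (p b - w b) ^ 2 ≤ ∑ b ∈ S, (q b - w b) ^ 2 := by
  let Φ : (quarticIndex → ℝ) →ₗ[ℝ] EuclideanSpace ℝ S :=
    (WithLp.linearEquiv 2 ℝ (S → ℝ)).symm.toLinearMap ∘ₗ evalMap S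
  have hclosed : IsClosed (LinearMap.range Φ : Set (EuclideanSpace ℝ S)) :=
    Submodule.closed_of_finiteDimensional _
  let u : EuclideanSpace ℝ S := WithLp.toLp 2 fun b => w b
  obtain ⟨y, ⟨x, rfl⟩, hx⟩ := hclosed.exists_infDist_eq_dist ⟨0, Submodule.zero_mem _⟩ u
  have hΦ : ∀ x, dist u (Φ x) ^ 2 = ∑ b ∈ S, (poly 5 (extendCoeff x) 0 0 b - w b) ^ 2 := by
    intro x
    rw [EuclideanSpace.dist_eq, Real.sq_sqrt (Finset.sum_nonneg fun _ _ => sq_nonneg _),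
      ← Finset.sum_coe_sort S]
    refine Finset.sum_congr rfl fun b _ => ?_
    rw [Real.dist_eq, sq_abs, ← neg_sq, neg_sub]
    rfl
  refine ⟨poly 5 (extendCoeff x) 0 0,
    isQuartic_iff.2 ⟨_, isQuarticCoeff_extendCoeff x, fun _ => rfl⟩, fun q hq => ?_⟩
  obtain ⟨c, hc, hqc⟩ := isQuartic_iff.1 hq
  simp only [hqc]
  rw [← extendCoeff_restrict hc, ← hΦ, ← hΦ, ← hx]
  exact pow_le_pow_left₀ Metric.infDist_nonneg (Metric.infDist_le_dist_of_mem (LinearMap.mem_range_self Φ _)) 2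

lemma fit_spec (Ω : Rect) (T : Finset Rect) (w : ℝ × ℝ → ℝ) (z : ℝ × ℝ) :
    IsQuartic (fit Ω T w z) ∧ ∀ q, IsQuartic q →
      ∑ b ∈ samplingPoints Ω T z, (fit Ω T w z b - w b) ^ 2
        ≤ ∑ b ∈ samplingPoints Ω T z, (q b - w b) ^ 2 :=
  Classical.epsilon_spec (exists_leastSquares (samplingPoints Ω T z) w)

/-- The least-squares fit is as close to any quartic polynomial as the data are, up to the number of
sampling points. -/
lemma abs_fit_sub_le {Ω : Rect} {T : Finset Rect} {w : ℝ × ℝ → ℝ} {z : ℝ × ℝ} {q : ℝ × ℝ → ℝ}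
    (hq : IsQuartic q) {E : ℝ} (hE : ∀ b ∈ samplingPoints Ω T z, |q b - w b| ≤ E) {b : ℝ × ℝ}
    (hb : b ∈ samplingPoints Ω T z) :
    |fit Ω T w z b - q b| ≤ ((samplingPoints Ω T z).card + 1) * E := by
  have hE0 : 0 ≤ E := (abs_nonneg _).trans (hE b hb)
  have hcard : (1 : ℝ) ≤ (samplingPoints Ω T z).card := by
    exact_mod_cast Finset.card_pos.2 ⟨b, hb⟩
  have h1 : (fit Ω T w z b - w b) ^ 2 ≤ ((samplingPoints Ω T z).card * E) ^ 2 :=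
    calc (fit Ω T w z b - w b) ^ 2 ≤ ∑ b ∈ samplingPoints Ω T z, (fit Ω T w z b - w b) ^ 2 :=
          Finset.single_le_sum (f := fun b => (fit Ω T w z b - w b) ^ 2)
            (fun _ _ => sq_nonneg _) hb
      _ ≤ ∑ b ∈ samplingPoints Ω T z, (q b - w b) ^ 2 := (fit_spec Ω T w z).2 q hq
      _ ≤ ∑ b ∈ samplingPoints Ω T z, E ^ 2 := Finset.sum_le_sum fun b hb =>
          sq_le_sq' (abs_le.1 (hE b hb)).1 (abs_le.1 (hE b hb)).2
      _ = (samplingPoints Ω T z).card * E ^ 2 := by simp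
      _ ≤ ((samplingPoints Ω T z).card * E) ^ 2 := by
          rw [mul_pow]
          exact mul_le_mul_of_nonneg_right (by nlinarith) (sq_nonneg E)
  have h2 := abs_le_of_sq_le_sq h1 (by positivity)
  have h3 := abs_le.1 (hE b hb)
  rw [abs_le] at *
  constructor <;> linarith [h2.1, h2.2, h3.1, h3.2]

/-! ### Finiteness of local configurations -/

lemma lineX_step_finite (T₀ : TensorMesh) :
    (range fun i => T₀.lineX (i + 1) - T₀.lineX i).Finite := by
  refine ((Finset.range (T₀.m + 1)).finite_toSet.image
    fun i => T₀.lineX (i + 1) - T₀.lineX i).subset ?_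
  rintro _ ⟨i, rfl⟩
  rcases Nat.lt_or_ge i (T₀.m + 1) with h | h
  · exact ⟨i, by simpa using h, rfl⟩
  · refine ⟨T₀.m, by simp, ?_⟩
    have h1 : min (i + 1) T₀.m = T₀.m := by omega
    have h2 : min i T₀.m = T₀.m := by omega
    have h3 : i + 1 - T₀.m = (i - T₀.m) + 1 := by omega
    simp [TensorMesh.lineX, h1, h2, h3]

lemma lineY_step_finite (T₀ : TensorMesh) :
    (range fun i => T₀.lineY (i + 1) - T₀.lineY i).Finite := by
  refine ((Finset.range (T₀.n + 1)).finite_toSet.image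
    fun i => T₀.lineY (i + 1) - T₀.lineY i).subset ?_
  rintro _ ⟨i, rfl⟩
  rcases Nat.lt_or_ge i (T₀.n + 1) with h | h
  · exact ⟨i, by simpa using h, rfl⟩
  · refine ⟨T₀.n, by simp, ?_⟩
    have h1 : min (i + 1) T₀.n = T₀.n := by omega
    have h2 : min i T₀.n = T₀.n := by omega
    have h3 : i + 1 - T₀.n = (i - T₀.n) + 1 := by omega
    simp [TensorMesh.lineY, h1, h2, h3]

lemma exists_step_bounds {ξ : ℕ → ℝ} (hξ : StrictMono ξ)
    (hfin : (range fun i => ξ (i + 1) - ξ i).Finite) :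
    ∃ δ W : ℝ, 0 < δ ∧ ∀ i, δ ≤ ξ (i + 1) - ξ i ∧ ξ (i + 1) - ξ i ≤ W := by
  have hne : (range fun i => ξ (i + 1) - ξ i).Nonempty := range_nonempty _
  obtain ⟨δ, ⟨i, hi⟩, hδ⟩ := hfin.isCompact.exists_isLeast hne
  obtain ⟨W, -, hW⟩ := hfin.isCompact.exists_isGreatest hne
  refine ⟨δ, W, ?_, fun i => ⟨hδ ⟨i, rfl⟩, hW ⟨i, rfl⟩⟩⟩
  rw [← hi]
  exact sub_pos.2 (hξ (Nat.lt_succ_self i))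

/-- There are only finitely many differences of nodes of level `l + e` in a range proportional to
`2 ^ (-l)`, up to scaling: each is a sum of a bounded number of steps, with finitely many values. -/
lemma exists_finite_node_sub {ξ : ℕ → ℝ} (hξ : StrictMono ξ)
    (hfin : (range fun i => ξ (i + 1) - ξ i).Finite) (e : ℕ) (R : ℝ) :
    ∃ F : Set ℝ, F.Finite ∧ ∀ l i j, |node ξ (l + e) j - node ξ (l + e) i| * 2 ^ l ≤ R →
      (node ξ (l + e) j - node ξ (l + e) i) * 2 ^ l ∈ F := by
  obtain ⟨δ, W, hδ, hstep⟩ := exists_step_bounds hξ hfin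
  let B : ℕ → Set ℝ := fun n => n.rec {0} fun _ A =>
    Set.image2 (fun a s => a + s / 2 ^ e) A (range fun i => ξ (i + 1) - ξ i)
  have hB : ∀ n, (B n).Finite := by
    intro n
    induction n with
    | zero => exact Set.finite_singleton 0
    | succ n ih => exact ih.image2 _ hfin
  have hmem : ∀ l i n, (node ξ (l + e) (i + n) - node ξ (l + e) i) * 2 ^ l ∈ B n ∧
      n * δ / 2 ^ e ≤ (node ξ (l + e) (i + n) - node ξ (l + e) i) * 2 ^ l := by
    intro l i n
    induction n with
    | zero =>
      have h0 : (node ξ (l + e) (i + 0) - node ξ (l + e) i) * 2 ^ l = 0 := by simp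
      rw [h0]
      exact ⟨rfl, by simp⟩
    | succ n ih =>
      have hs : (node ξ (l + e) (i + n + 1) - node ξ (l + e) (i + n)) * 2 ^ l
          = (ξ ((i + n) / 2 ^ (l + e) + 1) - ξ ((i + n) / 2 ^ (l + e))) / 2 ^ e := by
        rw [node_step]
        field_simp
        ring
      have e1 : (node ξ (l + e) (i + (n + 1)) - node ξ (l + e) i) * 2 ^ l
          = (node ξ (l + e) (i + n) - node ξ (l + e) i) * 2 ^ l
            + (ξ ((i + n) / 2 ^ (l + e) + 1) - ξ ((i + n) / 2 ^ (l + e))) / 2 ^ e := by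
        rw [← hs, ← add_assoc]
        ring
      rw [e1]
      refine ⟨⟨_, ih.1, _, ⟨(i + n) / 2 ^ (l + e), rfl⟩, rfl⟩, ?_⟩
      have h2 : δ / 2 ^ e ≤ (ξ ((i + n) / 2 ^ (l + e) + 1) - ξ ((i + n) / 2 ^ (l + e))) / 2 ^ e :=
        div_le_div_of_nonneg_right (hstep _).1 (by positivity)
      push_cast
      calc ((n : ℝ) + 1) * δ / 2 ^ e = n * δ / 2 ^ e + δ / 2 ^ e := by ring
        _ ≤ _ := add_le_add ih.2 h2
  obtain ⟨N, hN⟩ := exists_nat_ge (R * 2 ^ e / δ)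
  have hle : ∀ n : ℕ, n * δ / 2 ^ e ≤ R → n ≤ N := by
    intro n hn
    have : (n : ℝ) ≤ R * 2 ^ e / δ := by
      rw [le_div_iff₀ hδ]
      rwa [div_le_iff₀ (by positivity)] at hn
    exact_mod_cast this.trans hN
  refine ⟨(⋃ n ∈ Finset.range (N + 1), B n) ∪ -(⋃ n ∈ Finset.range (N + 1), B n), ?_, ?_⟩
  · have h := Set.Finite.biUnion (Finset.range (N + 1)).finite_toSet fun n _ => hB n
    exact h.union h.neg
  · intro l i j hij
    rcases Nat.le_total i j with h | h
    · obtain ⟨n, rfl⟩ := Nat.exists_eq_add_of_le h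
      obtain ⟨h1, h2⟩ := hmem l i n
      have h3 := (mul_le_mul_of_nonneg_right (le_abs_self _)
        (by positivity : (0 : ℝ) ≤ 2 ^ l)).trans hij
      exact Or.inl (mem_iUnion₂.2
        ⟨n, Finset.mem_range.2 (Nat.lt_succ_of_le (hle n (h2.trans h3))), h1⟩)
    · obtain ⟨n, rfl⟩ := Nat.exists_eq_add_of_le h
      obtain ⟨h1, h2⟩ := hmem l j n
      rw [abs_sub_comm] at hij
      have h3 := (mul_le_mul_of_nonneg_right (le_abs_self _)
        (by positivity : (0 : ℝ) ≤ 2 ^ l)).trans hij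
      refine Or.inr (mem_iUnion₂.2
        ⟨n, Finset.mem_range.2 (Nat.lt_succ_of_le (hle n (h2.trans h3))), ?_⟩)
      convert h1 using 1
      ring

/-- Scaled by `2 ^ l`, the offsets between grid points of level `l + e` at a distance of order
`2 ^ (-l)` form a finite set. -/
lemma exists_finite_offsets (T₀ : TensorMesh) (e : ℕ) (R : ℝ) :
    ∃ F : Finset (ℝ × ℝ), ∀ l v w, Grid T₀ (l + e) v → Grid T₀ (l + e) w →
      |w.1 - v.1| * 2 ^ l ≤ R → |w.2 - v.2| * 2 ^ l ≤ R →
      ((w.1 - v.1) * 2 ^ l, (w.2 - v.2) * 2 ^ l) ∈ F := by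
  obtain ⟨F₁, hF₁, h1⟩ := exists_finite_node_sub (lineX_strictMono T₀) (lineX_step_finite T₀) e R
  obtain ⟨F₂, hF₂, h2⟩ := exists_finite_node_sub (lineY_strictMono T₀) (lineY_step_finite T₀) e R
  refine ⟨(hF₁.prod hF₂).toFinset, ?_⟩
  rintro l _ _ ⟨i, j, rfl⟩ ⟨p, q, rfl⟩ hx hy
  rw [Set.Finite.mem_toFinset]
  exact ⟨h1 l i p hx, h2 l j q hy⟩

/-- The edges of a cell of level `l` have lengths comparable with `2 ^ (-l)`. -/
lemma exists_cell_size (T₀ : TensorMesh) : ∃ δ W : ℝ, 0 < δ ∧ δ ≤ W ∧ ∀ l K, IsCell T₀ l K →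
    (δ ≤ (K.x₁ - K.x₀) * 2 ^ l ∧ (K.x₁ - K.x₀) * 2 ^ l ≤ W) ∧
      (δ ≤ (K.y₁ - K.y₀) * 2 ^ l ∧ (K.y₁ - K.y₀) * 2 ^ l ≤ W) := by
  obtain ⟨δ₁, W₁, h1, hs1⟩ := exists_step_bounds (lineX_strictMono T₀) (lineX_step_finite T₀)
  obtain ⟨δ₂, W₂, h2, hs2⟩ := exists_step_bounds (lineY_strictMono T₀) (lineY_step_finite T₀)
  refine ⟨min δ₁ δ₂, max W₁ W₂, lt_min h1 h2, (min_le_left _ _).trans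
    (((hs1 0).1.trans (hs1 0).2).trans (le_max_left _ _)), ?_⟩
  rintro l K ⟨i, j, rfl⟩
  have e : ∀ (ξ : ℕ → ℝ) (i : ℕ), (node ξ l (i + 1) - node ξ l i) * 2 ^ l
      = ξ (i / 2 ^ l + 1) - ξ (i / 2 ^ l) := fun ξ i => by
    rw [node_step, div_mul_cancel₀ _ (by positivity)]
  simp only [TensorMesh.cell, e]
  exact ⟨⟨(min_le_left _ _).trans (hs1 _).1, (hs1 _).2.trans (le_max_left _ _)⟩,
    (min_le_right _ _).trans (hs2 _).1, (hs2 _).2.trans (le_max_right _ _)⟩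

/-! ### Poincaré and Sobolev inequalities on rectangles -/

/-- A family of continuous functions `g a b` behaving like the partial derivatives of order
`(a, b)` of a smooth function of two variables. -/
def IsJetFamily (g : ℕ → ℕ → ℝ × ℝ → ℝ) : Prop :=
  ∀ a b, Continuous (g a b) ∧ ∀ x y, HasDerivAt (fun t => g a b (t, y)) (g (a + 1) b (x, y)) x ∧
    HasDerivAt (fun t => g a b (x, t)) (g a (b + 1) (x, y)) y

lemma IsJetFamily.sub {g g' : ℕ → ℕ → ℝ × ℝ → ℝ} (h : IsJetFamily g) (h' : IsJetFamily g') :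
    IsJetFamily fun a b v => g a b v - g' a b v := fun a b =>
  ⟨(h a b).1.sub (h' a b).1, fun x y => ⟨(((h a b).2 x y).1).sub (((h' a b).2 x y).1),
    (((h a b).2 x y).2).sub (((h' a b).2 x y).2)⟩⟩

lemma isJetFamily_poly (N : ℕ) (c : ℕ → ℕ → ℝ) : IsJetFamily (poly N c) := fun a b =>
  ⟨continuous_poly N c a b, fun x y =>
    ⟨hasDerivAt_poly_fst N c a b x y, hasDerivAt_poly_snd N c a b x y⟩⟩

/-- The fundamental theorem of calculus with the Cauchy–Schwarz inequality. -/
lemma sq_sub_le_integral {h h' : ℝ → ℝ} (hh : ∀ t, HasDerivAt h (h' t) t) (hc : Continuous h')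
    {a b s t : ℝ} (hs : s ∈ Icc a b) (ht : t ∈ Icc a b) :
    (h t - h s) ^ 2 ≤ (b - a) * ∫ r in a..b, h' r ^ 2 := by
  wlog hst : s ≤ t generalizing s t
  · rw [← neg_sq, neg_sub]
    exact this ht hs (le_of_not_ge hst)
  have hab : a ≤ b := hs.1.trans hs.2
  have hi : ∀ u v : ℝ, IntervalIntegrable (fun r => h' r ^ 2) volume u v :=
    fun u v => (hc.pow 2).intervalIntegrable u v
  have hmono : ∫ r in s..t, h' r ^ 2 ≤ ∫ r in a..b, h' r ^ 2 :=
    intervalIntegral.integral_mono_interval hs.1 hst ht.2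
      (Filter.Eventually.of_forall fun r => sq_nonneg _) (hi a b)
  have hpos : 0 ≤ ∫ r in s..t, h' r ^ 2 :=
    intervalIntegral.integral_nonneg hst fun r _ => sq_nonneg _
  have hft : ∫ r in s..t, h' r = h t - h s :=
    intervalIntegral.integral_eq_sub_of_hasDerivAt (fun r _ => hh r) (hc.intervalIntegrable s t)
  have key : (h t - h s) ^ 2 ≤ (t - s) * ∫ r in s..t, h' r ^ 2 := by
    rcases hst.eq_or_lt with rfl | hlt
    · simp
    -- the variance of `h'` is nonnegative
    set m := (h t - h s) / (t - s) with hm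
    have hv : 0 ≤ ∫ r in s..t, (h' r - m) ^ 2 :=
      intervalIntegral.integral_nonneg hst fun r _ => sq_nonneg _
    have he : ∫ r in s..t, (h' r - m) ^ 2
        = (∫ r in s..t, h' r ^ 2) - 2 * m * (h t - h s) + (t - s) * m ^ 2 := by
      have : ∀ r, (h' r - m) ^ 2 = h' r ^ 2 - 2 * m * h' r + m ^ 2 := fun r => by ring
      simp only [this]
      rw [intervalIntegral.integral_add, intervalIntegral.integral_sub,
        intervalIntegral.integral_const_mul, hft, intervalIntegral.integral_const, smul_eq_mul]
      · exact hi s t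
      · exact (continuous_const.mul hc).intervalIntegrable s t
      · exact ((hc.pow 2).sub (continuous_const.mul hc)).intervalIntegrable s t
      · exact continuous_const.intervalIntegrable s t
    have hts : 0 < t - s := sub_pos.2 hlt
    have hm' : h t - h s = m * (t - s) := by rw [hm]; field_simp
    rw [he, hm'] at hv
    rw [hm']
    nlinarith
  calc (h t - h s) ^ 2 ≤ (t - s) * ∫ r in s..t, h' r ^ 2 := key
    _ ≤ (b - a) * ∫ r in a..b, h' r ^ 2 :=
      mul_le_mul (by linarith [hs.1, ht.2]) hmono hpos (by linarith)

/-- The one-dimensional Sobolev inequality. -/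
lemma sq_le_integral {h h' : ℝ → ℝ} (hh : ∀ t, HasDerivAt h (h' t) t) (hc : Continuous h')
    {a b t : ℝ} (hab : a < b) (ht : t ∈ Icc a b) :
    h t ^ 2 ≤ 2 / (b - a) * (∫ r in a..b, h r ^ 2) + 2 * (b - a) * ∫ r in a..b, h' r ^ 2 := by
  have hcont : Continuous h := continuous_iff_continuousAt.2 fun t => (hh t).continuousAt
  have h1 : ∫ _ in a..b, h t ^ 2
      ≤ ∫ s in a..b, (2 * h s ^ 2 + 2 * ((b - a) * ∫ r in a..b, h' r ^ 2)) := by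
    refine intervalIntegral.integral_mono_on hab.le (continuous_const.intervalIntegrable _ _)
      (Continuous.intervalIntegrable (by fun_prop) _ _) fun s hs => ?_
    have := sq_sub_le_integral hh hc hs ht
    nlinarith [sq_nonneg (h t - 2 * h s)]
  rw [intervalIntegral.integral_const, intervalIntegral.integral_add
    (Continuous.intervalIntegrable (by fun_prop) _ _)
    (continuous_const.intervalIntegrable _ _), intervalIntegral.integral_const_mul,
    intervalIntegral.integral_const, smul_eq_mul, smul_eq_mul] at h1
  have hba : 0 < b - a := sub_pos.2 hab
  rw [← mul_le_mul_iff_right₀ hba]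
  calc _ ≤ _ := h1
    _ = _ := by field_simp

lemma integrableOn_carrier {f : ℝ × ℝ → ℝ} (hf : Continuous f) (R : Rect) :
    IntegrableOn f R.carrier :=
  hf.continuousOn.integrableOn_compact (isCompact_carrier R)

lemma integral_carrier {f : ℝ × ℝ → ℝ} (hf : Continuous f) {R : Rect} (hx : R.x₀ ≤ R.x₁)
    (hy : R.y₀ ≤ R.y₁) :
    ∫ v in R.carrier, f v = ∫ x in R.x₀..R.x₁, ∫ y in R.y₀..R.y₁, f (x, y) := by
  have h := integrableOn_carrier hf R
  unfold Rect.carrier at h ⊢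
  rw [Measure.volume_eq_prod, setIntegral_prod _ h, integral_Icc_eq_integral_Ioc,
    intervalIntegral.integral_of_le hx]
  congr 1
  ext x
  rw [integral_Icc_eq_integral_Ioc, intervalIntegral.integral_of_le hy]

lemma integral_carrier_swap {f : ℝ × ℝ → ℝ} (hf : Continuous f) {R : Rect} (hx : R.x₀ ≤ R.x₁)
    (hy : R.y₀ ≤ R.y₁) :
    ∫ v in R.carrier, f v = ∫ y in R.y₀..R.y₁, ∫ x in R.x₀..R.x₁, f (x, y) := by
  rw [integral_carrier hf hx hy]
  refine intervalIntegral_intervalIntegral_swap ((integrableOn_carrier hf R).mono_set ?_)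
  rw [uIoc_of_le hx, uIoc_of_le hy]
  exact prod_mono Ioc_subset_Icc_self Ioc_subset_Icc_self

/-- The Poincaré inequality on a rectangle. -/
lemma integral_sq_le_of_mean_zero {g gx gy : ℝ × ℝ → ℝ} (hg : Continuous g) (hgx : Continuous gx)
    (hgy : Continuous gy) (h1 : ∀ x y, HasDerivAt (fun t => g (t, y)) (gx (x, y)) x)
    (h2 : ∀ x y, HasDerivAt (fun t => g (x, t)) (gy (x, y)) y) {R : Rect} (hx : R.x₀ < R.x₁)
    (hy : R.y₀ < R.y₁) (h0 : ∫ v in R.carrier, g v = 0) :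
    ∫ v in R.carrier, g v ^ 2 ≤ 2 * (R.x₁ - R.x₀) ^ 2 * (∫ v in R.carrier, gx v ^ 2)
      + 2 * (R.y₁ - R.y₀) ^ 2 * ∫ v in R.carrier, gy v ^ 2 := by
  have ha : 0 < R.x₁ - R.x₀ := sub_pos.2 hx
  have hb : 0 < R.y₁ - R.y₀ := sub_pos.2 hy
  set a := R.x₁ - R.x₀ with hadef
  set b := R.y₁ - R.y₀ with hbdef
  set A : ℝ → ℝ := fun y => 2 * (a * ∫ r in R.x₀..R.x₁, gx (r, y) ^ 2) with hA
  set B : ℝ → ℝ := fun x => 2 * (b * ∫ r in R.y₀..R.y₁, gy (x, r) ^ 2) with hB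
  have hAc : Continuous A := by
    refine continuous_const.mul (continuous_const.mul ?_)
    exact intervalIntegral.continuous_parametric_intervalIntegral_of_continuous'
      (f := fun y r => gx (r, y) ^ 2) (by unfold Function.uncurry; fun_prop) _ _
  have hBc : Continuous B := by
    refine continuous_const.mul (continuous_const.mul ?_)
    exact intervalIntegral.continuous_parametric_intervalIntegral_of_continuous'
      (f := fun x r => gy (x, r) ^ 2) (by unfold Function.uncurry; fun_prop) _ _
  have hconst : ∀ k : ℝ, ∫ _ in R.carrier, k = a * b * k := fun k => by
    rw [integral_carrier continuous_const hx.le hy.le]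
    simp only [intervalIntegral.integral_const, smul_eq_mul, ← hadef, ← hbdef]
    ring
  have hAI : ∫ v in R.carrier, A v.2 = 2 * a ^ 2 * ∫ v in R.carrier, gx v ^ 2 := by
    rw [integral_carrier_swap (f := fun v => gx v ^ 2) (hgx.pow 2) hx.le hy.le,
      integral_carrier_swap (f := fun v => A v.2) (hAc.comp continuous_snd) hx.le hy.le]
    simp only [intervalIntegral.integral_const, smul_eq_mul, ← hadef, hA,
      intervalIntegral.integral_const_mul]
    ring
  have hBI : ∫ v in R.carrier, B v.1 = 2 * b ^ 2 * ∫ v in R.carrier, gy v ^ 2 := by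
    rw [integral_carrier (f := fun v => gy v ^ 2) (hgy.pow 2) hx.le hy.le,
      integral_carrier (f := fun v => B v.1) (hBc.comp continuous_fst) hx.le hy.le]
    simp only [intervalIntegral.integral_const, smul_eq_mul, ← hbdef, hB,
      intervalIntegral.integral_const_mul]
    ring
  have hR : MeasurableSet R.carrier := (isClosed_carrier R).measurableSet
  have key : ∀ p ∈ R.carrier, a * b * g p ^ 2 ≤ a * b * A p.2 + ∫ v in R.carrier, B v.1 := by
    rintro ⟨x, y⟩ hp
    have e1 : ∫ v in R.carrier, (g (x, y) - g v) ^ 2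
        = a * b * g (x, y) ^ 2 + ∫ v in R.carrier, g v ^ 2 := by
      have : ∀ v, (g (x, y) - g v) ^ 2 = (g (x, y) ^ 2 - 2 * g (x, y) * g v) + g v ^ 2 :=
        fun v => by ring
      simp only [this]
      rw [integral_add (integrableOn_carrier (by fun_prop) R)
        (integrableOn_carrier (by fun_prop) R),
        integral_sub (integrableOn_carrier (by fun_prop) R)
        (integrableOn_carrier (by fun_prop) R), hconst, integral_const_mul, h0]
      ring
    have e2 : ∫ v in R.carrier, (g (x, y) - g v) ^ 2 ≤ ∫ v in R.carrier, (A y + B v.1) := by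
      refine setIntegral_mono_on (integrableOn_carrier (by fun_prop) R)
        (integrableOn_carrier (by fun_prop) R) hR ?_
      rintro ⟨s, t⟩ hv
      have i1 := sq_sub_le_integral (fun r => h1 r y) (by fun_prop) hv.1 hp.1
      have i2 := sq_sub_le_integral (fun r => h2 s r) (by fun_prop) hv.2 hp.2
      simp only [hA, hB]
      nlinarith [sq_nonneg ((g (x, y) - g (s, y)) - (g (s, y) - g (s, t)))]
    have e3 : ∫ v in R.carrier, (A y + B v.1) = a * b * A y + ∫ v in R.carrier, B v.1 := by
      rw [integral_add (integrableOn_carrier (by fun_prop) R)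
        (integrableOn_carrier (by fun_prop) R), hconst]
    have e4 : 0 ≤ ∫ v in R.carrier, g v ^ 2 := integral_nonneg fun v => sq_nonneg _
    linarith
  have hint : ∫ p in R.carrier, a * b * g p ^ 2
      ≤ ∫ p in R.carrier, (a * b * A p.2 + ∫ v in R.carrier, B v.1) :=
    setIntegral_mono_on (integrableOn_carrier (by fun_prop) R)
      (integrableOn_carrier (by fun_prop) R) hR key
  rw [integral_add (integrableOn_carrier (by fun_prop) R)
    (integrableOn_carrier (by fun_prop) R), hconst, integral_const_mul, integral_const_mul,
    ← mul_add, mul_le_mul_iff_right₀ (by positivity), hAI, hBI] at hint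
  exact hint

/-- The Sobolev inequality on a rectangle. -/
lemma sq_le_integral_carrier {g : ℕ → ℕ → ℝ × ℝ → ℝ} (hg : IsJetFamily g) (a b : ℕ) {R : Rect}
    (hx : R.x₀ < R.x₁) (hy : R.y₀ < R.y₁) {p : ℝ × ℝ} (hp : p ∈ R.carrier) :
    g a b p ^ 2 * ((R.x₁ - R.x₀) * (R.y₁ - R.y₀)) ≤ 4 * ((∫ v in R.carrier, g a b v ^ 2)
      + (R.x₁ - R.x₀) ^ 2 * (∫ v in R.carrier, g (a + 1) b v ^ 2)
      + (R.y₁ - R.y₀) ^ 2 * (∫ v in R.carrier, g a (b + 1) v ^ 2)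
      + (R.x₁ - R.x₀) ^ 2 * (R.y₁ - R.y₀) ^ 2 * ∫ v in R.carrier, g (a + 1) (b + 1) v ^ 2) := by
  obtain ⟨x, y⟩ := p
  have ha : 0 < R.x₁ - R.x₀ := sub_pos.2 hx
  have hb : 0 < R.y₁ - R.y₀ := sub_pos.2 hy
  have hc : ∀ i j, Continuous (g i j) := fun i j => (hg i j).1
  have hcy : ∀ i j, Continuous fun s => g i j (s, y) := fun i j => (hc i j).comp (by fun_prop)
  have hcI : ∀ i j, Continuous fun s => ∫ t in R.y₀..R.y₁, g i j (s, t) ^ 2 := fun i j =>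
    intervalIntegral.continuous_parametric_intervalIntegral_of_continuous'
      (f := fun x r => g i j (x, r) ^ 2)
      (by unfold Function.uncurry; exact ((hc i j).comp (by fun_prop)).pow 2) _ _
  have key : ∀ i, (∫ s in R.x₀..R.x₁, g i b (s, y) ^ 2) * (R.y₁ - R.y₀)
      ≤ 2 * (∫ v in R.carrier, g i b v ^ 2)
        + 2 * (R.y₁ - R.y₀) ^ 2 * ∫ v in R.carrier, g i (b + 1) v ^ 2 := by
    intro i
    have h1 : ∫ s in R.x₀..R.x₁, g i b (s, y) ^ 2 ≤ ∫ s in R.x₀..R.x₁,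
        (2 / (R.y₁ - R.y₀) * (∫ t in R.y₀..R.y₁, g i b (s, t) ^ 2)
          + 2 * (R.y₁ - R.y₀) * ∫ t in R.y₀..R.y₁, g i (b + 1) (s, t) ^ 2) := by
      refine intervalIntegral.integral_mono_on hx.le (((hcy i b).pow 2).intervalIntegrable _ _)
        (Continuous.intervalIntegrable (by fun_prop) _ _) fun s _ => ?_
      exact sq_le_integral (fun t => ((hg i b).2 s t).2) ((hc i (b + 1)).comp (by fun_prop)) hy hp.2
    rw [intervalIntegral.integral_add (Continuous.intervalIntegrable (by fun_prop) _ _)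
      (Continuous.intervalIntegrable (by fun_prop) _ _), intervalIntegral.integral_const_mul,
      intervalIntegral.integral_const_mul, ← integral_carrier (f := fun v => g i b v ^ 2) ((hc i b).pow 2) hx.le hy.le,
      
      ← integral_carrier (f := fun v => g i (b + 1) v ^ 2) ((hc i (b + 1)).pow 2) hx.le hy.le] at h1
    calc _ ≤ _ := mul_le_mul_of_nonneg_right h1 hb.le
      _ = _ := by field_simp
  have h2 := sq_le_integral (fun t => ((hg a b).2 t y).1) (hcy (a + 1) b) hx hp.1
  have h3 := mul_le_mul_of_nonneg_right h2 ha.le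
  have h4 : (2 / (R.x₁ - R.x₀) * (∫ r in R.x₀..R.x₁, g a b (r, y) ^ 2)
      + 2 * (R.x₁ - R.x₀) * ∫ r in R.x₀..R.x₁, g (a + 1) b (r, y) ^ 2) * (R.x₁ - R.x₀)
      = 2 * (∫ r in R.x₀..R.x₁, g a b (r, y) ^ 2)
      + 2 * (R.x₁ - R.x₀) ^ 2 * ∫ r in R.x₀..R.x₁, g (a + 1) b (r, y) ^ 2 := by field_simp
  rw [h4] at h3
  have h5 := mul_le_mul_of_nonneg_right h3 hb.le
  have h6 := mul_le_mul_of_nonneg_left (key (a + 1))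
    (by positivity : 0 ≤ 2 * (R.x₁ - R.x₀) ^ 2)
  linarith [key a]

/-- If the averages of all derivatives up to order four vanish, the Poincaré inequality bounds them
by the derivatives of order five. -/
lemma integral_sq_le_of_moments {g : ℕ → ℕ → ℝ × ℝ → ℝ} (hg : IsJetFamily g) {R : Rect}
    (hx : R.x₀ < R.x₁) (hy : R.y₀ < R.y₁) {H : ℝ} (hxH : R.x₁ - R.x₀ ≤ H) (hyH : R.y₁ - R.y₀ ≤ H)
    (h0 : ∀ a b, a + b ≤ 4 → ∫ v in R.carrier, g a b v = 0) {E : ℝ}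
    (hE : ∀ a b, a + b = 5 → ∫ v in R.carrier, g a b v ^ 2 ≤ E) (k : ℕ) :
    ∀ a b, a + b + k = 5 → ∫ v in R.carrier, g a b v ^ 2 ≤ (4 * H ^ 2) ^ k * E := by
  induction k with
  | zero => intro a b h; simpa using hE a b h
  | succ k ih =>
    intro a b h
    have h1 := integral_sq_le_of_mean_zero (hg a b).1 (hg (a + 1) b).1 (hg a (b + 1)).1
      (fun x y => ((hg a b).2 x y).1) (fun x y => ((hg a b).2 x y).2) hx hy (h0 a b (by omega))
    have h2 := ih (a + 1) b (by omega)
    have h3 := ih a (b + 1) (by omega)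
    have hp : ∀ i j, 0 ≤ ∫ v in R.carrier, g i j v ^ 2 :=
      fun i j => integral_nonneg fun v => sq_nonneg _
    have hxx : (R.x₁ - R.x₀) ^ 2 ≤ H ^ 2 := pow_le_pow_left₀ (sub_pos.2 hx).le hxH 2
    have hyy : (R.y₁ - R.y₀) ^ 2 ≤ H ^ 2 := pow_le_pow_left₀ (sub_pos.2 hy).le hyH 2
    have h4 := mul_le_mul hxx h2 (hp _ _) (sq_nonneg H)
    have h5 := mul_le_mul hyy h3 (hp _ _) (sq_nonneg H)
    rw [pow_succ]
    linarith

lemma sq_le_of_moments {g : ℕ → ℕ → ℝ × ℝ → ℝ} (hg : IsJetFamily g) {R : Rect}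
    (hx : R.x₀ < R.x₁) (hy : R.y₀ < R.y₁) {H : ℝ} (hxH : R.x₁ - R.x₀ ≤ H) (hyH : R.y₁ - R.y₀ ≤ H)
    (h0 : ∀ a b, a + b ≤ 4 → ∫ v in R.carrier, g a b v = 0) {E : ℝ}
    (hE : ∀ a b, a + b = 5 → ∫ v in R.carrier, g a b v ^ 2 ≤ E) {p : ℝ × ℝ} (hp : p ∈ R.carrier) :
    g 0 0 p ^ 2 * ((R.x₁ - R.x₀) * (R.y₁ - R.y₀)) ≤ 4 ^ 7 * H ^ 10 * E := by
  have h1 := sq_le_integral_carrier hg 0 0 hx hy hp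
  have hI := integral_sq_le_of_moments hg hx hy hxH hyH h0 hE
  have hpos : ∀ i j, 0 ≤ ∫ v in R.carrier, g i j v ^ 2 :=
    fun i j => integral_nonneg fun v => sq_nonneg _
  have hxx : (R.x₁ - R.x₀) ^ 2 ≤ H ^ 2 := pow_le_pow_left₀ (sub_pos.2 hx).le hxH 2
  have hyy : (R.y₁ - R.y₀) ^ 2 ≤ H ^ 2 := pow_le_pow_left₀ (sub_pos.2 hy).le hyH 2
  have h2 := mul_le_mul hxx (hI 4 1 0 rfl) (hpos _ _) (sq_nonneg H)
  have h3 := mul_le_mul hyy (hI 4 0 1 rfl) (hpos _ _) (sq_nonneg H)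
  have h4 := mul_le_mul (mul_le_mul hxx hyy (sq_nonneg _) (sq_nonneg H)) (hI 3 1 1 rfl) (hpos _ _)
    (by positivity)
  have h5 := hI 5 0 0 rfl
  have hE0 : 0 ≤ E := (hpos 5 0).trans (hE 5 0 rfl)
  have h6 : 0 ≤ H ^ 10 * E := by positivity
  simp only [zero_add] at h1
  nlinarith

/-- The map sending a quartic polynomial to the averages of its derivatives up to order four. -/
def momentMap (R : Rect) : (quarticIndex → ℝ) →ₗ[ℝ] (quarticIndex → ℝ) where
  toFun x p := ∫ v in R.carrier, poly 5 (extendCoeff x) p.1.1 p.1.2 v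
  map_add' x y := by
    ext p
    rw [Pi.add_apply, ← integral_add (integrableOn_carrier (continuous_poly _ _ _ _) R)
      (integrableOn_carrier (continuous_poly _ _ _ _) R)]
    congr 1
    ext v
    simp only [poly_extendCoeff, Pi.add_apply, ← Finset.sum_add_distrib]
    refine Finset.sum_congr rfl fun p _ => ?_
    ring
  map_smul' r x := by
    ext p
    rw [Pi.smul_apply, RingHom.id_apply, smul_eq_mul, ← integral_const_mul]
    congr 1
    ext v
    simp only [poly_extendCoeff, Pi.smul_apply, smul_eq_mul, Finset.mul_sum]
    refine Finset.sum_congr rfl fun p _ => ?_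
    ring

lemma mem_quarticIndex {a b : ℕ} (h : a + b ≤ 4) : (a, b) ∈ quarticIndex :=
  Finset.mem_filter.2 ⟨Finset.mem_product.2 ⟨Finset.mem_range.2 (by simp only; omega),
    Finset.mem_range.2 (by simp only; omega)⟩, h⟩

/-- The averages of the derivatives up to order four of a quartic can be prescribed. -/
lemma exists_quartic_moments {R : Rect} (hx : R.x₀ < R.x₁) (hy : R.y₀ < R.y₁) (m : ℕ → ℕ → ℝ) :
    ∃ c, IsQuarticCoeff c ∧ ∀ a b, a + b ≤ 4 → ∫ v in R.carrier, poly 5 c a b v = m a b := by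
  have hinj : Function.Injective (momentMap R) := by
    rw [← LinearMap.ker_eq_bot, LinearMap.ker_eq_bot']
    intro x hx0
    have hq := isQuarticCoeff_extendCoeff x
    have h1 : ∀ p ∈ R.carrier, poly 5 (extendCoeff x) 0 0 p = 0 := by
      intro p hp
      have := sq_le_of_moments (isJetFamily_poly 5 (extendCoeff x)) hx hy (le_max_left _ _)
        (le_max_right _ _) (fun a b hab => congrFun hx0 ⟨(a, b), mem_quarticIndex hab⟩) (E := 0)
        (fun a b hab => by simp [poly_eq_zero_of_lt hq (by omega : 4 < a + b)]) hp
      rw [mul_zero] at this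
      have hpos : 0 < (R.x₁ - R.x₀) * (R.y₁ - R.y₀) := mul_pos (sub_pos.2 hx) (sub_pos.2 hy)
      have h2 := nonpos_of_mul_nonpos_left this hpos
      exact pow_eq_zero_iff two_ne_zero |>.1 (le_antisymm h2 (sq_nonneg _))
    obtain ⟨C, -, hC⟩ := exists_growth_bound
    have h2 : ∀ v, poly 5 (extendCoeff x) 0 0 v = 0 := by
      intro v
      have ha := sub_pos.2 hx
      have hb := sub_pos.2 hy
      have := hC _ hq (R.x₀, R.y₀) _ _ 0
        (max 1 (max (|v.1 - R.x₀| / (R.x₁ - R.x₀)) (|v.2 - R.y₀| / (R.y₁ - R.y₀)))) ha hb le_rfl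
        (le_max_left _ _) (fun p hp1 hp2 => by
          rw [h1 p ⟨by simpa using hp1, by simpa using hp2⟩, abs_zero]) v
        ((div_le_iff₀ ha).1 ((le_max_left _ _).trans (le_max_right _ _)))
        ((div_le_iff₀ hb).1 ((le_max_right _ _).trans (le_max_right _ _)))
      rw [mul_zero] at this
      exact abs_nonpos_iff.1 this
    have h3 := poly_eq_zero_iff hq h2
    ext p
    have := congrFun (congrFun h3 p.1.1) p.1.2
    rwa [extendCoeff, dif_pos p.2] at this
  obtain ⟨x, hx'⟩ := LinearMap.injective_iff_surjective.1 hinj fun p => m p.1.1 p.1.2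
  exact ⟨_, isQuarticCoeff_extendCoeff x,
    fun a b hab => congrFun hx' ⟨(a, b), mem_quarticIndex hab⟩⟩

/-- The Bramble–Hilbert lemma for smooth functions on a rectangle. -/
lemma IsJetFamily.exists_quartic {g : ℕ → ℕ → ℝ × ℝ → ℝ} (hg : IsJetFamily g) {R : Rect}
    (hx : R.x₀ < R.x₁) (hy : R.y₀ < R.y₁) {H : ℝ} (hxH : R.x₁ - R.x₀ ≤ H) (hyH : R.y₁ - R.y₀ ≤ H)
    {E : ℝ} (hE : ∀ a b, a + b = 5 → ∫ v in R.carrier, g a b v ^ 2 ≤ E) :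
    ∃ c, IsQuarticCoeff c ∧
      (∀ p ∈ R.carrier, (g 0 0 p - poly 5 c 0 0 p) ^ 2 * ((R.x₁ - R.x₀) * (R.y₁ - R.y₀))
        ≤ 4 ^ 7 * H ^ 10 * E) ∧
      ∀ a b, a + b = 1 → ∫ v in R.carrier, (g a b v - poly 5 c a b v) ^ 2 ≤ (4 * H ^ 2) ^ 4 * E := by
  obtain ⟨c, hc, hm⟩ := exists_quartic_moments hx hy fun a b => ∫ v in R.carrier, g a b v
  have hg' := hg.sub (isJetFamily_poly 5 c)
  have h0 : ∀ a b, a + b ≤ 4 → ∫ v in R.carrier, (g a b v - poly 5 c a b v) = 0 := by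
    intro a b hab
    rw [integral_sub (integrableOn_carrier (hg a b).1 R)
      (integrableOn_carrier (continuous_poly _ _ _ _) R), hm a b hab, sub_self]
  have hE' : ∀ a b, a + b = 5 → ∫ v in R.carrier, (g a b v - poly 5 c a b v) ^ 2 ≤ E := by
    intro a b hab
    simpa [poly_eq_zero_of_lt hc (by omega : 4 < a + b)] using hE a b hab
  exact ⟨c, hc, fun p hp => sq_le_of_moments hg' hx hy hxH hyH h0 hE' hp,
    fun a b hab => integral_sq_le_of_moments hg' hx hy hxH hyH h0 hE' 4 a b (by omega)⟩

/-! ### Mollification of weak derivatives -/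

/-- The directional derivative as an operator on functions. -/
def dirDeriv (e : ℝ × ℝ) (f : ℝ × ℝ → ℝ) (v : ℝ × ℝ) : ℝ := fderiv ℝ f v e

lemma partialDeriv_eq (a b : ℕ) (f : ℝ × ℝ → ℝ) :
    partialDeriv a b f = (dirDeriv (1, 0))^[a] ((dirDeriv (0, 1))^[b] f) := rfl

lemma contDiff_dirDeriv {f : ℝ × ℝ → ℝ} (hf : ContDiff ℝ ∞ f) (e : ℝ × ℝ) :
    ContDiff ℝ ∞ (dirDeriv e f) :=
  (hf.fderiv_right (m := ∞) (by simp)).clm_apply contDiff_const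

lemma contDiff_dirDeriv_iterate {f : ℝ × ℝ → ℝ} (hf : ContDiff ℝ ∞ f) (e : ℝ × ℝ) (n : ℕ) :
    ContDiff ℝ ∞ ((dirDeriv e)^[n] f) := by
  induction n with
  | zero => exact hf
  | succ n ih =>
    rw [Function.iterate_succ_apply']
    exact contDiff_dirDeriv ih e

lemma contDiff_partialDeriv {f : ℝ × ℝ → ℝ} (hf : ContDiff ℝ ∞ f) (a b : ℕ) :
    ContDiff ℝ ∞ (partialDeriv a b f) :=
  contDiff_dirDeriv_iterate (contDiff_dirDeriv_iterate hf _ b) _ a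

lemma dirDeriv_comm {f : ℝ × ℝ → ℝ} (hf : ContDiff ℝ ∞ f) (e e' : ℝ × ℝ) :
    dirDeriv e (dirDeriv e' f) = dirDeriv e' (dirDeriv e f) := by
  ext v
  have hd : DifferentiableAt ℝ (fderiv ℝ f) v :=
    ((hf.fderiv_right (m := ∞) (by simp)).differentiable (by simp)) v
  have h : ∀ i j : ℝ × ℝ, dirDeriv i (dirDeriv j f) v = fderiv ℝ (fderiv ℝ f) v i j := by
    intro i j
    have := (hd.hasFDerivAt.clm_apply (hasFDerivAt_const j v)).fderiv
    change fderiv ℝ (fun y => fderiv ℝ f y j) v i = _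
    rw [this]
    simp
  rw [h, h]
  exact second_derivative_symmetric
    (fun y => (hf.differentiable (by simp) y).hasFDerivAt) hd.hasFDerivAt _ _

lemma dirDeriv_iterate_comm {f : ℝ × ℝ → ℝ} (hf : ContDiff ℝ ∞ f) (e e' : ℝ × ℝ) (n : ℕ) :
    dirDeriv e ((dirDeriv e')^[n] f) = (dirDeriv e')^[n] (dirDeriv e f) := by
  induction n with
  | zero => rfl
  | succ n ih =>
    rw [Function.iterate_succ_apply', Function.iterate_succ_apply', ← ih,
      dirDeriv_comm (contDiff_dirDeriv_iterate hf e' n)]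

lemma isJetFamily_partialDeriv {f : ℝ × ℝ → ℝ} (hf : ContDiff ℝ ∞ f) :
    IsJetFamily fun a b => partialDeriv a b f := by
  intro a b
  have hs := contDiff_partialDeriv hf a b
  refine ⟨hs.continuous, fun x y => ?_⟩
  have hd := (hs.differentiable (by simp) (x, y)).hasFDerivAt
  have e1 : partialDeriv (a + 1) b f = dirDeriv (1, 0) (partialDeriv a b f) := by
    rw [partialDeriv_eq, Function.iterate_succ_apply']
    rfl
  have e2 : partialDeriv a (b + 1) f = dirDeriv (0, 1) (partialDeriv a b f) := by
    rw [partialDeriv_eq, Function.iterate_succ_apply',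
      ← dirDeriv_iterate_comm (contDiff_dirDeriv_iterate hf _ b)]
    rfl
  beta_reduce
  rw [e1, e2]
  exact ⟨hd.comp_hasDerivAt x ((hasDerivAt_id x).prodMk (hasDerivAt_const x y)),
    hd.comp_hasDerivAt y ((hasDerivAt_const y x).prodMk (hasDerivAt_id y))⟩

lemma dirDeriv_reflect {k : ℝ × ℝ → ℝ} (hk : ContDiff ℝ ∞ k) (e x : ℝ × ℝ) (r : ℝ) :
    dirDeriv e (fun t => r * k (x - t)) = fun t => (-r) * dirDeriv e k (x - t) := by
  ext t
  have h1 : HasFDerivAt (fun t : ℝ × ℝ => x - t) (-ContinuousLinearMap.id ℝ (ℝ × ℝ)) t := by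
    simpa using (hasFDerivAt_id t).const_sub x
  have h2 := (((hk.differentiable (by simp) (x - t)).hasFDerivAt.comp t h1).const_mul r).fderiv
  change fderiv ℝ (fun t => r * k (x - t)) t e = _
  rw [show (fun t => r * k (x - t)) = fun y => r * (k ∘ fun t => x - t) y from rfl, h2]
  simp [dirDeriv]

lemma dirDeriv_iterate_reflect {k : ℝ × ℝ → ℝ} (hk : ContDiff ℝ ∞ k) (e x : ℝ × ℝ) (n : ℕ) (r : ℝ) :
    (dirDeriv e)^[n] (fun t => r * k (x - t))
      = fun t => ((-1) ^ n * r) * (dirDeriv e)^[n] k (x - t) := by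
  induction n with
  | zero => simp
  | succ n ih =>
    rw [Function.iterate_succ_apply', ih, dirDeriv_reflect (contDiff_dirDeriv_iterate hk e n),
      Function.iterate_succ_apply']
    ext t
    ring

lemma partialDeriv_reflect {k : ℝ × ℝ → ℝ} (hk : ContDiff ℝ ∞ k) (a b : ℕ) (x : ℝ × ℝ) :
    partialDeriv a b (fun t => k (x - t))
      = fun t => (-1) ^ (a + b) * partialDeriv a b k (x - t) := by
  have h1 : (fun t => k (x - t)) = fun t => 1 * k (x - t) := by simp
  rw [partialDeriv_eq, h1, dirDeriv_iterate_reflect hk,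
    dirDeriv_iterate_reflect (contDiff_dirDeriv_iterate hk _ b), partialDeriv_eq]
  ext t
  ring

/-- The convolution of two real functions on the plane. -/
def conv (g k : ℝ × ℝ → ℝ) : ℝ × ℝ → ℝ := convolution g k (ContinuousLinearMap.mul ℝ ℝ) volume

lemma conv_apply (g k : ℝ × ℝ → ℝ) (x : ℝ × ℝ) : conv g k x = ∫ t, g t * k (x - t) := rfl

lemma contDiff_conv {g k : ℝ × ℝ → ℝ} (hg : LocallyIntegrable g) (hk : ContDiff ℝ ∞ k)
    (hkc : HasCompactSupport k) : ContDiff ℝ ∞ (conv g k) :=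
  hkc.contDiff_convolution_right (n := ⊤) _ hg hk

lemma dirDeriv_conv {g k : ℝ × ℝ → ℝ} (hg : LocallyIntegrable g) (hk : ContDiff ℝ ∞ k)
    (hkc : HasCompactSupport k) (e : ℝ × ℝ) : dirDeriv e (conv g k) = conv g (dirDeriv e k) := by
  ext x
  have h := (hkc.hasFDerivAt_convolution_right (ContinuousLinearMap.mul ℝ ℝ) hg
    (hk.of_le (by simp)) x).fderiv
  change fderiv ℝ (convolution g k _ _) x e = _
  rw [h, convolution_precompR_apply _ hg (hkc.fderiv ℝ) (hk.continuous_fderiv (by simp))]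
  rfl

lemma hasCompactSupport_dirDeriv_iterate {k : ℝ × ℝ → ℝ} (hkc : HasCompactSupport k) (e : ℝ × ℝ)
    (n : ℕ) : HasCompactSupport ((dirDeriv e)^[n] k) := by
  induction n with
  | zero => exact hkc
  | succ n ih =>
    rw [Function.iterate_succ_apply']
    exact ih.fderiv_apply ℝ e

lemma dirDeriv_iterate_conv {g k : ℝ × ℝ → ℝ} (hg : LocallyIntegrable g) (hk : ContDiff ℝ ∞ k)
    (hkc : HasCompactSupport k) (e : ℝ × ℝ) (n : ℕ) :
    (dirDeriv e)^[n] (conv g k) = conv g ((dirDeriv e)^[n] k) := by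
  induction n with
  | zero => rfl
  | succ n ih =>
    rw [Function.iterate_succ_apply', Function.iterate_succ_apply', ih,
      dirDeriv_conv hg (contDiff_dirDeriv_iterate hk e n)
        (hasCompactSupport_dirDeriv_iterate hkc e n)]

lemma partialDeriv_conv {g k : ℝ × ℝ → ℝ} (hg : LocallyIntegrable g) (hk : ContDiff ℝ ∞ k)
    (hkc : HasCompactSupport k) (a b : ℕ) :
    partialDeriv a b (conv g k) = conv g (partialDeriv a b k) := by
  rw [partialDeriv_eq, dirDeriv_iterate_conv hg hk hkc,
    dirDeriv_iterate_conv hg (contDiff_dirDeriv_iterate hk _ b)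
      (hasCompactSupport_dirDeriv_iterate hkc _ b)]
  rfl

/-- Mollification commutes with weak derivatives, away from the boundary. -/
lemma IsWeakDeriv.partialDeriv_conv {U : Set (ℝ × ℝ)} (hU : IsOpen U) {a b : ℕ}
    {u w k : ℝ × ℝ → ℝ} (hw : IsWeakDeriv U a b u w) (hu : LocallyIntegrable (U.indicator u))
    (hk : ContDiff ℝ ∞ k) {r : ℝ} (hkr : tsupport k ⊆ Metric.closedBall 0 r) {x : ℝ × ℝ}
    (hx : Metric.closedBall x r ⊆ U) :
    partialDeriv a b (conv (U.indicator u) k) x = conv (U.indicator w) k x := by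
  have hkc : HasCompactSupport k :=
    (isCompact_closedBall (0 : ℝ × ℝ) r).of_isClosed_subset (isClosed_tsupport k) hkr
  rw [PHT.partialDeriv_conv hu hk hkc, conv_apply, conv_apply]
  have hsupp : tsupport (fun t => k (x - t)) ⊆ Metric.closedBall x r := by
    refine closure_minimal (fun t ht => ?_) Metric.isClosed_closedBall
    have := hkr (subset_tsupport k (Function.mem_support.2 ht))
    rw [mem_closedBall_zero_iff] at this
    rwa [Metric.mem_closedBall, dist_comm, dist_eq_norm]
  have h := hw.2 (fun t => k (x - t)) (hk.comp (contDiff_const.sub contDiff_id))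
    ((isCompact_closedBall x r).of_isClosed_subset (isClosed_tsupport _) hsupp) (hsupp.trans hx)
  rw [partialDeriv_reflect hk] at h
  have e : ∀ f g : ℝ × ℝ → ℝ, ∫ t, U.indicator f t * g t = ∫ t in U, f t * g t := by
    intro f g
    rw [← integral_indicator hU.measurableSet]
    congr 1
    ext t
    by_cases ht : t ∈ U <;> simp [ht]
  rw [e, e]
  have h2 : ∫ v in U, u v * ((-1) ^ (a + b) * partialDeriv a b k (x - v))
      = (-1) ^ (a + b) * ∫ v in U, u v * partialDeriv a b k (x - v) := by
    rw [← integral_const_mul]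
    congr 1
    ext v
    ring
  rw [h2] at h
  exact mul_left_cancel₀ (pow_ne_zero _ (by norm_num)) h

/-- Young's inequality for the convolution with a probability density. -/
lemma eLpNorm_conv_le {g k : ℝ × ℝ → ℝ} (hg : AEStronglyMeasurable g volume) (hk : Continuous k)
    (hkc : HasCompactSupport k) (hk0 : ∀ x, 0 ≤ k x) (hk1 : ∫ x, k x = 1) :
    eLpNorm (conv g k) 2 volume ≤ eLpNorm g 2 volume := by
  have hkI : ∫⁻ x, ENNReal.ofReal (k x) = 1 := by
    rw [← ofReal_integral_eq_lintegral_ofReal (hk.integrable_of_hasCompactSupport hkc)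
      (Filter.Eventually.of_forall hk0), hk1, ENNReal.ofReal_one]
  have hkm : Measurable fun p : (ℝ × ℝ) × (ℝ × ℝ) => ENNReal.ofReal (k (p.1 - p.2)) :=
    (hk.comp (continuous_fst.sub continuous_snd)).measurable.ennreal_ofReal
  have hpt : ∀ x, ‖conv g k x‖ₑ ^ 2 ≤ ∫⁻ t, ENNReal.ofReal (k (x - t)) * ‖g t‖ₑ ^ 2 := by
    intro x
    have hkx : Measurable fun t => ENNReal.ofReal (k (x - t)) :=
      (hk.comp (continuous_const.sub continuous_id)).measurable.ennreal_ofReal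
    have hkx1 : ∫⁻ t, ENNReal.ofReal (k (x - t)) = 1 := by
      rw [← hkI]
      exact lintegral_sub_left_eq_self (fun y => ENNReal.ofReal (k y)) x
    have h1 : ‖conv g k x‖ₑ ≤ ∫⁻ t, (ENNReal.ofReal (k (x - t)) * ‖g t‖ₑ ^ 2) ^ (1 / 2 : ℝ)
        * ENNReal.ofReal (k (x - t)) ^ (1 / 2 : ℝ) := by
      rw [conv_apply]
      refine (enorm_integral_le_lintegral_enorm _).trans (lintegral_mono fun t => le_of_eq ?_)
      rw [enorm_mul, Real.enorm_of_nonneg (hk0 _),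
        ENNReal.mul_rpow_of_nonneg _ _ (by norm_num), mul_right_comm,
        ← ENNReal.rpow_add_of_nonneg _ _ (by norm_num) (by norm_num), ← ENNReal.rpow_natCast,
        ← ENNReal.rpow_mul]
      norm_num
      rw [mul_comm]
    have h2 := ENNReal.lintegral_mul_norm_pow_le (μ := volume)
      (f := fun t => ENNReal.ofReal (k (x - t)) * ‖g t‖ₑ ^ 2)
      (g := fun t => ENNReal.ofReal (k (x - t)))
      (hkx.aemeasurable.mul (hg.enorm.pow_const 2)) hkx.aemeasurable
      (p := 1 / 2) (q := 1 / 2) (by norm_num) (by norm_num) (by norm_num)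
    rw [hkx1, ENNReal.one_rpow, mul_one] at h2
    calc ‖conv g k x‖ₑ ^ 2
        ≤ ((∫⁻ t, ENNReal.ofReal (k (x - t)) * ‖g t‖ₑ ^ 2) ^ (1 / 2 : ℝ)) ^ 2 :=
          pow_le_pow_left' (h1.trans h2) 2
      _ = _ := by
          rw [← ENNReal.rpow_natCast, ← ENNReal.rpow_mul]
          norm_num
  have hmain : ∫⁻ x, ‖conv g k x‖ₑ ^ 2 ≤ ∫⁻ t, ‖g t‖ₑ ^ 2 := by
    calc ∫⁻ x, ‖conv g k x‖ₑ ^ 2 ≤ ∫⁻ x, ∫⁻ t, ENNReal.ofReal (k (x - t)) * ‖g t‖ₑ ^ 2 :=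
          lintegral_mono hpt
      _ = ∫⁻ t, ∫⁻ x, ENNReal.ofReal (k (x - t)) * ‖g t‖ₑ ^ 2 := by
          refine lintegral_lintegral_swap ?_
          exact hkm.aemeasurable.mul ((hg.enorm.pow_const 2).comp_snd)
      _ = ∫⁻ t, ‖g t‖ₑ ^ 2 := by
          refine lintegral_congr fun t => ?_
          have hkt : Measurable fun x => ENNReal.ofReal (k (x - t)) :=
            (hk.comp (continuous_id.sub continuous_const)).measurable.ennreal_ofReal
          rw [lintegral_mul_const _ hkt,
            lintegral_sub_right_eq_self (fun y => ENNReal.ofReal (k y)) t, hkI, one_mul]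
  rw [eLpNorm_eq_lintegral_rpow_enorm_toReal (by norm_num) (by norm_num),
    eLpNorm_eq_lintegral_rpow_enorm_toReal (by norm_num) (by norm_num)]
  refine ENNReal.rpow_le_rpow ?_ (by positivity)
  simpa using hmain

lemma eLpNorm_le_iff_integral_sq_le {h : ℝ × ℝ → ℝ} (hh : Continuous h) (R : Rect) {B : ℝ}
    (hB : 0 ≤ B) : eLpNorm h 2 (volume.restrict R.carrier) ≤ ENNReal.ofReal B ↔
      ∫ v in R.carrier, h v ^ 2 ≤ B ^ 2 := by
  have hmem : MemLp h 2 (volume.restrict R.carrier) := by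
    rw [memLp_two_iff_integrable_sq hh.aestronglyMeasurable]
    exact integrableOn_carrier (hh.pow 2) R
  rw [hmem.eLpNorm_eq_integral_rpow_norm (by norm_num) (by norm_num),
    ENNReal.ofReal_le_ofReal_iff hB]
  have h0 : 0 ≤ ∫ v in R.carrier, h v ^ 2 := integral_nonneg fun v => sq_nonneg _
  have e : ((∫ v in R.carrier, ‖h v‖ ^ (2 : ℝ≥0∞).toReal) ^ ((2 : ℝ≥0∞).toReal)⁻¹)
      = √(∫ v in R.carrier, h v ^ 2) := by
    rw [Real.sqrt_eq_rpow]
    simp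
  rw [e, Real.sqrt_le_left hB]

/-! ### Approximation by quartic polynomials -/

lemma eLpNorm_weakDeriv_le {k : ℕ} (U : Set (ℝ × ℝ)) (u : ℝ × ℝ → ℝ) {a b : ℕ} (hab : a + b ≤ k) :
    eLpNorm (weakDeriv U a b u) 2 (volume.restrict U) ≤ sobolevNorm k U u := by
  have h1 : eLpNorm (weakDeriv U a b u) 2 (volume.restrict U) ^ 2
      ≤ ∑ a ∈ Finset.range (k + 1), ∑ b ∈ Finset.range (k + 1 - a),
        eLpNorm (weakDeriv U a b u) 2 (volume.restrict U) ^ 2 := by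
    refine le_trans ?_ (Finset.single_le_sum
      (f := fun a => ∑ b ∈ Finset.range (k + 1 - a),
        eLpNorm (weakDeriv U a b u) 2 (volume.restrict U) ^ 2)
      (fun _ _ => zero_le) (Finset.mem_range.2 (by omega : a < k + 1)))
    exact Finset.single_le_sum
      (f := fun b => eLpNorm (weakDeriv U a b u) 2 (volume.restrict U) ^ 2)
      (fun _ _ => zero_le) (Finset.mem_range.2 (by omega : b < k + 1 - a))
  calc eLpNorm (weakDeriv U a b u) 2 (volume.restrict U)
      = (eLpNorm (weakDeriv U a b u) 2 (volume.restrict U) ^ 2) ^ (1 / 2 : ℝ) := by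
        rw [← ENNReal.rpow_natCast, ← ENNReal.rpow_mul]
        norm_num
    _ ≤ _ := ENNReal.rpow_le_rpow h1 (by norm_num)

lemma MemSobolev.isWeakDeriv {k : ℕ} {U : Set (ℝ × ℝ)} {u : ℝ × ℝ → ℝ} (hu : MemSobolev k U u)
    {a b : ℕ} (hab : a + b ≤ k) : IsWeakDeriv U a b u (weakDeriv U a b u) :=
  Classical.epsilon_spec (hu.2 a b hab)

lemma MemSobolev.sobolevNorm_ne_top {k : ℕ} {U : Set (ℝ × ℝ)} {u : ℝ × ℝ → ℝ}
    (hu : MemSobolev k U u) : sobolevNorm k U u ≠ ⊤ := by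
  refine ENNReal.rpow_ne_top_of_nonneg (by norm_num) ?_
  refine ENNReal.sum_ne_top.2 fun a ha => ENNReal.sum_ne_top.2 fun b hb => ENNReal.pow_ne_top ?_
  simp only [Finset.mem_range] at ha hb
  exact (hu.isWeakDeriv (by omega : a + b ≤ k)).1.2.ne

open Filter Topology in
/-- A quartic polynomial that is bounded on a rectangle has bounded coefficients. -/
lemma exists_coeff_bound {R : Rect} (hx : R.x₀ < R.x₁) (hy : R.y₀ < R.y₁) :
    ∃ C : ℝ, 0 ≤ C ∧ ∀ c, IsQuarticCoeff c → ∀ E, 0 ≤ E →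
      (∀ p ∈ R.carrier, |poly 5 c 0 0 p| ≤ E) → ∀ i j, |c i j| ≤ C * E := by
  obtain ⟨C, hC0, hC⟩ := exists_growth_bound
  obtain ⟨D, hD0, hD⟩ := determinesQuartics_unitGrid.exists_bound
  have ha := sub_pos.2 hx
  have hb := sub_pos.2 hy
  let ρ : ℝ × ℝ → ℝ := fun v =>
    max 1 (max (|v.1 - R.x₀| / (R.x₁ - R.x₀)) (|v.2 - R.y₀| / (R.y₁ - R.y₀)))
  have hρ : ∀ v, 0 ≤ C * ρ v ^ 8 := fun v =>
    mul_nonneg hC0 (pow_nonneg (zero_le_one.trans (le_max_left _ _)) _)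
  refine ⟨D * ∑ v ∈ unitGrid, C * ρ v ^ 8,
    mul_nonneg hD0 (Finset.sum_nonneg fun v _ => hρ v), fun c hc E hE h i j => ?_⟩
  rw [mul_assoc]
  refine hD c hc _ (mul_nonneg (Finset.sum_nonneg fun v _ => hρ v) hE) (fun v hv => ?_) i j
  have h1 := hC c hc (R.x₀, R.y₀) _ _ E (ρ v) ha hb hE (le_max_left _ _)
    (fun p hp1 hp2 => h p ⟨by simpa using hp1, by simpa using hp2⟩) v
    ((div_le_iff₀ ha).1 ((le_max_left _ _).trans (le_max_right _ _)))
    ((div_le_iff₀ hb).1 ((le_max_right _ _).trans (le_max_right _ _)))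
  exact h1.trans (mul_le_mul_of_nonneg_right
    (Finset.single_le_sum (f := fun v => C * ρ v ^ 8) (fun v _ => hρ v) hv) hE)

lemma interior_carrier (R : Rect) : interior R.carrier = Ioo R.x₀ R.x₁ ×ˢ Ioo R.y₀ R.y₁ := by
  rw [Rect.carrier, interior_prod_eq, interior_Icc, interior_Icc]

lemma restrict_interior_carrier (R : Rect) :
    (volume : Measure (ℝ × ℝ)).restrict (interior R.carrier) = volume.restrict R.carrier :=
  Measure.restrict_congr_set (interior_ae_eq_of_null_frontier
    (((convex_Icc _ _).prod (convex_Icc _ _)).addHaar_frontier volume))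

lemma closure_interior_carrier {R : Rect} (hx : R.x₀ < R.x₁) (hy : R.y₀ < R.y₁) :
    closure (interior R.carrier) = R.carrier := by
  rw [interior_carrier, closure_prod_eq, closure_Ioo hx.ne, closure_Ioo hy.ne, Rect.carrier]

open Filter Topology in
lemma tendsto_poly {c : ℕ → ℕ → ℕ → ℝ} {c₀ : ℕ → ℕ → ℝ}
    (h : ∀ i j, Tendsto (fun n => c n i j) atTop (𝓝 (c₀ i j))) (N a b : ℕ) (v : ℝ × ℝ) :
    Tendsto (fun n => poly N (c n) a b v) atTop (𝓝 (poly N c₀ a b v)) :=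
  tendsto_finsetSum _ fun i _ => tendsto_finsetSum _ fun j _ =>
    ((h i j).mul_const _).mul_const _

open Filter Topology in
lemma exists_quartic_subseq {c : ℕ → ℕ → ℕ → ℝ} (hc : ∀ n, IsQuarticCoeff (c n)) {B : ℝ}
    (hB : ∀ n i j, |c n i j| ≤ B) : ∃ c₀, IsQuarticCoeff c₀ ∧ ∃ φ : ℕ → ℕ, StrictMono φ ∧
      ∀ i j, Tendsto (fun n => c (φ n) i j) atTop (𝓝 (c₀ i j)) := by
  obtain ⟨x, -, φ, hφ, hlim⟩ := tendsto_subseq_of_bounded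
    (Metric.isBounded_closedBall (x := (0 : quarticIndex → ℝ)) (r := max B 0))
    (x := fun n p => c n p.1.1 p.1.2) (fun n => by
      rw [mem_closedBall_zero_iff, pi_norm_le_iff_of_nonneg (le_max_right _ _)]
      exact fun p => (hB n _ _).trans (le_max_left _ _))
  refine ⟨extendCoeff x, isQuarticCoeff_extendCoeff x, φ, hφ, fun i j => ?_⟩
  by_cases hij : i + j ≤ 4
  · have h := (tendsto_pi_nhds.1 hlim) ⟨(i, j), mem_quarticIndex hij⟩
    rw [extendCoeff, dif_pos (mem_quarticIndex hij)]
    exact h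
  · have h0 : extendCoeff x i j = 0 := isQuarticCoeff_extendCoeff x i j (by omega)
    rw [h0]
    refine tendsto_const_nhds.congr fun n => ?_
    exact (hc (φ n) i j (by omega)).symm

/-- The rectangle `R`, shrunk by `t` on each side. -/
def Rect.shrink (R : Rect) (t : ℝ) : Rect := ⟨R.x₀ + t, R.x₁ - t, R.y₀ + t, R.y₁ - t⟩

lemma closedBall_subset_interior {R : Rect} {r : ℝ} (hr : 0 < r) {p : ℝ × ℝ}
    (hp : p ∈ (R.shrink (2 * r)).carrier) : Metric.closedBall p r ⊆ interior R.carrier := by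
  rw [interior_carrier]
  intro q hq
  rw [Metric.mem_closedBall, Prod.dist_eq, max_le_iff, Real.dist_eq, Real.dist_eq, abs_le,
    abs_le] at hq
  obtain ⟨⟨h1, h2⟩, h3, h4⟩ := hp
  simp only [Rect.shrink] at h1 h2 h3 h4
  exact ⟨⟨by linarith, by linarith⟩, ⟨by linarith, by linarith⟩⟩

lemma abs_conv_le {g k : ℝ × ℝ → ℝ} (hk0 : ∀ x, 0 ≤ k x) (hki : Integrable k)
    (hk1 : ∫ x, k x = 1) {r B : ℝ} (hkr : tsupport k ⊆ Metric.closedBall 0 r) {x : ℝ × ℝ}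
    (hB : ∀ t ∈ Metric.closedBall x r, |g t| ≤ B) : |conv g k x| ≤ B := by
  have h1 : ∫ t, B * k (x - t) = B := by
    rw [integral_const_mul, integral_sub_left_eq_self (fun y => k y) volume x, hk1, mul_one]
  rw [conv_apply, ← Real.norm_eq_abs]
  refine (norm_integral_le_of_norm_le ((hki.comp_sub_left x).const_mul B)
    (Filter.Eventually.of_forall fun t => ?_)).trans h1.le
  rw [Real.norm_eq_abs, abs_mul, abs_of_nonneg (hk0 _)]
  by_cases ht : k (x - t) = 0
  · simp [ht]
  refine mul_le_mul_of_nonneg_right (hB t ?_) (hk0 _)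
  have := hkr (subset_tsupport k (Function.mem_support.2 ht))
  rw [mem_closedBall_zero_iff] at this
  rwa [Metric.mem_closedBall, dist_comm, dist_eq_norm]

open Filter Topology in
/-- The Bramble–Hilbert lemma: on a rectangle, a function in `H⁵` is approximated by a quartic
polynomial to order five in the maximum norm (up to the scaling of the `L²` norm), and to order four
in the gradient. Mollifications satisfy this on slightly smaller rectangles; their quartic
approximations are bounded, and a subsequence converges. -/
lemma exists_quartic_approx {U : Set (ℝ × ℝ)} (hU : IsOpen U) {u : ℝ × ℝ → ℝ}
    (hu : MemSobolev 5 U u) {R : Rect} (hx : R.x₀ < R.x₁) (hy : R.y₀ < R.y₁)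
    (hRU : interior R.carrier ⊆ U) (huc : ContinuousOn u R.carrier) {H : ℝ}
    (hxH : R.x₁ - R.x₀ ≤ H) (hyH : R.y₁ - R.y₀ ≤ H) :
    ∃ c, IsQuarticCoeff c ∧
      (∀ p ∈ R.carrier, (u p - poly 5 c 0 0 p) ^ 2 * ((R.x₁ - R.x₀) * (R.y₁ - R.y₀))
        ≤ 4 ^ 7 * H ^ 10 * (sobolevNorm 5 U u).toReal ^ 2) ∧
      ∀ a b, a + b = 1 → eLpNorm (fun v => weakDeriv U a b u v - poly 5 c a b v) 2
        (volume.restrict R.carrier)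
          ≤ ENNReal.ofReal ((4 * H ^ 2) ^ 2 * (sobolevNorm 5 U u).toReal) := by
  have hUm := hU.measurableSet
  have hRm : MeasurableSet R.carrier := (isClosed_carrier R).measurableSet
  set S := (sobolevNorm 5 U u).toReal with hS
  have hS0 : 0 ≤ S := ENNReal.toReal_nonneg
  have hSe : sobolevNorm 5 U u = ENNReal.ofReal S :=
    (ENNReal.ofReal_toReal hu.sobolevNorm_ne_top).symm
  have hH : 0 < H := (sub_pos.2 hx).trans_le hxH
  have hul : LocallyIntegrable (U.indicator u) :=
    ((memLp_indicator_iff_restrict hUm).2 hu.1).locallyIntegrable (by norm_num)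
  have hwl : ∀ a b, a + b ≤ 5 → MemLp (U.indicator (weakDeriv U a b u)) 2 volume :=
    fun a b hab => (memLp_indicator_iff_restrict hUm).2 (hu.isWeakDeriv hab).1
  obtain ⟨δ, hδ, hδx, hδy⟩ : ∃ δ : ℝ, 0 < δ ∧ 8 * δ ≤ R.x₁ - R.x₀ ∧ 8 * δ ≤ R.y₁ - R.y₀ := by
    refine ⟨min (R.x₁ - R.x₀) (R.y₁ - R.y₀) / 8,
      div_pos (lt_min (sub_pos.2 hx) (sub_pos.2 hy)) (by norm_num), ?_, ?_⟩
    · linarith [min_le_left (R.x₁ - R.x₀) (R.y₁ - R.y₀)]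
    · linarith [min_le_right (R.x₁ - R.x₀) (R.y₁ - R.y₀)]
  -- a sequence of mollifiers
  let r : ℕ → ℝ := fun n => δ * (1 / ((n : ℝ) + 1))
  have hr : ∀ n, 0 < r n := fun n => by positivity
  have hrδ : ∀ n, r n ≤ δ := fun n => by
    refine mul_le_of_le_one_right hδ.le ?_
    rw [div_le_one (by positivity)]
    linarith [(Nat.cast_nonneg n : (0 : ℝ) ≤ n)]
  have hr0 : Tendsto r atTop (𝓝 0) := by
    have h := (tendsto_one_div_add_atTop_nhds_zero_nat (𝕜 := ℝ)).const_mul δ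
    rwa [mul_zero] at h
  let β : ℕ → ContDiffBump (0 : ℝ × ℝ) := fun n => ⟨r n / 2, r n, half_pos (hr n), half_lt_self (hr n)⟩
  let k : ℕ → ℝ × ℝ → ℝ := fun n => (β n).normed volume
  have hk : ∀ n, ContDiff ℝ ∞ (k n) := fun n => (β n).contDiff_normed
  have hkc : ∀ n, HasCompactSupport (k n) := fun n => (β n).hasCompactSupport_normed
  have hk0 : ∀ n x, 0 ≤ k n x := fun n x => (β n).nonneg_normed x
  have hk1 : ∀ n, ∫ x, k n x = 1 := fun n => (β n).integral_normed
  have hkr : ∀ n, tsupport (k n) ⊆ Metric.closedBall 0 (r n) := fun n =>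
    (β n).tsupport_normed_eq.le
  have hconv : ∀ (g : ℝ × ℝ → ℝ) n x,
      conv g (k n) x = convolution (k n) g (ContinuousLinearMap.lsmul ℝ ℝ) volume x := by
    intro g n x
    rw [convolution_lsmul_swap, conv_apply]
    congr 1
    ext t
    rw [smul_eq_mul, mul_comm]
  let Q : ℕ → Rect := fun n => R.shrink (2 * r n)
  have hQx : ∀ n, (Q n).x₁ - (Q n).x₀ = R.x₁ - R.x₀ - 4 * r n := fun n => by
    simp only [Q, Rect.shrink]; ring
  have hQy : ∀ n, (Q n).y₁ - (Q n).y₀ = R.y₁ - R.y₀ - 4 * r n := fun n => by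
    simp only [Q, Rect.shrink]; ring
  have hQx0 : ∀ n, (Q n).x₀ < (Q n).x₁ := fun n => by linarith [hQx n, hrδ n]
  have hQy0 : ∀ n, (Q n).y₀ < (Q n).y₁ := fun n => by linarith [hQy n, hrδ n]
  have hball : ∀ n, ∀ p ∈ (Q n).carrier, Metric.closedBall p (r n) ⊆ interior R.carrier :=
    fun n p hp => closedBall_subset_interior (hr n) hp
  let f : ℕ → ℝ × ℝ → ℝ := fun n => conv (U.indicator u) (k n)
  have hf : ∀ n, ContDiff ℝ ∞ (f n) := fun n => contDiff_conv hul (hk n) (hkc n)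
  have hfw : ∀ n a b, a + b ≤ 5 → ∀ p ∈ (Q n).carrier,
      partialDeriv a b (f n) p = conv (U.indicator (weakDeriv U a b u)) (k n) p :=
    fun n a b hab p hp => (hu.isWeakDeriv hab).partialDeriv_conv hU hul (hk n) (hkr n)
      ((hball n p hp).trans hRU)
  have hE : ∀ n a b, a + b = 5 →
      ∫ v in (Q n).carrier, partialDeriv a b (f n) v ^ 2 ≤ S ^ 2 := by
    intro n a b hab
    rw [← eLpNorm_le_iff_integral_sq_le (contDiff_partialDeriv (hf n) a b).continuous _ hS0, ← hSe]
    calc eLpNorm (partialDeriv a b (f n)) 2 (volume.restrict (Q n).carrier)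
        = eLpNorm (conv (U.indicator (weakDeriv U a b u)) (k n)) 2
            (volume.restrict (Q n).carrier) :=
          eLpNorm_congr_ae ((ae_restrict_iff' (isClosed_carrier _).measurableSet).2
            (Eventually.of_forall (hfw n a b hab.le)))
      _ ≤ eLpNorm (conv (U.indicator (weakDeriv U a b u)) (k n)) 2 volume :=
          eLpNorm_mono_measure _ Measure.restrict_le_self
      _ ≤ eLpNorm (U.indicator (weakDeriv U a b u)) 2 volume :=
          eLpNorm_conv_le (hwl a b hab.le).1 (hk n).continuous (hkc n) (hk0 n) (hk1 n)
      _ = eLpNorm (weakDeriv U a b u) 2 (volume.restrict U) :=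
          eLpNorm_indicator_eq_eLpNorm_restrict hUm
      _ ≤ _ := eLpNorm_weakDeriv_le U u hab.le
  choose c hc hcsup hcgrad using fun n => (isJetFamily_partialDeriv (hf n)).exists_quartic (hQx0 n)
    (hQy0 n) (by linarith [hQx n, hr n] : _ ≤ H) (by linarith [hQy n, hr n] : _ ≤ H) (hE n)
  -- the quartics are bounded on a common rectangle
  obtain ⟨B, hB⟩ : ∃ B, ∀ p ∈ R.carrier, |u p| ≤ B := by
    obtain ⟨B, hB⟩ := (isCompact_carrier R).exists_bound_of_continuousOn huc
    exact ⟨B, hB⟩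
  have hint : interior R.carrier ⊆ R.carrier := interior_subset
  have hfB : ∀ n, ∀ p ∈ (Q n).carrier, |f n p| ≤ B := by
    intro n p hp
    refine abs_conv_le (hk0 n) ((hk n).continuous.integrable_of_hasCompactSupport (hkc n)) (hk1 n)
      (hkr n) fun t ht => ?_
    have htR := hball n p hp ht
    rw [indicator_of_mem (hRU htR)]
    exact hB t (hint htR)
  have hQ0 : ∀ n, (Q 0).carrier ⊆ (Q n).carrier := by
    intro n p hp
    have h0 : r 0 = δ := by simp [r]
    have := hrδ n
    obtain ⟨⟨h1, h2⟩, h3, h4⟩ := hp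
    simp only [Q, Rect.shrink, h0] at h1 h2 h3 h4
    exact ⟨⟨by simp only [Q, Rect.shrink]; linarith, by simp only [Q, Rect.shrink]; linarith⟩,
      ⟨by simp only [Q, Rect.shrink]; linarith, by simp only [Q, Rect.shrink]; linarith⟩⟩
  have hpos : 0 < δ ^ 2 := by positivity
  have hqB : ∀ n, ∀ p ∈ (Q 0).carrier,
      |poly 5 (c n) 0 0 p| ≤ max B 0 + √(4 ^ 7 * H ^ 10 * S ^ 2 / δ ^ 2) := by
    intro n p hp
    have h1 := hcsup n p (hQ0 n hp)
    have h2 : (f n p - poly 5 (c n) 0 0 p) ^ 2 ≤ 4 ^ 7 * H ^ 10 * S ^ 2 / δ ^ 2 := by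
      rw [le_div_iff₀ hpos]
      refine le_trans (mul_le_mul_of_nonneg_left ?_ (sq_nonneg _)) h1
      rw [sq]
      exact mul_le_mul (by linarith [hQx n, hrδ n]) (by linarith [hQy n, hrδ n]) hδ.le
        (by linarith [hQx0 n])
    have h3 := Real.abs_le_sqrt h2
    have h4 := (hfB n p (hQ0 n hp)).trans (le_max_left B 0)
    have h5 : poly 5 (c n) 0 0 p = f n p - (f n p - poly 5 (c n) 0 0 p) := by ring
    rw [h5]
    exact (abs_sub _ _).trans (add_le_add h4 h3)
  obtain ⟨C, hC0, hC⟩ := exists_coeff_bound (hQx0 0) (hQy0 0)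
  obtain ⟨c₀, hc₀, φ, hφ, hlim⟩ := exists_quartic_subseq hc fun n =>
    hC (c n) (hc n) _ (by positivity) (hqB n)
  have hφt := hφ.tendsto_atTop
  have hev : ∀ p ∈ interior R.carrier, ∀ᶠ n in atTop, p ∈ (Q (φ n)).carrier := by
    intro p hp
    rw [interior_carrier] at hp
    obtain ⟨⟨h1, h2⟩, h3, h4⟩ := hp
    have hrφ : Tendsto (fun n => 2 * r (φ n)) atTop (𝓝 0) := by
      simpa using (hr0.comp hφt).const_mul 2
    filter_upwards [hrφ.eventually_lt_const (sub_pos.2 h1), hrφ.eventually_lt_const (sub_pos.2 h2),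
      hrφ.eventually_lt_const (sub_pos.2 h3), hrφ.eventually_lt_const (sub_pos.2 h4)]
      with n e1 e2 e3 e4
    exact ⟨⟨by simp only [Q, Rect.shrink]; linarith, by simp only [Q, Rect.shrink]; linarith⟩,
      ⟨by simp only [Q, Rect.shrink]; linarith, by simp only [Q, Rect.shrink]; linarith⟩⟩
  refine ⟨c₀, hc₀, ?_, ?_⟩
  · have hclosed : ∀ p ∈ interior R.carrier, (u p - poly 5 c₀ 0 0 p) ^ 2
        * ((R.x₁ - R.x₀) * (R.y₁ - R.y₀)) ≤ 4 ^ 7 * H ^ 10 * S ^ 2 := by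
      intro p hp
      have hnhds : R.carrier ∈ 𝓝 p := mem_interior_iff_mem_nhds.1 hp
      have hcont : ContinuousAt (U.indicator u) p := by
        refine (huc.continuousAt hnhds).congr ?_
        filter_upwards [isOpen_interior.mem_nhds hp] with q hq
        rw [indicator_of_mem (hRU hq)]
      have h1 : Tendsto (fun n => f n p) atTop (𝓝 (u p)) := by
        have h := ContDiffBump.convolution_tendsto_right (μ := volume) (φ := β) (l := atTop)
          (g := fun _ => U.indicator u) (k := fun _ => p) (x₀ := p) (z₀ := u p) hr0
          (Eventually.of_forall fun _ => hul.aestronglyMeasurable) (by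
            have h := hcont.tendsto
            rw [indicator_of_mem (hRU hp)] at h
            exact h.comp tendsto_snd) tendsto_const_nhds
        exact h.congr fun n => (hconv _ n p).symm
      have hside : ∀ s : ℝ, Tendsto (fun n => s - 4 * r (φ n)) atTop (𝓝 s) := fun s => by
        simpa using tendsto_const_nhds.sub ((hr0.comp hφt).const_mul 4)
      have h2 := (((h1.comp hφt).sub (tendsto_poly hlim 5 0 0 p)).pow 2).mul
        ((hside (R.x₁ - R.x₀)).mul (hside (R.y₁ - R.y₀)))
      refine le_of_tendsto h2 ?_
      filter_upwards [hev p hp] with n hn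
      have := hcsup (φ n) p hn
      rwa [hQx, hQy] at this
    intro p hp
    have hcl : p ∈ closure (interior R.carrier) := by
      rwa [closure_interior_carrier hx hy]
    have hcontF : ContinuousOn (fun p => (u p - poly 5 c₀ 0 0 p) ^ 2
        * ((R.x₁ - R.x₀) * (R.y₁ - R.y₀))) R.carrier :=
      ((huc.sub (continuous_poly _ _ _ _).continuousOn).pow 2).mul continuousOn_const
    have hmem := (hcontF p hp).mono hint
    have : NeBot (𝓝[interior R.carrier] p) := mem_closure_iff_nhdsWithin_neBot.1 hcl
    exact le_of_tendsto hmem (eventually_nhdsWithin_of_forall hclosed)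
  · intro a b hab
    have hwae := ContDiffBump.ae_convolution_tendsto_right_of_locallyIntegrable (μ := volume)
      (φ := β) (l := atTop) (K := 2) hr0 (Eventually.of_forall fun n => by
        change r n ≤ 2 * (r n / 2)
        linarith) ((hwl a b (by omega)).locallyIntegrable (by norm_num))
    let h : ℕ → ℝ × ℝ → ℝ := fun n => (Q (φ n)).carrier.indicator fun v =>
      partialDeriv a b (f (φ n)) v - poly 5 (c (φ n)) a b v
    have hcontn : ∀ n, Continuous fun v =>
        partialDeriv a b (f (φ n)) v - poly 5 (c (φ n)) a b v := fun n =>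
      (contDiff_partialDeriv (hf _) a b).continuous.sub (continuous_poly _ _ _ _)
    have hm : ∀ n, MeasurableSet (Q (φ n)).carrier := fun n => (isClosed_carrier _).measurableSet
    rw [← restrict_interior_carrier]
    have hfat := Lp.eLpNorm_lim_le_liminf_eLpNorm (p := 2) (f := h)
      (μ := volume.restrict (interior R.carrier))
      (fun n => ((hcontn n).measurable.indicator (hm n)).aestronglyMeasurable)
      (fun v => weakDeriv U a b u v - poly 5 c₀ a b v) (by
        filter_upwards [ae_restrict_of_ae hwae, ae_restrict_mem isOpen_interior.measurableSet]
          with p hp hpR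
        rw [indicator_of_mem (hRU hpR)] at hp
        refine ((hp.comp hφt).sub (tendsto_poly hlim 5 a b p)).congr' ?_
        filter_upwards [hev p hpR] with n hn
        simp only [h, indicator_of_mem hn, Function.comp]
        rw [hfw _ a b (by omega) p hn, hconv])
    refine hfat.trans ?_
    have hbound : ∀ n, eLpNorm (h n) 2 (volume.restrict (interior R.carrier))
        ≤ ENNReal.ofReal ((4 * H ^ 2) ^ 2 * S) := by
      intro n
      refine (eLpNorm_mono_measure _ Measure.restrict_le_self).trans ?_
      rw [eLpNorm_indicator_eq_eLpNorm_restrict (hm n),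
        eLpNorm_le_iff_integral_sq_le (hcontn n) _ (by positivity)]
      refine (hcgrad (φ n) a b hab).trans (le_of_eq ?_)
      ring
    exact (liminf_le_liminf (Eventually.of_forall hbound)).trans (liminf_const _).le

section

/-! ### Scales in a patch -/

variable {T₀ : TensorMesh} {T : Finset Rect}

/-- The elements in the patch `P` have levels within `e` of `l`, and the diameter of `P` is at most
`ρ * 2⁻ˡ`. -/
structure IsUniformPatch (T₀ : TensorMesh) (T : Finset Rect) (P : Set (ℝ × ℝ)) (l e : ℕ) (ρ : ℝ) :
    Prop where
  level : ∀ L ∈ T, L.carrier ⊆ P → ∀ k, IsCell T₀ k L → k ≤ l + e ∧ l ≤ k + e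
  dist_fst : ∀ v ∈ P, ∀ v' ∈ P, |v.1 - v'.1| ≤ ρ * (2 ^ l)⁻¹
  dist_snd : ∀ v ∈ P, ∀ v' ∈ P, |v.2 - v'.2| ≤ ρ * (2 ^ l)⁻¹

lemma sides_le_diam {K : Rect} (hx : K.x₀ ≤ K.x₁) (hy : K.y₀ ≤ K.y₁) :
    K.x₁ - K.x₀ ≤ Metric.diam K.carrier ∧ K.y₁ - K.y₀ ≤ Metric.diam K.carrier := by
  have hb := (isCompact_carrier K).isBounded
  have h := Metric.dist_le_diam_of_mem hb (x := (K.x₁, K.y₁)) (y := (K.x₀, K.y₀))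
    ⟨⟨hx, le_rfl⟩, hy, le_rfl⟩ ⟨⟨le_rfl, hx⟩, le_rfl, hy⟩
  rw [Prod.dist_eq, max_le_iff, Real.dist_eq, Real.dist_eq] at h
  exact ⟨(le_abs_self _).trans h.1, (le_abs_self _).trans h.2⟩

lemma diam_carrier_le {K : Rect} {d : ℝ} (hd : 0 ≤ d) (hx : K.x₁ - K.x₀ ≤ d) (hy : K.y₁ - K.y₀ ≤ d) :
    Metric.diam K.carrier ≤ d := by
  refine Metric.diam_le_of_forall_dist_le hd fun p hp q hq => ?_
  obtain ⟨⟨h1, h2⟩, h3, h4⟩ := hp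
  obtain ⟨⟨k1, k2⟩, k3, k4⟩ := hq
  rw [Prod.dist_eq, max_le_iff, Real.dist_eq, Real.dist_eq, abs_le, abs_le]
  exact ⟨⟨by linarith, by linarith⟩, by linarith, by linarith⟩

lemma IsDyadic.elementPatch_subset_domain (hT : IsDyadic T₀ T) (K : Rect) :
    elementPatch T₀.domain T K ⊆ T₀.domain.carrier :=
  iUnion₂_subset fun _ hz => hT.layer_subset_domain (hT.basisVertices_subset hz.1) _

/-- The condition on the diameters of the elements of a patch bounds the range of their levels. -/
lemma IsDyadic.isUniformPatch (hT : IsDyadic T₀ T)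
    (hdet : DeterminesQuartics (basisVertices T₀.domain T)) {δ W M : ℝ} (hδ : 0 < δ) (hM : 0 ≤ M)
    (hsize : ∀ l K, IsCell T₀ l K →
      (δ ≤ (K.x₁ - K.x₀) * 2 ^ l ∧ (K.x₁ - K.x₀) * 2 ^ l ≤ W) ∧
        (δ ≤ (K.y₁ - K.y₀) * 2 ^ l ∧ (K.y₁ - K.y₀) * 2 ^ l ≤ W))
    {e : ℕ} (he : M * W ≤ δ * 2 ^ e) {K : Rect} (hK : K ∈ T) {l : ℕ} (hl : IsCell T₀ l K)
    (hdiam : ∀ K' ∈ T, K'.carrier ⊆ elementPatch T₀.domain T K →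
      Metric.diam (elementPatch T₀.domain T K) ≤ M * Metric.diam K'.carrier) :
    IsUniformPatch T₀ T (elementPatch T₀.domain T K) l e (M * W) := by
  have hPb : Bornology.IsBounded (elementPatch T₀.domain T K) :=
    (isCompact_carrier T₀.domain).isBounded.subset (hT.elementPatch_subset_domain K)
  have hKP := hT.self_subset_elementPatch hdet hK
  have hupper : ∀ k L, IsCell T₀ k L → Metric.diam L.carrier ≤ W * (2 ^ k)⁻¹ := by
    intro k L hL
    have h := hsize k L hL
    have h1 : L.x₁ - L.x₀ ≤ W * (2 ^ k)⁻¹ := (le_mul_inv_iff₀ (by positivity)).2 h.1.2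
    exact diam_carrier_le ((sub_pos.2 hL.lt.1).le.trans h1) h1
      ((le_mul_inv_iff₀ (by positivity)).2 h.2.2)
  have hlower : ∀ k L, IsCell T₀ k L → δ * (2 ^ k)⁻¹ ≤ Metric.diam L.carrier := by
    intro k L hL
    have h := hsize k L hL
    exact ((mul_inv_le_iff₀ (by positivity)).2 h.1.1).trans
      (sides_le_diam hL.lt.1.le hL.lt.2.le).1
  have hcmp : ∀ k j : ℕ, δ * (2 ^ k)⁻¹ ≤ M * W * (2 ^ j)⁻¹ → j ≤ k + e := by
    intro k j h
    have h1 : δ * (2 ^ k)⁻¹ ≤ δ * 2 ^ e * (2 ^ j)⁻¹ :=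
      h.trans (mul_le_mul_of_nonneg_right he (by positivity))
    rw [mul_assoc, mul_le_mul_iff_right₀ hδ, le_mul_inv_iff₀ (by positivity),
      inv_mul_le_iff₀ (by positivity), ← pow_add] at h1
    exact (pow_le_pow_iff_right₀ (by norm_num)).1 h1
  have hdP : Metric.diam (elementPatch T₀.domain T K) ≤ M * W * (2 ^ l)⁻¹ := by
    rw [mul_assoc]
    exact (hdiam K hK hKP).trans (mul_le_mul_of_nonneg_left (hupper l K hl) hM)
  refine ⟨fun L hL hLP k hk => ⟨?_, ?_⟩, fun v hv v' hv' => ?_, fun v hv v' hv' => ?_⟩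
  · by_contra hcon
    -- compare `L` with the whole patch in both directions
    have h1 : δ * (2 ^ l)⁻¹ ≤ M * W * (2 ^ k)⁻¹ := by
      rw [mul_assoc M]
      exact (hlower l K hl).trans ((Metric.diam_mono hKP hPb).trans ((hdiam L hL hLP).trans
        (mul_le_mul_of_nonneg_left (hupper k L hk) hM)))
    exact hcon (hcmp l k h1)
  · exact hcmp k l ((hlower k L hk).trans ((Metric.diam_mono hLP hPb).trans hdP))
  · have h := (Metric.dist_le_diam_of_mem hPb hv hv').trans hdP
    rw [Prod.dist_eq, max_le_iff] at h
    exact h.1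
  · have h := (Metric.dist_le_diam_of_mem hPb hv hv').trans hdP
    rw [Prod.dist_eq, max_le_iff] at h
    exact h.2

lemma Grid.eq_node {m : ℕ} {v : ℝ × ℝ} (h : Grid T₀ m v) :
    v.1 ∈ range (node T₀.lineX m) ∧ v.2 ∈ range (node T₀.lineY m) := by
  obtain ⟨i, j, rfl⟩ := h
  exact ⟨⟨i, rfl⟩, ⟨j, rfl⟩⟩

lemma IsCell.mem_range_node {l m : ℕ} {L : Rect} (hL : IsCell T₀ l L) (hlm : l ≤ m) :
    (L.x₀ ∈ range (node T₀.lineX m) ∧ L.x₁ ∈ range (node T₀.lineX m)) ∧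
      L.y₀ ∈ range (node T₀.lineY m) ∧ L.y₁ ∈ range (node T₀.lineY m) := by
  have h1 := ((hL.grid_of_mem_corners
    (mem_corners_iff.2 ⟨Or.inl rfl, Or.inl rfl⟩ : (L.x₀, L.y₀) ∈ L.corners)).mono hlm).eq_node
  have h2 := ((hL.grid_of_mem_corners
    (mem_corners_iff.2 ⟨Or.inr rfl, Or.inr rfl⟩ : (L.x₁, L.y₁) ∈ L.corners)).mono hlm).eq_node
  exact ⟨⟨h1.1, h2.1⟩, h1.2, h2.2⟩

lemma node_gap {δ W : ℝ} (hsize : ∀ l K, IsCell T₀ l K →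
      (δ ≤ (K.x₁ - K.x₀) * 2 ^ l ∧ (K.x₁ - K.x₀) * 2 ^ l ≤ W) ∧
        (δ ≤ (K.y₁ - K.y₀) * 2 ^ l ∧ (K.y₁ - K.y₀) * 2 ^ l ≤ W)) {m : ℕ} {s t : ℝ} (hst : s < t) :
    (s ∈ range (node T₀.lineX m) → t ∈ range (node T₀.lineX m) → δ * (2 ^ m)⁻¹ ≤ t - s) ∧
      (s ∈ range (node T₀.lineY m) → t ∈ range (node T₀.lineY m) → δ * (2 ^ m)⁻¹ ≤ t - s) := by
  constructor
  · rintro ⟨i, rfl⟩ ⟨j, rfl⟩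
    have hmono := node_strictMono (lineX_strictMono T₀) m
    have hij : i + 1 ≤ j := hmono.lt_iff_lt.1 hst
    have h := (hsize m (T₀.cell m i 0) ⟨i, 0, rfl⟩).1.1
    have h1 : δ * (2 ^ m)⁻¹ ≤ node T₀.lineX m (i + 1) - node T₀.lineX m i :=
      (mul_inv_le_iff₀ (by positivity)).2 h
    linarith [hmono.monotone hij]
  · rintro ⟨i, rfl⟩ ⟨j, rfl⟩
    have hmono := node_strictMono (lineY_strictMono T₀) m
    have hij : i + 1 ≤ j := hmono.lt_iff_lt.1 hst
    have h := (hsize m (T₀.cell m 0 i) ⟨0, i, rfl⟩).2.1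
    have h1 : δ * (2 ^ m)⁻¹ ≤ node T₀.lineY m (i + 1) - node T₀.lineY m i :=
      (mul_inv_le_iff₀ (by positivity)).2 h
    linarith [hmono.monotone hij]

lemma max_mem' {A : Set ℝ} {s t : ℝ} (hs : s ∈ A) (ht : t ∈ A) : max s t ∈ A := by
  rcases max_choice s t with h | h <;> rwa [h]

lemma min_mem' {A : Set ℝ} {s t : ℝ} (hs : s ∈ A) (ht : t ∈ A) : min s t ∈ A := by
  rcases min_choice s t with h | h <;> rwa [h]

/-- The sides of the rectangle `Q` lie between `σ` and `τ`. -/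
def SidesIn (σ τ : ℝ) (Q : Rect) : Prop :=
  (σ ≤ Q.x₁ - Q.x₀ ∧ Q.x₁ - Q.x₀ ≤ τ) ∧ σ ≤ Q.y₁ - Q.y₀ ∧ Q.y₁ - Q.y₀ ≤ τ

/-- Two elements with a common edge segment are bridged by a rectangle in their union that has a
rectangle in common with each of them. -/
lemma EdgeAdj.exists_bridge {L N : Rect} (h : EdgeAdj L N) {σ τ : ℝ} (hL : SidesIn σ τ L)
    (hN : SidesIn σ τ N) (hσ : 0 < σ)
    (hgx : N.x₀ < L.x₁ → L.x₀ < N.x₁ → σ ≤ min L.x₁ N.x₁ - max L.x₀ N.x₀)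
    (hgy : N.y₀ < L.y₁ → L.y₀ < N.y₁ → σ ≤ min L.y₁ N.y₁ - max L.y₀ N.y₀) :
    ∃ D Q Q' : Rect, SidesIn σ (2 * τ) D ∧ SidesIn σ (2 * τ) Q ∧ SidesIn σ (2 * τ) Q' ∧
      D.carrier ⊆ L.carrier ∪ N.carrier ∧ Q.carrier ⊆ D.carrier ∩ L.carrier ∧
      Q'.carrier ⊆ D.carrier ∩ N.carrier := by
  obtain ⟨⟨hL1, hL2⟩, hL3, hL4⟩ := hL
  obtain ⟨⟨hN1, hN2⟩, hN3, hN4⟩ := hN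
  have a1 := min_le_left L.x₁ N.x₁
  have a2 := min_le_right L.x₁ N.x₁
  have a3 := le_max_left L.x₀ N.x₀
  have a4 := le_max_right L.x₀ N.x₀
  have b1 := min_le_left L.y₁ N.y₁
  have b2 := min_le_right L.y₁ N.y₁
  have b3 := le_max_left L.y₀ N.y₀
  have b4 := le_max_right L.y₀ N.y₀
  rcases h with ⟨hy, h1, h2⟩ | ⟨hx, h1, h2⟩
  · have hg := hgx h2 h1
    refine ⟨⟨max L.x₀ N.x₀, min L.x₁ N.x₁, min L.y₀ N.y₀, max L.y₁ N.y₁⟩,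
      ⟨max L.x₀ N.x₀, min L.x₁ N.x₁, L.y₀, L.y₁⟩,
      ⟨max L.x₀ N.x₀, min L.x₁ N.x₁, N.y₀, N.y₁⟩, ⟨⟨hg, by linarith⟩, ?_, ?_⟩,
      ⟨⟨hg, by linarith⟩, hL3, by linarith⟩, ⟨⟨hg, by linarith⟩, hN3, by linarith⟩, ?_, ?_, ?_⟩
    · linarith [min_le_left L.y₀ N.y₀, le_max_left L.y₁ N.y₁]
    · rcases hy with hy | hy
      · simp only [min_eq_left (by linarith : L.y₀ ≤ N.y₀), max_eq_right (by linarith : L.y₁ ≤ N.y₁)]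
        linarith
      · simp only [min_eq_right (by linarith : N.y₀ ≤ L.y₀), max_eq_left (by linarith : N.y₁ ≤ L.y₁)]
        linarith
    · rintro v ⟨⟨p1, p2⟩, p3, p4⟩
      simp only at p1 p2 p3 p4
      rcases hy with hy | hy
      · rw [min_eq_left (by linarith)] at p3
        rw [max_eq_right (by linarith)] at p4
        rcases le_total v.2 L.y₁ with hv | hv
        · exact Or.inl ⟨⟨by linarith, by linarith⟩, p3, hv⟩
        · exact Or.inr ⟨⟨by linarith, by linarith⟩, by linarith, p4⟩
      · rw [min_eq_right (by linarith)] at p3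
        rw [max_eq_left (by linarith)] at p4
        rcases le_total v.2 N.y₁ with hv | hv
        · exact Or.inr ⟨⟨by linarith, by linarith⟩, p3, hv⟩
        · exact Or.inl ⟨⟨by linarith, by linarith⟩, by linarith, p4⟩
    · rintro v ⟨⟨p1, p2⟩, p3, p4⟩
      exact ⟨⟨⟨p1, p2⟩, (min_le_left _ _).trans p3, p4.trans (le_max_left _ _)⟩,
        ⟨a3.trans p1, p2.trans a1⟩, p3, p4⟩
    · rintro v ⟨⟨p1, p2⟩, p3, p4⟩
      exact ⟨⟨⟨p1, p2⟩, (min_le_right _ _).trans p3, p4.trans (le_max_right _ _)⟩,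
        ⟨a4.trans p1, p2.trans a2⟩, p3, p4⟩
  · have hg := hgy h2 h1
    refine ⟨⟨min L.x₀ N.x₀, max L.x₁ N.x₁, max L.y₀ N.y₀, min L.y₁ N.y₁⟩,
      ⟨L.x₀, L.x₁, max L.y₀ N.y₀, min L.y₁ N.y₁⟩,
      ⟨N.x₀, N.x₁, max L.y₀ N.y₀, min L.y₁ N.y₁⟩, ⟨⟨?_, ?_⟩, hg, by linarith⟩,
      ⟨⟨hL1, by linarith⟩, hg, by linarith⟩, ⟨⟨hN1, by linarith⟩, hg, by linarith⟩, ?_, ?_, ?_⟩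
    · linarith [min_le_left L.x₀ N.x₀, le_max_left L.x₁ N.x₁]
    · rcases hx with hx | hx
      · simp only [min_eq_left (by linarith : L.x₀ ≤ N.x₀), max_eq_right (by linarith : L.x₁ ≤ N.x₁)]
        linarith
      · simp only [min_eq_right (by linarith : N.x₀ ≤ L.x₀), max_eq_left (by linarith : N.x₁ ≤ L.x₁)]
        linarith
    · rintro v ⟨⟨p1, p2⟩, p3, p4⟩
      simp only at p1 p2 p3 p4
      rcases hx with hx | hx
      · rw [min_eq_left (by linarith)] at p1
        rw [max_eq_right (by linarith)] at p2
        rcases le_total v.1 L.x₁ with hv | hv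
        · exact Or.inl ⟨⟨p1, hv⟩, by linarith, by linarith⟩
        · exact Or.inr ⟨⟨by linarith, p2⟩, by linarith, by linarith⟩
      · rw [min_eq_right (by linarith)] at p1
        rw [max_eq_left (by linarith)] at p2
        rcases le_total v.1 N.x₁ with hv | hv
        · exact Or.inr ⟨⟨p1, hv⟩, by linarith, by linarith⟩
        · exact Or.inl ⟨⟨by linarith, p2⟩, by linarith, by linarith⟩
    · rintro v ⟨⟨p1, p2⟩, p3, p4⟩
      exact ⟨⟨⟨(min_le_left _ _).trans p1, p2.trans (le_max_left _ _)⟩, p3, p4⟩,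
        ⟨p1, p2⟩, b3.trans p3, p4.trans b1⟩
    · rintro v ⟨⟨p1, p2⟩, p3, p4⟩
      exact ⟨⟨⟨(min_le_right _ _).trans p1, p2.trans (le_max_right _ _)⟩, p3, p4⟩,
        ⟨p1, p2⟩, b4.trans p3, p4.trans b2⟩

/-! ### Quartic approximations along chains of elements -/

/-- An invariant that weakens with every step holds after at most as many steps as there are
elements. -/
lemma of_reflTransGen_of_card {α : Type*} {r : α → α → Prop} {A : Finset α}
    (hA : ∀ a b, r a b → b ∈ A) {p : ℕ → α → Prop} (hmono : ∀ n a, p n a → p (n + 1) a)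
    (hstep : ∀ n a b, p n a → r a b → p (n + 1) b) {a b : α} (ha : a ∈ A) (h0 : p 0 a)
    (hab : Relation.ReflTransGen r a b) : p A.card b := by
  classical
  have hmono' : ∀ m n, m ≤ n → ∀ x, p m x → p n x := fun m n hmn x hx => by
    induction n, hmn using Nat.le_induction with
    | base => exact hx
    | succ n _ ih => exact hmono n x ih
  by_contra hcon
  -- the set of elements reached grows strictly in each step
  have hgrow : ∀ n ≤ A.card, n + 1 ≤ (A.filter (p n)).card := by
    intro n hn
    induction n with
    | zero => exact Finset.card_pos.2 ⟨a, Finset.mem_filter.2 ⟨ha, h0⟩⟩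
    | succ n ih =>
      refine (Nat.succ_le_succ (ih (by omega))).trans (Finset.card_lt_card ?_)
      refine (Finset.ssubset_iff_subset_ne).2
        ⟨Finset.monotone_filter_right A fun x hx => hmono n x, fun heq => ?_⟩
      have hclosed : ∀ x, Relation.ReflTransGen r a x → p n x := by
        intro x hx
        induction hx with
        | refl => exact hmono' 0 n (Nat.zero_le n) a h0
        | tail _ hxy ih' =>
          have := Finset.mem_filter.2 ⟨hA _ _ hxy, hstep n _ _ ih' hxy⟩
          rw [← heq] at this
          exact (Finset.mem_filter.1 this).2
      exact hcon (hmono' n _ (by omega) b (hclosed b hab))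
  have := (hgrow A.card le_rfl).trans (Finset.card_filter_le _ _)
  omega

/-- Quartics that are close on a rectangle are close at a distance of the same scale. -/
lemma exists_scaled_growth_bound {σ : ℝ} (hσ : 0 < σ) (ρ : ℝ) : ∃ C : ℝ, 0 ≤ C ∧
    ∀ c c', IsQuarticCoeff c → IsQuarticCoeff c' → ∀ (Q : Rect) (η E : ℝ), 0 < η → 0 ≤ E →
      σ * η ≤ Q.x₁ - Q.x₀ → σ * η ≤ Q.y₁ - Q.y₀ →
      (∀ p ∈ Q.carrier, |poly 5 c 0 0 p - poly 5 c' 0 0 p| ≤ E) →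
      ∀ v : ℝ × ℝ, |v.1 - Q.x₀| ≤ ρ * η → |v.2 - Q.y₀| ≤ ρ * η →
        |poly 5 c 0 0 v - poly 5 c' 0 0 v| ≤ C * E := by
  obtain ⟨C, hC0, hC⟩ := exists_growth_bound
  have hR : 1 ≤ max 1 (ρ / σ) := le_max_left _ _
  refine ⟨C * max 1 (ρ / σ) ^ 8, by positivity, fun c c' hc hc' Q η E hη hE hx hy h v h1 h2 => ?_⟩
  rw [← poly_sub]
  have hση : 0 < σ * η := mul_pos hσ hη
  have hlen : ∀ a, σ * η ≤ a → ρ * η ≤ max 1 (ρ / σ) * a := by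
    intro a ha
    calc ρ * η = ρ / σ * (σ * η) := by field_simp
      _ ≤ max 1 (ρ / σ) * a :=
        mul_le_mul (le_max_right _ _) ha hση.le (zero_le_one.trans hR)
  refine hC _ (hc.sub hc') (Q.x₀, Q.y₀) _ _ E _ (hση.trans_le hx) (hση.trans_le hy) hE hR
    (fun p hp1 hp2 => ?_) v (h1.trans (hlen _ hx)) (h2.trans (hlen _ hy))
  rw [poly_sub]
  exact h p ⟨by simpa using hp1, by simpa using hp2⟩

/-- The Bramble–Hilbert lemma on rectangles of size comparable with `η`. -/
lemma exists_scaled_quartic_approx {σ : ℝ} (hσ : 0 < σ) (τ : ℝ) : ∃ C : ℝ, 0 ≤ C ∧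
    ∀ (U : Set (ℝ × ℝ)) (u : ℝ × ℝ → ℝ), IsOpen U → MemSobolev 5 U u → ∀ (R : Rect) (η : ℝ), 0 < η →
      SidesIn (σ * η) (τ * η) R → interior R.carrier ⊆ U → ContinuousOn u R.carrier →
      ∃ c, IsQuarticCoeff c ∧
        (∀ p ∈ R.carrier, |u p - poly 5 c 0 0 p| ≤ C * η ^ 4 * (sobolevNorm 5 U u).toReal) ∧
        ∀ a b, a + b = 1 → eLpNorm (fun v => weakDeriv U a b u v - poly 5 c a b v) 2
          (volume.restrict R.carrier)
            ≤ ENNReal.ofReal (C * η ^ 4 * (sobolevNorm 5 U u).toReal) := by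
  refine ⟨max (2 ^ 7 * |τ| ^ 5 / σ) (16 * τ ^ 4), le_max_of_le_right (by positivity),
    fun U u hU hu R η hη hR hRU huc => ?_⟩
  obtain ⟨⟨h1, h2⟩, h3, h4⟩ := hR
  have hση : 0 < σ * η := mul_pos hσ hη
  have hx : R.x₀ < R.x₁ := sub_pos.1 (hση.trans_le h1)
  have hy : R.y₀ < R.y₁ := sub_pos.1 (hση.trans_le h3)
  obtain ⟨c, hc, hsup, hgrad⟩ := exists_quartic_approx hU hu hx hy hRU huc h2 h4
  set S := (sobolevNorm 5 U u).toReal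
  have hS : 0 ≤ S := ENNReal.toReal_nonneg
  have hτ : 0 < τ := by
    have : 0 < τ * η := (sub_pos.2 hx).trans_le h2
    exact pos_of_mul_pos_left this hη.le
  refine ⟨c, hc, fun p hp => ?_, fun a b hab => (hgrad a b hab).trans (ENNReal.ofReal_le_ofReal ?_)⟩
  · have hlow : (σ * η) ^ 2 ≤ (R.x₁ - R.x₀) * (R.y₁ - R.y₀) := by
      rw [sq]
      exact mul_le_mul h1 h3 hση.le (sub_pos.2 hx).le
    have hsq : (|u p - poly 5 c 0 0 p| * (σ * η)) ^ 2 ≤ (2 ^ 7 * (τ * η) ^ 5 * S) ^ 2 := by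
      rw [mul_pow, sq_abs]
      calc _ ≤ _ := mul_le_mul_of_nonneg_left hlow (sq_nonneg _)
        _ ≤ _ := hsup p hp
        _ = _ := by ring
    have h5 := (sq_le_sq₀ (by positivity) (by positivity)).1 hsq
    have h6 : |u p - poly 5 c 0 0 p| ≤ 2 ^ 7 * |τ| ^ 5 / σ * η ^ 4 * S := by
      rw [abs_of_pos hτ, ← mul_le_mul_iff_left₀ hση]
      calc _ ≤ _ := h5
        _ = _ := by field_simp
    refine h6.trans ?_
    gcongr
    exact le_max_left _ _
  · calc (4 * (τ * η) ^ 2) ^ 2 * S = 16 * τ ^ 4 * η ^ 4 * S := by ring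
      _ ≤ _ := by
        gcongr
        exact le_max_right _ _

end

section

variable {T₀ : TensorMesh} {T : Finset Rect}

lemma IsCell.sidesIn_of_level_close {δ W : ℝ} (hδ : 0 < δ) (hsize : ∀ l K, IsCell T₀ l K →
      (δ ≤ (K.x₁ - K.x₀) * 2 ^ l ∧ (K.x₁ - K.x₀) * 2 ^ l ≤ W) ∧
        (δ ≤ (K.y₁ - K.y₀) * 2 ^ l ∧ (K.y₁ - K.y₀) * 2 ^ l ≤ W))
    {k l e : ℕ} (h1 : k ≤ l + e) (h2 : l ≤ k + e) {L : Rect} (hL : IsCell T₀ k L) :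
    SidesIn (δ / 2 ^ e * (2 ^ l)⁻¹) (W * 2 ^ e * (2 ^ l)⁻¹) L := by
  have hW : 0 < W := hδ.trans_le ((hsize k L hL).1.1.trans (hsize k L hL).1.2)
  have hlow : δ / 2 ^ e * (2 ^ l)⁻¹ ≤ δ * (2 ^ k)⁻¹ := by
    rw [div_eq_mul_inv, mul_assoc, ← mul_inv, ← pow_add, add_comm e l]
    gcongr
    norm_num
  have hup : W * (2 ^ k)⁻¹ ≤ W * 2 ^ e * (2 ^ l)⁻¹ := by
    rw [mul_assoc]
    gcongr
    rw [le_mul_inv_iff₀ (by positivity), inv_mul_le_iff₀ (by positivity), ← pow_add]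
    gcongr
    norm_num
  have h := hsize k L hL
  exact ⟨⟨hlow.trans ((mul_inv_le_iff₀ (by positivity)).2 h.1.1),
    ((le_mul_inv_iff₀ (by positivity)).2 h.1.2).trans hup⟩,
    hlow.trans ((mul_inv_le_iff₀ (by positivity)).2 h.2.1),
    ((le_mul_inv_iff₀ (by positivity)).2 h.2.2).trans hup⟩

open scoped Classical in
lemma IsUniformPatch.card_le (hT : IsDyadic T₀ T) {P : Set (ℝ × ℝ)} {l e : ℕ} {ρ : ℝ}
    (hP : IsUniformPatch T₀ T P l e ρ) {F : Finset (ℝ × ℝ)}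
    (hF : ∀ v w, Grid T₀ (l + e) v → Grid T₀ (l + e) w →
      |w.1 - v.1| * 2 ^ l ≤ ρ → |w.2 - v.2| * 2 ^ l ≤ ρ →
      ((w.1 - v.1) * 2 ^ l, (w.2 - v.2) * 2 ^ l) ∈ F) {K : Rect} (hK : K ∈ T)
    (hKP : K.carrier ⊆ P) : (T.filter fun L => L.carrier ⊆ P).card ≤ F.card ^ 2 := by
  rw [sq, ← Finset.card_product]
  have hg : ∀ L ∈ T, L.carrier ⊆ P → ∀ v ∈ L.corners, Grid T₀ (l + e) v ∧ v ∈ P := by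
    intro L hL hLP v hv
    obtain ⟨k, hk⟩ := hT.isCell L hL
    exact ⟨(hk.grid_of_mem_corners hv).mono (hP.level L hL hLP k hk).1, hLP (hT.corner_mem hL hv)⟩
  have hoff : ∀ v w, Grid T₀ (l + e) v ∧ v ∈ P → Grid T₀ (l + e) w ∧ w ∈ P →
      ((w.1 - v.1) * 2 ^ l, (w.2 - v.2) * 2 ^ l) ∈ F := fun v w hv hw =>
    hF v w hv.1 hw.1 ((le_mul_inv_iff₀ (by positivity)).1 (hP.dist_fst w hw.2 v hv.2))
      ((le_mul_inv_iff₀ (by positivity)).1 (hP.dist_snd w hw.2 v hv.2))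
  have hK0 := hg K hK hKP (K.x₀, K.y₀) (mem_corners_iff.2 ⟨Or.inl rfl, Or.inl rfl⟩)
  refine Finset.card_le_card_of_injOn (fun L =>
    (((L.x₀ - K.x₀) * 2 ^ l, (L.y₀ - K.y₀) * 2 ^ l),
      ((L.x₁ - K.x₀) * 2 ^ l, (L.y₁ - K.y₀) * 2 ^ l))) (fun L hL => ?_) ?_
  · obtain ⟨hL, hLP⟩ := Finset.mem_filter.1 hL
    exact Finset.mem_product.2 ⟨hoff _ (L.x₀, L.y₀) hK0
        (hg L hL hLP _ (mem_corners_iff.2 ⟨Or.inl rfl, Or.inl rfl⟩)),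
      hoff _ (L.x₁, L.y₁) hK0 (hg L hL hLP _ (mem_corners_iff.2 ⟨Or.inr rfl, Or.inr rfl⟩))⟩
  · intro L _ N _ h
    have h2 : (2 : ℝ) ^ l ≠ 0 := by positivity
    simp only [Prod.mk.injEq, mul_left_inj' h2, sub_left_inj] at h
    exact Rect.ext h.1.1 h.2.1 h.1.2 h.2.2

/-- The quartic approximation on an element approximates to the same order at all sampling points
of active vertices: quartics on adjacent elements are compared on a bridging rectangle. -/
lemma exists_quartic_near {δ W : ℝ} (hδ : 0 < δ) (hsize : ∀ l K, IsCell T₀ l K →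
      (δ ≤ (K.x₁ - K.x₀) * 2 ^ l ∧ (K.x₁ - K.x₀) * 2 ^ l ≤ W) ∧
        (δ ≤ (K.y₁ - K.y₀) * 2 ^ l ∧ (K.y₁ - K.y₀) * 2 ^ l ≤ W)) (e : ℕ) (ρ : ℝ) :
    ∃ C : ℝ, 0 ≤ C ∧ ∀ T : Finset Rect, IsDyadic T₀ T →
      DeterminesQuartics (basisVertices T₀.domain T) → ∀ K ∈ T, ∀ l,
      IsUniformPatch T₀ T (elementPatch T₀.domain T K) l e ρ → ∀ u : ℝ × ℝ → ℝ,
      ContinuousOn u (elementPatch T₀.domain T K) →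
      MemSobolev 5 (interior (elementPatch T₀.domain T K)) u →
      ∃ c, IsQuarticCoeff c ∧
        (∀ a b, a + b = 1 →
          eLpNorm (fun v => weakDeriv (interior (elementPatch T₀.domain T K)) a b u v
            - poly 5 c a b v) 2 (volume.restrict K.carrier) ≤ ENNReal.ofReal (C * ((2 ^ l)⁻¹) ^ 4
              * (sobolevNorm 5 (interior (elementPatch T₀.domain T K)) u).toReal)) ∧
        ∀ z, IsActive T₀.domain T K z → ∀ b ∈ vertexPatch T₀.domain T z,
          |u b - poly 5 c 0 0 b| ≤ C * ((2 ^ l)⁻¹) ^ 4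
            * (sobolevNorm 5 (interior (elementPatch T₀.domain T K)) u).toReal := by
  classical
  have hσ : 0 < δ / 2 ^ e := by positivity
  obtain ⟨A, hA0, hA⟩ := exists_scaled_quartic_approx hσ (2 * (W * 2 ^ e))
  obtain ⟨G, hG0, hG⟩ := exists_scaled_growth_bound hσ ρ
  obtain ⟨F, hF⟩ := exists_finite_offsets T₀ e ρ
  refine ⟨A + F.card ^ 2 * (4 * G * A), by positivity,
    fun T hT hdet K hK l hP u huc hu => ?_⟩
  set P := elementPatch T₀.domain T K with hPdef
  set S := (sobolevNorm 5 (interior P) u).toReal with hS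
  have hS0 : 0 ≤ S := ENNReal.toReal_nonneg
  have hη : (0 : ℝ) < (2 ^ l)⁻¹ := by positivity
  set η : ℝ := (2 ^ l)⁻¹ with hηdef
  have hKP : K.carrier ⊆ P := hT.self_subset_elementPatch hdet hK
  have happ : ∀ R : Rect, R.carrier ⊆ P → SidesIn (δ / 2 ^ e * η) (2 * (W * 2 ^ e) * η) R → _ :=
    fun R hR hside => hA (interior P) u isOpen_interior hu R η hη hside (interior_mono hR)
      (huc.mono hR)
  have hsides : ∀ L ∈ T, L.carrier ⊆ P → SidesIn (δ / 2 ^ e * η) (W * 2 ^ e * η) L := by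
    intro L hL hLP
    obtain ⟨k, hk⟩ := hT.isCell L hL
    have := hP.level L hL hLP k hk
    exact IsCell.sidesIn_of_level_close hδ hsize this.1 this.2 hk
  have hW2 : ∀ {L : Rect}, SidesIn (δ / 2 ^ e * η) (W * 2 ^ e * η) L →
      SidesIn (δ / 2 ^ e * η) (2 * (W * 2 ^ e) * η) L := by
    rintro L ⟨⟨h1, h2⟩, h3, h4⟩
    have : 0 < δ / 2 ^ e * η := mul_pos hσ hη
    exact ⟨⟨h1, by linarith⟩, h3, by linarith⟩
  have hex : ∀ L : Rect, ∃ c, L ∈ T ∧ L.carrier ⊆ P → IsQuarticCoeff c ∧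
      (∀ p ∈ L.carrier, |u p - poly 5 c 0 0 p| ≤ A * η ^ 4 * S) ∧
      ∀ a b, a + b = 1 → eLpNorm (fun v => weakDeriv (interior P) a b u v - poly 5 c a b v) 2
          (volume.restrict L.carrier) ≤ ENNReal.ofReal (A * η ^ 4 * S) := by
    intro L
    by_cases hL : L ∈ T ∧ L.carrier ⊆ P
    · obtain ⟨c, hc⟩ := happ L hL.2 (hW2 (hsides L hL.1 hL.2))
      exact ⟨c, fun _ => hc⟩
    · exact ⟨fun _ _ => 0, fun h => absurd h hL⟩
  choose c hc using hex
  have hE0 : 0 ≤ A * η ^ 4 * S := by positivity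
  set E := A * η ^ 4 * S with hE
  -- comparison of the approximations on adjacent elements
  have hadj : ∀ L N, AdjIn T P L N → ∀ v ∈ P,
      |poly 5 (c N) 0 0 v - poly 5 (c L) 0 0 v| ≤ 4 * G * E := by
    rintro L N ⟨hL, hN, hLN⟩ v hv
    obtain ⟨k, hk⟩ := hT.isCell L hL.1
    obtain ⟨k', hk'⟩ := hT.isCell N hN.1
    have hr := hk.mem_range_node (hP.level L hL.1 hL.2 k hk).1
    have hr' := hk'.mem_range_node (hP.level N hN.1 hN.2 k' hk').1
    have hση : δ * (2 ^ (l + e))⁻¹ = δ / 2 ^ e * η := by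
      rw [hηdef, pow_add]
      field_simp
    obtain ⟨D, Q, Q', hD, hQ, hQ', hDLN, hQD, hQ'D⟩ := hLN.exists_bridge (hsides L hL.1 hL.2)
      (hsides N hN.1 hN.2) (mul_pos hσ hη) (fun h1 h2 => by
        rw [← hση]
        exact (node_gap hsize (max_lt (lt_min hk.lt.1 h2) (lt_min h1 hk'.lt.1))).1
          (max_mem' hr.1.1 hr'.1.1) (min_mem' hr.1.2 hr'.1.2)) (fun h1 h2 => by
        rw [← hση]
        exact (node_gap hsize (max_lt (lt_min hk.lt.2 h2) (lt_min h1 hk'.lt.2))).2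
          (max_mem' hr.2.1 hr'.2.1) (min_mem' hr.2.2 hr'.2.2))
    have hDP : D.carrier ⊆ P := hDLN.trans (union_subset hL.2 hN.2)
    rw [← mul_assoc] at hD
    obtain ⟨d, hd, hdD, -⟩ := happ D hDP hD
    have hcmp : ∀ (R : Rect), R ∈ T ∧ R.carrier ⊆ P → ∀ Q : Rect,
        SidesIn (δ / 2 ^ e * η) (2 * (W * 2 ^ e * η)) Q → Q.carrier ⊆ D.carrier ∩ R.carrier →
        |poly 5 (c R) 0 0 v - poly 5 d 0 0 v| ≤ G * (2 * E) := by
      intro R hR Q hQ hQDR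
      have hQ0 : (Q.x₀, Q.y₀) ∈ Q.carrier := by
        have : 0 < δ / 2 ^ e * η := mul_pos hσ hη
        exact ⟨⟨le_rfl, by linarith [hQ.1.1]⟩, le_rfl, by linarith [hQ.2.1]⟩
      have hQP := hR.2 (hQDR hQ0).2
      refine hG _ _ (hc R hR).1 hd Q η (2 * E) hη (by positivity) hQ.1.1 hQ.2.1 (fun p hp => ?_) v
        (hP.dist_fst v hv _ hQP) (hP.dist_snd v hv _ hQP)
      have h1 := (hc R hR).2.1 p (hQDR hp).2
      have h2 := hdD p (hQDR hp).1
      rw [abs_le] at h1 h2 ⊢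
      constructor <;> linarith [h1.1, h1.2, h2.1, h2.2]
    have h1 := hcmp L hL Q hQ hQD
    have h2 := hcmp N hN Q' hQ' hQ'D
    rw [abs_le] at h1 h2 ⊢
    constructor <;> linarith [h1.1, h1.2, h2.1, h2.2]
  have hΘ : 0 ≤ 4 * G * E := by positivity
  have hAE : A * η ^ 4 * S ≤ (A + F.card ^ 2 * (4 * G * A)) * η ^ 4 * S := by
    gcongr
    exact le_add_of_nonneg_right (by positivity)
  refine ⟨c K, (hc K ⟨hK, hKP⟩).1, fun a b hab => ((hc K ⟨hK, hKP⟩).2.2 a b hab).trans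
    (ENNReal.ofReal_le_ofReal hAE), fun z hz b hb => ?_⟩
  obtain ⟨N, hN, hbN, hNP, hconn⟩ := hT.exists_connIn_elementPatch hdet hK hz hb
  have hcard := hP.card_le hT (hF l) hK hKP
  have hchain := of_reflTransGen_of_card (A := T.filter fun L => L.carrier ⊆ P)
    (p := fun n L => ∀ v ∈ P, |poly 5 (c L) 0 0 v - poly 5 (c K) 0 0 v| ≤ n * (4 * G * E))
    (fun L N h => Finset.mem_filter.2 h.2.1)
    (fun n L h v hv => (h v hv).trans (mul_le_mul_of_nonneg_right (by simp) hΘ))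
    (fun n L N h hLN v hv => by
      have h1 := h v hv
      have h2 := hadj L N hLN v hv
      push_cast
      rw [abs_le] at h1 h2 ⊢
      constructor <;> linarith [h1.1, h1.2, h2.1, h2.2])
    (Finset.mem_filter.2 ⟨hK, hKP⟩) (fun v _ => by simp) hconn b (hNP hbN)
  have h1 := (hc N ⟨hN, hNP⟩).2.1 b hbN
  have h2 : ((T.filter fun L => L.carrier ⊆ P).card : ℝ) * (4 * G * E)
      ≤ (F.card : ℝ) ^ 2 * (4 * G * E) :=
    mul_le_mul_of_nonneg_right (by exact_mod_cast hcard) hΘ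
  have h3 : (A + F.card ^ 2 * (4 * G * A)) * η ^ 4 * S = E + (F.card : ℝ) ^ 2 * (4 * G * E) := by
    rw [hE]
    ring
  rw [h3]
  rw [abs_le] at h1 hchain ⊢
  constructor <;> linarith [h1.1, h1.2, hchain.1, hchain.2]

/-! ### Stability of the least-squares fits -/

lemma IsDyadic.interp_eq (hT : IsDyadic T₀ T) (u : ℝ × ℝ → ℝ) {b : ℝ × ℝ}
    (hb : b ∈ basisVertices T₀.domain T) : interp T₀.domain T u b = u b := by
  have h := congrFun ((hT.interpSpline_spec (geom T₀.domain u)).2 b hb) 0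
  exact h

lemma IsDyadic.samplingPoints_subset (hT : IsDyadic T₀ T)
    (hdet : DeterminesQuartics (basisVertices T₀.domain T)) {K : Rect} (hK : K ∈ T) {l e : ℕ} {ρ : ℝ}
    (hP : IsUniformPatch T₀ T (elementPatch T₀.domain T K) l e ρ) {z : ℝ × ℝ}
    (hz : IsActive T₀.domain T K z) {b : ℝ × ℝ} (hb : b ∈ vertexPatch T₀.domain T z)
    (hbb : b ∈ basisVertices T₀.domain T) :
    Grid T₀ (l + e) b ∧ b ∈ elementPatch T₀.domain T K := by
  obtain ⟨N, hN, hbN, hNP, -⟩ := hT.exists_connIn_elementPatch hdet hK hz hb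
  obtain ⟨k, hk⟩ := hT.isCell N hN
  exact ⟨(hk.grid_of_mem_corners (hT.mem_corners_of_basis hbb hN hbN)).mono
    (hP.level N hN hNP k hk).1, hNP hbN⟩

/-- The derivatives of the fit at an active vertex inherit the approximation order of the data,
since the scaled sampling sets come from a finite collection of unisolvent sets. -/
lemma exists_fit_bound (T₀ : TensorMesh) (e : ℕ) (ρ : ℝ) : ∃ C : ℝ, 0 ≤ C ∧
    ∀ T : Finset Rect, IsDyadic T₀ T → DeterminesQuartics (basisVertices T₀.domain T) →
      ∀ K ∈ T, ∀ l, IsUniformPatch T₀ T (elementPatch T₀.domain T K) l e ρ →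
      ∀ z, IsActive T₀.domain T K z → ∀ c, IsQuarticCoeff c → ∀ (u : ℝ × ℝ → ℝ) (X : ℝ), 0 ≤ X →
      (∀ b ∈ samplingPoints T₀.domain T z, |u b - poly 5 c 0 0 b| ≤ X) →
      ∃ c', IsQuarticCoeff c' ∧
        (∀ v, fit T₀.domain T (interp T₀.domain T u) z v = poly 5 c' 0 0 v) ∧
        ∀ i ≤ 2, ∀ j ≤ 2,
          ((2 ^ l)⁻¹) ^ (i + j) * |poly 5 c' i j z - poly 5 c i j z| ≤ C * X := by
  classical
  obtain ⟨F, hF⟩ := exists_finite_offsets T₀ e ρ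
  obtain ⟨B, hB0, hB⟩ := exists_uniform_bound F
  refine ⟨4 * (B * (F.card + 1)), by positivity,
    fun T hT hdet K hK l hP z hz c hc u X hX hu => ?_⟩
  have hη : (0 : ℝ) < 2 ^ l := by positivity
  obtain ⟨c', hc', hfit⟩ := isQuartic_iff.1 (fit_spec T₀.domain T (interp T₀.domain T u) z).1
  refine ⟨c', hc', hfit, ?_⟩
  have hzΩ := hT.basisVertices_subset hz.1
  have hzP : Grid T₀ (l + e) z ∧ z ∈ elementPatch T₀.domain T K := by
    obtain ⟨L, hL, hzL⟩ := hT.cover z hzΩ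
    exact hT.samplingPoints_subset hdet hK hP hz (hT.carrier_subset_vertexPatch hdet hzΩ hL hzL hzL)
      hz.1
  let θ : ℝ × ℝ → ℝ × ℝ := fun b => ((b.1 - z.1) * 2 ^ l, (b.2 - z.2) * 2 ^ l)
  have hθ : Function.Injective θ := by
    intro b b' h
    simp only [θ, Prod.mk.injEq, mul_left_inj' hη.ne', sub_left_inj] at h
    exact Prod.ext h.1 h.2
  have hSF : (samplingPoints T₀.domain T z).image θ ⊆ F := by
    intro w hw
    obtain ⟨b, hb, rfl⟩ := Finset.mem_image.1 hw
    obtain ⟨hbb, hbz⟩ := mem_layerPoints.1 hb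
    have hbP := hT.samplingPoints_subset hdet hK hP hz hbz hbb
    exact hF l z b hzP.1 hbP.1 ((le_mul_inv_iff₀ hη).1 (hP.dist_fst b hbP.2 z hzP.2))
      ((le_mul_inv_iff₀ hη).1 (hP.dist_snd b hbP.2 z hzP.2))
  have hdetS : DeterminesQuartics ((samplingPoints T₀.domain T z).image θ) := by
    intro p hp h0 v
    obtain ⟨a, ha, hpa⟩ := isQuartic_iff.1 hp
    have h1 := hT.determines_samplingPoints hdet hzΩ
      (poly 5 (taylorCoeff a (-z.1 * 2 ^ l, -z.2 * 2 ^ l) (2 ^ l) (2 ^ l)) 0 0)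
      (isQuartic_iff.2 ⟨_, ha.taylor _ _ _, fun _ => rfl⟩) (fun b hb => by
        have h2 := h0 (θ b) (Finset.mem_image_of_mem θ hb)
        rw [hpa] at h2
        rw [poly_taylor, ← h2]
        congr 1
        ext <;> simp only [θ] <;> ring) (z.1 + v.1 / 2 ^ l, z.2 + v.2 / 2 ^ l)
    rw [poly_taylor] at h1
    rw [hpa, ← h1]
    congr 1
    ext <;> simp only <;> field_simp <;> ring
  have hcard : (samplingPoints T₀.domain T z).card ≤ F.card := by
    rw [← Finset.card_image_of_injective _ hθ]
    exact Finset.card_le_card hSF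
  have hd := hc'.sub hc
  have hco := hB _ hSF hdetS _ (hd.taylor z (2 ^ l)⁻¹ (2 ^ l)⁻¹) ((F.card + 1) * X)
    (by positivity) (fun w hw => by
      obtain ⟨b, hb, rfl⟩ := Finset.mem_image.1 hw
      have e1 : ((z.1 + (2 ^ l)⁻¹ * (θ b).1, z.2 + (2 ^ l)⁻¹ * (θ b).2) : ℝ × ℝ) = b := by
        ext <;> simp only [θ] <;> field_simp <;> ring
      rw [poly_taylor, e1, poly_sub, ← hfit]
      refine (abs_fit_sub_le (isQuartic_iff.2 ⟨c, hc, fun _ => rfl⟩) (E := X) (fun b' hb' => ?_)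
        hb).trans ?_
      · rw [hT.interp_eq u (mem_layerPoints.1 hb').1, abs_sub_comm]
        exact hu b' hb'
      · gcongr)
  intro i hi j hj
  have h := hco i j
  rw [taylorCoeff, poly_sub, ← pow_add, abs_mul, abs_of_nonneg (by positivity),
    div_mul_eq_mul_div, div_le_iff₀ (by positivity)] at h
  have hfac : ((i.factorial : ℝ) * j.factorial) ≤ 4 := by
    have h1 : i.factorial ≤ 2 := Nat.factorial_le hi
    have h2 : j.factorial ≤ 2 := Nat.factorial_le hj
    have := Nat.mul_le_mul h1 h2
    exact_mod_cast this
  calc _ ≤ B * ((F.card + 1) * X) * (i.factorial * j.factorial) := h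
    _ ≤ B * ((F.card + 1) * X) * 4 := by gcongr
    _ = _ := by ring

/-! ### Comparison of the recovered gradient with the quartic -/

lemma dx_of_eqOn {Ω : Rect} (hΩ : Ω.x₀ < Ω.x₁) {f : ℝ × ℝ → ℝ} {N a b : ℕ} {c : ℕ → ℕ → ℝ}
    (hf : ∀ v ∈ Ω.carrier, f v = poly N c a b v) {v : ℝ × ℝ} (hv : v ∈ Ω.carrier) :
    dx Ω f v = poly N c (a + 1) b v := by
  rw [dx, derivWithin_congr (f₁ := fun t => f (t, v.2)) (f := fun t => poly N c a b (t, v.2))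
    (fun t ht => hf (t, v.2) ⟨ht, hv.2⟩) (hf v hv)]
  exact (hasDerivAt_poly_fst N c a b v.1 v.2).hasDerivWithinAt.derivWithin
    (uniqueDiffOn_Icc hΩ v.1 hv.1)

lemma dy_of_eqOn {Ω : Rect} (hΩ : Ω.y₀ < Ω.y₁) {f : ℝ × ℝ → ℝ} {N a b : ℕ} {c : ℕ → ℕ → ℝ}
    (hf : ∀ v ∈ Ω.carrier, f v = poly N c a b v) {v : ℝ × ℝ} (hv : v ∈ Ω.carrier) :
    dy Ω f v = poly N c a (b + 1) v := by
  rw [dy, derivWithin_congr (f₁ := fun t => f (v.1, t)) (f := fun t => poly N c a b (v.1, t))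
    (fun t ht => hf (v.1, t) ⟨hv.1, ht⟩) (hf v hv)]
  exact (hasDerivAt_poly_snd N c a b v.1 v.2).hasDerivWithinAt.derivWithin
    (uniqueDiffOn_Icc hΩ v.2 hv.2)

lemma geom_of_eqOn {Ω : Rect} (hΩ : Ω.x₀ < Ω.x₁ ∧ Ω.y₀ < Ω.y₁) {f : ℝ × ℝ → ℝ} {N a b : ℕ}
    {c : ℕ → ℕ → ℝ} (hf : ∀ v ∈ Ω.carrier, f v = poly N c a b v) {v : ℝ × ℝ}
    (hv : v ∈ Ω.carrier) :
    geom Ω f v = ![poly N c a b v, poly N c (a + 1) b v, poly N c a (b + 1) v,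
      poly N c (a + 1) (b + 1) v] := by
  rw [geom, hf v hv, dx_of_eqOn hΩ.1 hf hv, dy_of_eqOn hΩ.2 hf hv,
    dx_of_eqOn hΩ.1 (fun w hw => dy_of_eqOn hΩ.2 hf hw) hv]

/-- The first derivatives of a quartic polynomial are bicubic. -/
lemma isSpline_poly (Ω : Rect) (T : Finset Rect) {c : ℕ → ℕ → ℝ} (hc : IsQuarticCoeff c) {a b : ℕ}
    (hab : a + b = 1) : IsSpline Ω T (poly 5 c a b) := by
  refine ⟨(contDiff_poly 5 c a b 1).contDiffOn, fun K _ => ?_⟩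
  obtain ⟨rfl, rfl⟩ | ⟨rfl, rfl⟩ : (a = 1 ∧ b = 0) ∨ (a = 0 ∧ b = 1) := by omega
  · refine ⟨fun i j => (i + 1) * c (i + 1) j, fun v _ => ?_⟩
    rw [poly, Finset.sum_range_succ']
    simp only [Nat.zero_descFactorial_succ, Nat.cast_zero, zero_mul, mul_zero,
      Finset.sum_const_zero, add_zero]
    refine Finset.sum_congr rfl fun i _ => ?_
    rw [Finset.sum_range_succ, hc (i + 1) 4 (by omega)]
    simp only [Nat.descFactorial_one, Nat.descFactorial_zero, add_tsub_cancel_right, tsub_zero,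
      zero_mul, add_zero, Nat.cast_add, Nat.cast_one, one_mul]
    exact Finset.sum_congr rfl fun j _ => by ring
  · refine ⟨fun i j => (j + 1) * c i (j + 1), fun v _ => ?_⟩
    rw [poly, Finset.sum_range_succ]
    have h4 : ∑ j ∈ Finset.range 5, c 4 j * ((Nat.descFactorial 4 0 : ℝ) * v.1 ^ (4 - 0))
        * ((j.descFactorial 1 : ℝ) * v.2 ^ (j - 1)) = 0 := by
      refine Finset.sum_eq_zero fun j _ => ?_
      rcases j with _ | j
      · simp
      · rw [hc 4 (j + 1) (by omega), zero_mul, zero_mul]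
    rw [h4, add_zero]
    refine Finset.sum_congr rfl fun i _ => ?_
    rw [Finset.sum_range_succ']
    simp only [Nat.cast_zero, zero_mul, mul_zero, add_zero, Nat.descFactorial_one, Nat.descFactorial_zero, add_tsub_cancel_right, tsub_zero,
      Nat.cast_add, Nat.cast_one, one_mul]
    exact Finset.sum_congr rfl fun j _ => by ring

/-- A spline is bounded on an element by its data at the active vertices. -/
lemma exists_spline_bound {δ W : ℝ} (hδ : 0 < δ) (hsize : ∀ l K, IsCell T₀ l K →
      (δ ≤ (K.x₁ - K.x₀) * 2 ^ l ∧ (K.x₁ - K.x₀) * 2 ^ l ≤ W) ∧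
        (δ ≤ (K.y₁ - K.y₀) * 2 ^ l ∧ (K.y₁ - K.y₀) * 2 ^ l ≤ W)) (e : ℕ) (ρ : ℝ) :
    ∃ C : ℝ, 0 ≤ C ∧ ∀ T : Finset Rect, IsDyadic T₀ T →
      DeterminesQuartics (basisVertices T₀.domain T) → ∀ K ∈ T, ∀ l, IsCell T₀ l K →
      IsUniformPatch T₀ T (elementPatch T₀.domain T K) l e ρ → ∀ s, IsSpline T₀.domain T s →
      ∀ D, 0 ≤ D → (∀ z, IsActive T₀.domain T K z → JetLE (2 ^ l)⁻¹ D (geom T₀.domain s z)) →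
      ∀ v ∈ K.carrier, |s v| ≤ C * D := by
  have hκ1 : 1 ≤ max 1 (max (W * 2 ^ e) δ⁻¹) := le_max_left _ _
  have hκW : W * 2 ^ e ≤ max 1 (max (W * 2 ^ e) δ⁻¹) :=
    (le_max_left _ _).trans (le_max_right _ _)
  have hκδ : δ⁻¹ ≤ max 1 (max (W * 2 ^ e) δ⁻¹) := (le_max_right _ _).trans (le_max_right _ _)
  set κ := max 1 (max (W * 2 ^ e) δ⁻¹)
  have hκ0 : 0 < κ := zero_lt_one.trans_le hκ1
  refine ⟨8 * κ * (8 * κ * (8 * κ) ^ e), by positivity,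
    fun T hT hdet K hK l hl hP s hs D hD hsD v hv => ?_⟩
  have hη : (0 : ℝ) < (2 ^ l)⁻¹ := by positivity
  obtain ⟨t, ht, hts, htA, htI⟩ := hs.exists_active_part hT hK
  have hsz : ∀ L ∈ T, ∀ k, IsCell T₀ k L → l - e ≤ k → k ≤ l →
      (L.x₁ - L.x₀ ≤ κ * (2 ^ l)⁻¹ ∧ L.y₁ - L.y₀ ≤ κ * (2 ^ l)⁻¹) ∧
      ((2 ^ l)⁻¹ ≤ κ * (L.x₁ - L.x₀) ∧ (2 ^ l)⁻¹ ≤ κ * (L.y₁ - L.y₀)) := by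
    intro L _ k hk h1 h2
    have hup := IsCell.sidesIn_of_level_close hδ hsize (e := e) (by omega : k ≤ l + e)
      (by omega : l ≤ k + e) hk
    have hlow := IsCell.sidesIn_of_level_close hδ hsize (e := l - k) (l := k) le_self_add le_self_add hk
    have hmul : W * 2 ^ e * (2 ^ l)⁻¹ ≤ κ * (2 ^ l)⁻¹ := mul_le_mul_of_nonneg_right hκW hη.le
    have hside : ∀ a : ℝ, 0 < a → δ ≤ a * 2 ^ k → (2 ^ l)⁻¹ ≤ κ * a := by
      intro a ha0 ha
      have h3 : (2 : ℝ) ^ k ≤ 2 ^ l := pow_le_pow_right₀ (by norm_num) h2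
      have h4 : δ ≤ a * 2 ^ l := ha.trans (mul_le_mul_of_nonneg_left h3 ha0.le)
      calc (2 ^ l : ℝ)⁻¹ = δ⁻¹ * (δ * (2 ^ l)⁻¹) := by field_simp
        _ ≤ κ * a := mul_le_mul hκδ ((mul_inv_le_iff₀ (by positivity)).2 h4)
          (by positivity) hκ0.le
    exact ⟨⟨hup.1.2.trans hmul, hup.2.2.trans hmul⟩,
      hside _ (sub_pos.2 hk.lt.1) (hsize k L hk).1.1,
      hside _ (sub_pos.2 hk.lt.2) (hsize k L hk).2.1⟩
  have hcorner : ∀ w ∈ K.corners, JetLE (2 ^ l)⁻¹ ((8 * κ) ^ e * D) (geom T₀.domain t w) := by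
    intro w hw
    have h := ht.jetLE_of_data hT (A := {z | IsActive T₀.domain T K z}) (m := l - e) (l := l) hη hκ1
      hD htI (fun z hz hzA => by rw [htA z hz hzA]; exact hsD z hzA)
      (fun z hz hzA L hL k hk hzL => by
        have hLP := hT.carrier_subset_elementPatch hdet hzA hL (hT.corner_mem hL hzL)
        have := (hP.level L hL hLP k hk).2
        omega) hsz l le_rfl (mem_vertices_iff.2 ⟨K, hK, hw⟩) (hl.grid_of_mem_corners hw)
    refine h.mono (mul_le_mul_of_nonneg_right ?_ hD)
    exact pow_le_pow_right₀ (by linarith) (by omega)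
  obtain ⟨c, hc⟩ := ht.exists_poly hK
  have hK' := hsz K hK l hl (Nat.sub_le l e) le_rfl
  have hj := jetLE_of_corners (c := c) hη hκ1 hl.lt.1 hl.lt.2 hK'.1.1 hK'.1.2 hK'.2.1 hK'.2.2
    (fun w hw => by
      rw [← ht.geom_eq_jet hT hK hc (hT.corner_mem hK hw)]
      exact hcorner w hw) hv
  rw [← hts v hv, hc v hv]
  refine hj.1.trans (le_of_eq ?_)
  ring

/-- One component of the recovered gradient is close to the derivative of a quartic that is close
to `u` at the sampling points. -/
lemma exists_recovered_bound {δ W : ℝ} (hδ : 0 < δ) (hsize : ∀ l K, IsCell T₀ l K →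
      (δ ≤ (K.x₁ - K.x₀) * 2 ^ l ∧ (K.x₁ - K.x₀) * 2 ^ l ≤ W) ∧
        (δ ≤ (K.y₁ - K.y₀) * 2 ^ l ∧ (K.y₁ - K.y₀) * 2 ^ l ≤ W)) (e : ℕ) (ρ : ℝ) :
    ∃ C : ℝ, 0 ≤ C ∧ ∀ T : Finset Rect, IsDyadic T₀ T →
      DeterminesQuartics (basisVertices T₀.domain T) → ∀ K ∈ T, ∀ l, IsCell T₀ l K →
      IsUniformPatch T₀ T (elementPatch T₀.domain T K) l e ρ →
      ∀ c, IsQuarticCoeff c → ∀ (u : ℝ × ℝ → ℝ) (X : ℝ), 0 ≤ X →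
      (∀ z, IsActive T₀.domain T K z → ∀ b ∈ vertexPatch T₀.domain T z,
        |u b - poly 5 c 0 0 b| ≤ X) →
      ∀ v ∈ K.carrier,
        |interpSpline T₀.domain T (fun z => geom T₀.domain
          (dx T₀.domain (fit T₀.domain T (interp T₀.domain T u) z)) z) v - poly 5 c 1 0 v|
            ≤ C * (2 ^ l * X) ∧
        |interpSpline T₀.domain T (fun z => geom T₀.domain
          (dy T₀.domain (fit T₀.domain T (interp T₀.domain T u) z)) z) v - poly 5 c 0 1 v|
            ≤ C * (2 ^ l * X) := by
  obtain ⟨A, hA0, hA⟩ := exists_spline_bound hδ hsize e ρ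
  obtain ⟨B, hB0, hB⟩ := exists_fit_bound T₀ e ρ
  refine ⟨A * B, by positivity, fun T hT hdet K hK l hl hP c hc u X hX hu v hv => ?_⟩
  have hη : (0 : ℝ) < (2 ^ l)⁻¹ := by positivity
  set η : ℝ := (2 ^ l)⁻¹ with hηdef
  have hΩ := domain_lt T₀
  have key : ∀ (a b : ℕ), a + b = 1 → ∀ d : (ℝ × ℝ → ℝ) → ℝ × ℝ → ℝ,
      (∀ c' f, (∀ v, f v = poly 5 c' 0 0 v) → ∀ v ∈ T₀.domain.carrier, d f v = poly 5 c' a b v) →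
      |interpSpline T₀.domain T (fun z => geom T₀.domain
        (d (fit T₀.domain T (interp T₀.domain T u) z)) z) v - poly 5 c a b v|
          ≤ A * B * (2 ^ l * X) := by
    intro a b hab d hd
    obtain ⟨hG, hGz⟩ := hT.interpSpline_spec fun z => geom T₀.domain
      (d (fit T₀.domain T (interp T₀.domain T u) z)) z
    have hq := isSpline_poly T₀.domain T hc hab
    have h := hA T hT hdet K hK l hl hP _ (hG.sub hq) (2 ^ l * (B * X)) (by positivity)
      (fun z hz => by
        have hzΩ := hT.basisVertices_subset hz.1
        obtain ⟨c', hc', hfit, hder⟩ := hB T hT hdet K hK l hP z hz c hc u X hX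
          fun b hb => hu z hz b (mem_layerPoints.1 hb).2
        rw [hG.geom_sub hT hq hzΩ, hGz z hz.1, geom_of_eqOn hΩ (hd c' _ hfit) hzΩ,
          geom_of_eqOn hΩ (fun _ _ => rfl) hzΩ]
        -- all orders of differentiation carry one power of `η` more than in `JetLE`
        have hone : ∀ k i j : ℕ, i ≤ 2 → j ≤ 2 → i + j = k + 1 →
            η ^ k * |poly 5 c' i j z - poly 5 c i j z| ≤ 2 ^ l * (B * X) := by
          intro k i j hi hj hij
          have hd := hder i hi j hj
          rw [hij] at hd
          have : η ^ k * |poly 5 c' i j z - poly 5 c i j z|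
              = 2 ^ l * (η ^ (k + 1) * |poly 5 c' i j z - poly 5 c i j z|) := by
            rw [hηdef, pow_succ]
            field_simp
          rw [this]
          exact mul_le_mul_of_nonneg_left hd (by positivity)
        have h1 := hone 0 a b (by omega) (by omega) (by omega)
        have h2 := hone 1 (a + 1) b (by omega) (by omega) (by omega)
        have h3 := hone 1 a (b + 1) (by omega) (by omega) (by omega)
        have h4 := hone 2 (a + 1) (b + 1) (by omega) (by omega) (by omega)
        rw [pow_zero, one_mul] at h1
        rw [pow_one] at h2 h3
        exact ⟨h1, h2, h3, h4⟩) v hv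
    refine h.trans (le_of_eq ?_)
    ring
  exact ⟨key 1 0 rfl (dx T₀.domain) fun c' f hf v hv => dx_of_eqOn hΩ.1 (fun w _ => hf w) hv,
    key 0 1 rfl (dy T₀.domain) fun c' f hf v hv => dy_of_eqOn hΩ.2 (fun w _ => hf w) hv⟩

end

/-! ### The error estimate in `L²` -/

lemma norm_euclidean_two_le (x : EuclideanSpace ℝ (Fin 2)) : ‖x‖ ≤ |x 0| + |x 1| := by
  rw [EuclideanSpace.norm_eq, Real.sqrt_le_left (by positivity)]
  simp only [Fin.sum_univ_two, Real.norm_eq_abs]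
  nlinarith [mul_nonneg (abs_nonneg (x 0)) (abs_nonneg (x 1))]

lemma diam_le_meshSize {T : Finset Rect} {K : Rect} (hK : K ∈ T) :
    Metric.diam K.carrier ≤ meshSize T :=
  le_csSup ((T.finite_toSet.image _).bddAbove) ⟨K, hK, rfl⟩

/-- The `L²` norm of a constant on a rectangle with sides at most `d`. -/
lemma eLpNorm_const_carrier_le {K : Rect} (hx : K.x₀ ≤ K.x₁) {d : ℝ}
    (h1 : K.x₁ - K.x₀ ≤ d) (h2 : K.y₁ - K.y₀ ≤ d) {r : ℝ} (hr : 0 ≤ r) :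
    eLpNorm (fun _ : ℝ × ℝ => r) 2 (volume.restrict K.carrier) ≤ ENNReal.ofReal (r * d) := by
  have hd : 0 ≤ d := (sub_nonneg.2 hx).trans h1
  have hvol : volume.restrict K.carrier univ ≤ ENNReal.ofReal d ^ 2 := by
    rw [Measure.restrict_apply_univ, Rect.carrier, Measure.volume_eq_prod, Measure.prod_prod,
      Real.volume_Icc, Real.volume_Icc, sq]
    exact mul_le_mul' (ENNReal.ofReal_le_ofReal h1) (ENNReal.ofReal_le_ofReal h2)
  refine (eLpNorm_le_of_ae_bound (C := r) (Filter.Eventually.of_forall fun _ => by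
    rw [Real.norm_of_nonneg hr])).trans ?_
  rw [ENNReal.ofReal_mul hr, mul_comm]
  refine mul_le_mul' le_rfl ((ENNReal.rpow_le_rpow hvol (by positivity)).trans (le_of_eq ?_))
  rw [← ENNReal.rpow_natCast, ← ENNReal.rpow_mul]
  norm_num

end

end PHT

theorem theorem3p4 (T₀ : PHT.TensorMesh) (M : ℝ) :
    ∃ C : ℝ, ∀ T : Finset PHT.Rect, PHT.IsHierarchical T₀ T →
      PHT.DeterminesQuartics (PHT.basisVertices T₀.domain T) →
      ∀ K ∈ T,
        (∀ K' ∈ T, K'.carrier ⊆ PHT.elementPatch T₀.domain T K →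
          Metric.diam (PHT.elementPatch T₀.domain T K) ≤ M * Metric.diam K'.carrier) →
      ∀ u : ℝ × ℝ → ℝ, ContinuousOn u (PHT.elementPatch T₀.domain T K) →
        PHT.MemSobolev 5 (interior (PHT.elementPatch T₀.domain T K)) u →
        MeasureTheory.eLpNorm
            (fun v => PHT.weakGradient (interior (PHT.elementPatch T₀.domain T K)) u v
              - PHT.recoveredGradient T₀.domain T (PHT.interp T₀.domain T u) v)
            2 (MeasureTheory.volume.restrict K.carrier)
          ≤ ENNReal.ofReal (C * PHT.meshSize T ^ 4)
            * PHT.sobolevNorm 5 (interior (PHT.elementPatch T₀.domain T K)) u := by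
  open PHT in
  obtain ⟨δ, W, hδ, hδW, hsize⟩ := exists_cell_size T₀
  have hW : 0 < W := hδ.trans_le hδW
  obtain ⟨e, he⟩ : ∃ e : ℕ, max M 0 * W ≤ δ * 2 ^ e := by
    obtain ⟨e, he⟩ := pow_unbounded_of_one_lt (max M 0 * W / δ) (by norm_num : (1 : ℝ) < 2)
    exact ⟨e, by rw [div_lt_iff₀ hδ] at he; linarith⟩
  obtain ⟨A, hA0, hA⟩ := exists_quartic_near hδ hsize e (max M 0 * W)
  obtain ⟨B, hB0, hB⟩ := exists_recovered_bound hδ hsize e (max M 0 * W)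
  -- The factor `δ⁻⁴` passes from the scale `η` of `K` to the mesh size, since `δ η ≤ h`.
  refine ⟨(2 * A + 2 * (B * A) * W) / δ ^ 4, fun T hierT hdet K hK hdiam u huc hu => ?_⟩
  have hT := hierT.isDyadic
  obtain ⟨l, hl⟩ := hT.isCell K hK
  have hP := hT.isUniformPatch hdet hδ (le_max_right M 0) hsize he hK hl
    fun K' hK' hK'P => (hdiam K' hK' hK'P).trans
      (mul_le_mul_of_nonneg_right (le_max_left M 0) Metric.diam_nonneg)
  obtain ⟨c, hc, hgrad, hnear⟩ := hA T hT hdet K hK l hP u huc hu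
  have hKP := hT.self_subset_elementPatch hdet hK
  set P := elementPatch T₀.domain T K with hPdef
  set S := (sobolevNorm 5 (interior P) u).toReal with hS
  have hS0 : 0 ≤ S := ENNReal.toReal_nonneg
  have hSe : sobolevNorm 5 (interior P) u = ENNReal.ofReal S :=
    (ENNReal.ofReal_toReal hu.sobolevNorm_ne_top).symm
  set η : ℝ := (2 ^ l)⁻¹ with hηdef
  have hη : 0 < η := by positivity
  have hrec := hB T hT hdet K hK l hl hP c hc u (A * η ^ 4 * S) (by positivity) hnear
  set r : ℝ := B * (2 ^ l * (A * η ^ 4 * S)) with hr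
  have hr0 : 0 ≤ r := by positivity
  set f : ℝ × ℝ → ℝ := fun v => weakDeriv (interior P) 1 0 u v - poly 5 c 1 0 v with hf
  set g : ℝ × ℝ → ℝ := fun v => weakDeriv (interior P) 0 1 u v - poly 5 c 0 1 v with hg
  have hKm : MeasurableSet K.carrier := (isClosed_carrier K).measurableSet
  have hle : MeasureTheory.volume.restrict K.carrier
      ≤ MeasureTheory.volume.restrict (interior P) := by
    rw [← restrict_interior_carrier]
    exact MeasureTheory.Measure.restrict_mono (interior_mono hKP) le_rfl
  have hmeas : ∀ a b, a + b = 1 → MeasureTheory.AEStronglyMeasurable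
      (fun v => weakDeriv (interior P) a b u v - poly 5 c a b v)
      (MeasureTheory.volume.restrict K.carrier) := fun a b hab =>
    ((hu.isWeakDeriv (by omega : a + b ≤ 5)).1.1.mono_measure hle).sub
      (continuous_poly 5 c a b).aestronglyMeasurable
  -- The error splits into `∇(u - q)` and the difference between `∇q` and the recovered gradient,
  -- whose components are at most `r` on `K`.
  have hpt : ∀ᵐ v ∂MeasureTheory.volume.restrict K.carrier,
      ‖weakGradient (interior P) u v
        - recoveredGradient T₀.domain T (interp T₀.domain T u) v‖ ≤ |f v| + |g v| + 2 * r := by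
    filter_upwards [MeasureTheory.ae_restrict_mem hKm] with v hv
    obtain ⟨h1, h2⟩ := hrec v hv
    refine (norm_euclidean_two_le _).trans ?_
    have e1 : ∀ x y z : ℝ, |y - z| ≤ r → |x - y| ≤ |x - z| + r := fun x y z h => by
      have := abs_sub_le x z y
      rw [abs_sub_comm z y] at this
      linarith
    have h3 := e1 (weakDeriv (interior P) 1 0 u v) _ _ h1
    have h4 := e1 (weakDeriv (interior P) 0 1 u v) _ _ h2
    simp only [weakGradient, recoveredGradient, PiLp.sub_apply, Matrix.cons_val_zero,
      Matrix.cons_val_one, hf, hg]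
    linarith
  have hK1 : K.x₁ - K.x₀ ≤ W * η := (le_mul_inv_iff₀ (by positivity)).2 (hsize l K hl).1.2
  have hK2 : K.y₁ - K.y₀ ≤ W * η := (le_mul_inv_iff₀ (by positivity)).2 (hsize l K hl).2.2
  have hηh : η ≤ meshSize T / δ := by
    rw [le_div_iff₀ hδ, mul_comm]
    exact ((mul_inv_le_iff₀ (by positivity)).2 (hsize l K hl).1.1).trans
      ((sides_le_diam hl.lt.1.le hl.lt.2.le).1.trans (diam_le_meshSize hK))
  have h2l : (2 : ℝ) ^ l * η = 1 := mul_inv_cancel₀ (by positivity)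
  calc _ ≤ MeasureTheory.eLpNorm (fun v => |f v| + |g v| + 2 * r) 2
        (MeasureTheory.volume.restrict K.carrier) :=
        MeasureTheory.eLpNorm_mono_ae_real hpt
    _ ≤ MeasureTheory.eLpNorm f 2 (MeasureTheory.volume.restrict K.carrier)
        + MeasureTheory.eLpNorm g 2 (MeasureTheory.volume.restrict K.carrier)
        + MeasureTheory.eLpNorm (fun _ : ℝ × ℝ => 2 * r) 2
          (MeasureTheory.volume.restrict K.carrier) := by
        have hf' := (hmeas 1 0 rfl).norm
        have hg' := (hmeas 0 1 rfl).norm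
        refine (MeasureTheory.eLpNorm_add_le (hf'.add hg')
          MeasureTheory.aestronglyMeasurable_const (by norm_num)).trans ?_
        refine add_le_add ((MeasureTheory.eLpNorm_add_le hf' hg' (by norm_num)).trans ?_) le_rfl
        rw [MeasureTheory.eLpNorm_norm, MeasureTheory.eLpNorm_norm]
    _ ≤ ENNReal.ofReal (A * η ^ 4 * S) + ENNReal.ofReal (A * η ^ 4 * S)
        + ENNReal.ofReal (2 * r * (W * η)) :=
        add_le_add (add_le_add (hgrad 1 0 rfl) (hgrad 0 1 rfl))
          (eLpNorm_const_carrier_le hl.lt.1.le hK1 hK2 (by positivity))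
    _ = ENNReal.ofReal ((2 * A + 2 * (B * A) * W) * η ^ 4 * S) := by
        rw [← ENNReal.ofReal_add (by positivity) (by positivity),
          ← ENNReal.ofReal_add (by positivity) (by positivity)]
        congr 1
        rw [hr]
        linear_combination (2 * B * A * η ^ 4 * S * W) * h2l
    _ ≤ ENNReal.ofReal ((2 * A + 2 * (B * A) * W) * (meshSize T / δ) ^ 4 * S) := by
        gcongr
    _ = _ := by
        rw [hSe, ← ENNReal.ofReal_mul' hS0]
        congr 1
        ring
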